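/- Let $Q$ be a smooth manifold of dimension $n$, let $\tau:E\to Q$ be a smooth real vector bundle of rank $m$, and let $([\![\cdot,\cdot]\!],\rho)$ be a Lie algebroid structure on $E$, that is, a Lie bracket on the smooth sections of $E$ and a vector bundle map $\rho:E\to TQ$ with $[\![\sigma_1,f\sigma_2]\!]=f[\![\sigma_1,\sigma_2]\!]+(\rho(\sigma_1)f)\sigma_2$ for $f\in C^\infty(Q)$. Let $\pi:E^*\times\mathbb R\to Q$, $(b_q,s)\mapsto q$, and let $\mathcal T=\mathcal T^E(E^*\times\mathbb R)$ be the prolongation of $E$ over $\pi$: its fibre at $p$ is $\{(a,v)\in E_{\pi(p)}\times T_p(E^*\times\mathbb R):\rho(a)=T\pi(v)\}$, its anchor is $\rho^{*\pi}(a,v)=v$, and its bracket is determined by the Leibniz rule and $[\![(\sigma_1\circ\pi,X_1),(\sigma_2\circ\pi,X_2)]\!]^{*\pi}=([\![\sigma_1,\sigma_2]\!]\circ\pi,[X_1,X_2])$. Let $\mathrm d$ be the exterior differential of the Lie algebroid $\mathcal T$. Put $\Theta_{(b,s)}(a,v)=b(a)$, $\widetilde{\mathcal V}^s(a,v)=\mathrm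 ds(v)$ and $\eta=\widetilde{\mathcal V}^s-\Theta$. Then: 1. $\mathcal T$ has rank $2m+1$ and $\eta$ is a contact section of it: $\eta$ is smooth and $\eta\wedge(\mathrm d\eta)^m$ vanishes nowhere. There is a unique smooth section $\mathcal R$ of $\mathcal T$ (the Reeb section) with $i_{\mathcal R}\mathrm d\eta=0$ and $i_{\mathcal R}\eta=1$. 2. For every smooth function $H:E^*\times\mathbb R\to\mathbb R$ there is a unique smooth section $\xi_H$ of $\mathcal T$ (the Hamiltonian section) with $$i_{\xi_H}\eta=-H,\qquad i_{\xi_H}\mathrm d\eta=\mathrm dH-\rho^{*\pi}(\mathcal R)(H)\,\eta .$$ 3. Let $(q^i)$ be local coordinates on an open set $U\subseteq Q$, let $(e_\alpha)$ be a local basis of sections of $E$ on $U$, let $\rho^i_\alpha$ and $\mathcal C^\gamma_{\alpha\beta}$ be the structure functions, $\rho(e_\alpha)=\rho^i_\alpha\,\partial/\partial q^i$ and $[\![e_\alpha,e_\beta]\!]=\mathcal C^\gamma_{\alpha\beta}e_\gamma$, and let $(q^i,y_\alpha,s)$ be the induced coordinates on $\pi^{-1}(U)$, where $y_\alpha(b,s)=b(e_\alpha)$.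 If $\tilde c$ is an integral curve of $\xi_H$, that is, of the vector field $\rho^{*\pi}(\xi_H)$, then, wherever $\tilde c(t)=(c^i(t),c_\alpha(t),c_s(t))$ lies in $\pi^{-1}(U)$, $$\frac{\mathrm dc^i}{\mathrm dt}=\rho^i_\alpha\frac{\partial H}{\partial y_\alpha},\qquad \frac{\mathrm dc_\alpha}{\mathrm dt}=-\Big(\rho^i_\alpha\frac{\partial H}{\partial q^i}+\mathcal C^\gamma_{\alpha\beta}c_\gamma\frac{\partial H}{\partial y_\beta}+c_\alpha\frac{\partial H}{\partial s}\Big),\qquad \frac{\mathrm dc_s}{\mathrm dt}=c_\alpha\frac{\partial H}{\partial y_\alpha}-H,$$ with the right-hand sides evaluated at $\tilde c(t)$ and repeated indices summed. -/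

import Mathlib

set_option linter.unusedSectionVars false

open Bundle Set Filter VectorField
open scoped Manifold ContDiff Topology

namespace LieAlgebroid

section Calculus
variable {EM : Type*} [NormedAddCommGroup EM] [NormedSpace ℝ EM] [CompleteSpace EM]
  {HM : Type*} [TopologicalSpace HM] {I : ModelWithCorners ℝ EM HM} [I.Boundaryless]
  {M : Type*} [TopologicalSpace M] [ChartedSpace HM M] [IsManifold I ∞ M]

theorem two_le_inf : (2 : ℕ∞ω) ≤ ∞ :=
  WithTop.coe_le_coe.2 (le_top : (2 : ℕ∞) ≤ ⊤)

theorem mvfderiv_eq_fderiv_chart {f : M → ℝ} (x : M) {y : EM} (hy : y ∈ (extChartAt I x).target)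
    (hf : MDifferentiableAt I 𝓘(ℝ, ℝ) f ((extChartAt I x).symm y)) (V : ∀ z : M, TangentSpace I z) :
    mvfderiv I f ((extChartAt I x).symm y) (V ((extChartAt I x).symm y)) =
      fderiv ℝ (f ∘ (extChartAt I x).symm) y
        (mpullbackWithin 𝓘(ℝ, EM) I (extChartAt I x).symm V (range I) y) := by
  have hinv := isInvertible_mfderivWithin_extChartAt_symm (I := I) hy
  have hd : MDifferentiableWithinAt 𝓘(ℝ, EM) I (extChartAt I x).symm (range I) y :=
    mdifferentiableWithinAt_extChartAt_symm hy
  have h1 : mfderivWithin 𝓘(ℝ, EM) 𝓘(ℝ, ℝ) (f ∘ (extChartAt I x).symm) (range I) y =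
      (mfderiv I 𝓘(ℝ, ℝ) f ((extChartAt I x).symm y)).comp
        (mfderivWithin 𝓘(ℝ, EM) I (extChartAt I x).symm (range I) y) :=
    mfderiv_comp_mfderivWithin y hf hd (I.uniqueMDiffOn _ (extChartAt_target_subset_range x hy))
  have h2 : fderiv ℝ (f ∘ (extChartAt I x).symm) y =
      mfderivWithin 𝓘(ℝ, EM) 𝓘(ℝ, ℝ) (f ∘ (extChartAt I x).symm) (range I) y := by
    rw [I.range_eq_univ, mfderivWithin_univ, mfderiv_eq_fderiv]
  rw [h2, h1, mpullbackWithin_apply]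
  have h3 : (mfderivWithin 𝓘(ℝ, EM) I (extChartAt I x).symm (range I) y)
     ((mfderivWithin 𝓘(ℝ, EM) I (extChartAt I x).symm (range I) y).inverse (V ((extChartAt I x).symm y))) = V ((extChartAt I x).symm y) := by
    exact hinv.self_apply_inverse _
  show _ = (mfderiv I 𝓘(ℝ, ℝ) f ((extChartAt I x).symm y)) ((mfderivWithin 𝓘(ℝ, EM) I (extChartAt I x).symm (range I) y)
     ((mfderivWithin 𝓘(ℝ, EM) I (extChartAt I x).symm (range I) y).inverse (V ((extChartAt I x).symm y))))
  rw [h3]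
  rfl


theorem mvfderiv_eq_fderiv_chart_self {f : M → ℝ} {x : M} (hf : MDifferentiableAt I 𝓘(ℝ, ℝ) f x)
    (v : TangentSpace I x) :
    mvfderiv I f x v = fderiv ℝ (f ∘ (extChartAt I x).symm) (extChartAt I x x) v := by
  have : mfderiv I 𝓘(ℝ, ℝ) f x = fderiv ℝ (f ∘ (extChartAt I x).symm) (extChartAt I x x) := by
    rw [hf.mfderiv, I.range_eq_univ, fderivWithin_univ]
    rfl
  simp only [mvfderiv, this]
  rfl

/-- `[V, W] f = V (W f) - W (V f)`. -/
theorem mvfderiv_mlieBracket {f : M → ℝ} {x : M} {V W : ∀ z : M, TangentSpace I z}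
    (hf : ContMDiffAt I 𝓘(ℝ, ℝ) ∞ f x)
    (hV : MDifferentiableAt I I.tangent (fun z => (⟨z, V z⟩ : TangentBundle I M)) x)
    (hW : MDifferentiableAt I I.tangent (fun z => (⟨z, W z⟩ : TangentBundle I M)) x)
    (hfV : MDifferentiableAt I 𝓘(ℝ, ℝ) (fun z => mvfderiv I f z (V z)) x)
    (hfW : MDifferentiableAt I 𝓘(ℝ, ℝ) (fun z => mvfderiv I f z (W z)) x) :
    mvfderiv I f x (mlieBracket I V W x) =
      mvfderiv I (fun z => mvfderiv I f z (W z)) x (V x) -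
        mvfderiv I (fun z => mvfderiv I f z (V z)) x (W x) := by
  have : IsManifold I 2 M := IsManifold.of_le (n := ∞) (by exact two_le_inf)
  have hf1 : MDifferentiableAt I 𝓘(ℝ, ℝ) f x := hf.mdifferentiableAt (by simp)
  set y := extChartAt I x x with hy
  set g := f ∘ (extChartAt I x).symm with hg
  have hyt : y ∈ (extChartAt I x).target := mem_extChartAt_target x
  have htn : ∀ᶠ z in 𝓝 y, z ∈ (extChartAt I x).target := extChartAt_target_mem_nhds x
  -- smoothness of the chart representation
  have hgs : ContDiffAt ℝ ∞ g y := by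
    have h := (contMDiffAt_iff.1 hf).2
    rw [I.range_eq_univ, contDiffWithinAt_univ] at h
    exact h
  obtain ⟨pb, hpbd⟩ : ∃ pb : (∀ z : M, TangentSpace I z) → EM → EM, ∀ U z, pb U z =
      mpullbackWithin 𝓘(ℝ, EM) I (extChartAt I x).symm U (range I) z := ⟨_, fun _ _ => rfl⟩
  have key : ∀ U : ∀ z : M, TangentSpace I z,
      (fun z => mvfderiv I f z (U z)) ∘ (extChartAt I x).symm =ᶠ[𝓝 y]
      fun z => fderiv ℝ g z (pb U z) := by
    intro U
    have hd : ∀ᶠ z in 𝓝 x, MDifferentiableAt I 𝓘(ℝ, ℝ) f z := by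
      have : IsManifold I 1 M := IsManifold.of_le (n := ∞) (by exact_mod_cast (le_top : (1:ℕ∞) ≤ ⊤))
      have h1 : ContMDiffAt I 𝓘(ℝ, ℝ) 1 f x :=
        hf.of_le (by exact_mod_cast (le_top : (1:ℕ∞) ≤ ⊤))
      have h2 := (contMDiffAt_iff_contMDiffAt_nhds (by simp)).1 h1
      exact h2.mono fun z hz => hz.mdifferentiableAt one_ne_zero
    have hc : ContinuousAt (extChartAt I x).symm y := continuousAt_extChartAt_symm x
    have hx : (extChartAt I x).symm y = x := extChartAt_to_inv x
    have hd' : ∀ᶠ z in 𝓝 y, MDifferentiableAt I 𝓘(ℝ, ℝ) f ((extChartAt I x).symm z) :=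
      hc.eventually (by rw [hx]; exact hd)
    filter_upwards [htn, hd'] with z hz hz'
    rw [hpbd]
    exact mvfderiv_eq_fderiv_chart x hz hz' U
  have hpb : ∀ U : ∀ z : M, TangentSpace I z, pb U y = U x := by
    intro U
    rw [hpbd]
    have h1 : ∀ z, z = x → (U z : EM) = U x := by
      rintro _ rfl
      rfl
    exact (mfderivWithin_extChartAt_symm_inverse_apply (I := I) (x := x) _).trans (h1 _ (extChartAt_to_inv x))
  have hdiff : ∀ U : ∀ z : M, TangentSpace I z,
      MDifferentiableAt I I.tangent (fun z => (⟨z, U z⟩ : TangentBundle I M)) x →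
      DifferentiableAt ℝ (pb U) y := by
    intro U hU
    have := MDifferentiableWithinAt.differentiableWithinAt_mpullbackWithin_vectorField
      (s := univ) (hU.mdifferentiableWithinAt)
    have h2 : pb U = mpullbackWithin 𝓘(ℝ, EM) I (extChartAt I x).symm U (range I) :=
      funext (hpbd U)
    rw [preimage_univ, univ_inter] at this
    have h3 : DifferentiableWithinAt ℝ (pb U) (range I) y := h2 ▸ this
    rwa [I.range_eq_univ, differentiableWithinAt_univ] at h3
  have hbr : mlieBracket I V W x =
      fderiv ℝ (pb W) y (pb V y) - fderiv ℝ (pb V) y (pb W y) := by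
    have hV2 : pb V = mpullbackWithin 𝓘(ℝ, EM) I (extChartAt I x).symm V (range I) :=
      funext (hpbd V)
    have hW2 : pb W = mpullbackWithin 𝓘(ℝ, EM) I (extChartAt I x).symm W (range I) :=
      funext (hpbd W)
    have h3 : lieBracketWithin ℝ (pb V) (pb W)
        ((extChartAt I x).symm ⁻¹' univ ∩ range I) y =
          fderiv ℝ (pb W) y (pb V y) - fderiv ℝ (pb V) y (pb W y) := by
      rw [preimage_univ, univ_inter, I.range_eq_univ, lieBracketWithin_univ, lieBracket_eq]
    rw [← h3, hV2, hW2]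
    refine ((isInvertible_mfderiv_extChartAt (mem_extChartAt_source x)).inverse_apply_eq).2 ?_
    rw [mfderiv_extChartAt_self]
    rfl
  have hg' : DifferentiableAt ℝ (fderiv ℝ g) y :=
    (hgs.fderiv_right (m := 1) (by exact two_le_inf)).differentiableAt one_ne_zero
  have hsym := (hgs.isSymmSndFDerivAt (by simpa using two_le_inf)) (V x) (W x)
  have e1 : mvfderiv I (fun z => mvfderiv I f z (W z)) x (V x) =
      fderiv ℝ (fderiv ℝ g) y (V x) (W x) + fderiv ℝ g y (fderiv ℝ (pb W) y (V x)) := by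
    rw [mvfderiv_eq_fderiv_chart_self hfW, (key W).fderiv_eq,
      fderiv_clm_apply hg' (hdiff W hW), hpb W]
    exact add_comm _ _
  have e2 : mvfderiv I (fun z => mvfderiv I f z (V z)) x (W x) =
      fderiv ℝ (fderiv ℝ g) y (W x) (V x) + fderiv ℝ g y (fderiv ℝ (pb V) y (W x)) := by
    rw [mvfderiv_eq_fderiv_chart_self hfV, (key V).fderiv_eq,
      fderiv_clm_apply hg' (hdiff V hV), hpb V]
    exact add_comm _ _
  rw [e1, e2, hsym, mvfderiv_eq_fderiv_chart_self hf1, hbr, hpb, hpb]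
  exact (map_sub (fderiv ℝ g y) _ _).trans (by ring)
end Calculus

end LieAlgebroid

/-- `ℝⁿ`. -/
abbrev RVec (n : ℕ) := EuclideanSpace ℝ (Fin n)

/-- A Lie algebroid structure on a smooth real vector bundle `E` of rank `m` over a manifold `Q` of
dimension `n`: a Lie bracket on the smooth sections and a smooth bundle map `E → TQ` (the anchor)
satisfying `[σ, f τ] = f [σ, τ] + (anchor σ)(f) τ`. -/
structure LieAlgebroid (n m : ℕ) {Q : Type*} [TopologicalSpace Q] [ChartedSpace (RVec n) Q]
    [IsManifold (𝓡 n) ∞ Q]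
    (E : Q → Type*) [TopologicalSpace (TotalSpace (RVec m) E)]
    [∀ q, AddCommGroup (E q)] [∀ q, Module ℝ (E q)] [∀ q, TopologicalSpace (E q)]
    [∀ q, IsTopologicalAddGroup (E q)] [∀ q, ContinuousSMul ℝ (E q)]
    [FiberBundle (RVec m) E] [VectorBundle ℝ (RVec m) E]
    [ContMDiffVectorBundle ∞ (RVec m) E (𝓡 n)] where
  bracket : Cₛ^∞⟮𝓡 n; RVec m, E⟯ →ₗ[ℝ] Cₛ^∞⟮𝓡 n; RVec m, E⟯ →ₗ[ℝ] Cₛ^∞⟮𝓡 n; RVec m, E⟯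
  bracket_self : ∀ σ, bracket σ σ = 0
  jacobi : ∀ σ τ υ, bracket σ (bracket τ υ) + bracket τ (bracket υ σ) + bracket υ (bracket σ τ) = 0
  anchor : ∀ q, E q →ₗ[ℝ] TangentSpace (𝓡 n) q
  contMDiff_anchor : ContMDiff ((𝓡 n).prod 𝓘(ℝ, RVec m)) (𝓡 n).tangent ∞
    (fun a : TotalSpace (RVec m) E => (⟨a.proj, anchor a.proj a.2⟩ : TangentBundle (𝓡 n) Q))
  leibniz : ∀ (σ τ : Cₛ^∞⟮𝓡 n; RVec m, E⟯) (f : C^∞⟮𝓡 n, Q; ℝ⟯) (q : Q),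
    bracket σ ⟨fun q => f q • τ q, f.contMDiff.smul_section τ.contMDiff⟩ q =
      f q • bracket σ τ q + mvfderiv (𝓡 n) f q (anchor q (σ q)) • τ q

namespace LieAlgebroid

section Base
variable {n m : ℕ} {Q : Type*} [TopologicalSpace Q] [ChartedSpace (RVec n) Q]
  [IsManifold (𝓡 n) ∞ Q]
  {E : Q → Type*} [TopologicalSpace (TotalSpace (RVec m) E)]
  [∀ q, AddCommGroup (E q)] [∀ q, Module ℝ (E q)] [∀ q, TopologicalSpace (E q)]
  [∀ q, IsTopologicalAddGroup (E q)] [∀ q, ContinuousSMul ℝ (E q)]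
  [FiberBundle (RVec m) E] [VectorBundle ℝ (RVec m) E] [ContMDiffVectorBundle ∞ (RVec m) E (𝓡 n)]

open Classical in
/-- A global smooth section with the same germ at `q` as `s` (it exists if `s` is smooth near `q`). -/
noncomputable def extendGerm (s : ∀ q, E q) (q : Q) : Cₛ^∞⟮𝓡 n; RVec m, E⟯ :=
  if h : ∃ σ : Cₛ^∞⟮𝓡 n; RVec m, E⟯, ∀ᶠ q' in 𝓝 q, σ q' = s q' then h.choose else 0

/-- The value at `q` of the bracket of two sections that are smooth near `q`; the bracket is local, so
this does not depend on the chosen extensions of the germs. -/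
noncomputable def localBracket (A : LieAlgebroid n m E) (s t : ∀ q, E q) (q : Q) : E q :=
  A.bracket (extendGerm s q) (extendGerm t q) q

theorem extendGerm_eventuallyEq [T2Space Q] {s : ∀ q, E q} {q : Q} {U : Set Q} (hU : U ∈ 𝓝 q)
    (hs : ContMDiffOn (𝓡 n) ((𝓡 n).prod 𝓘(ℝ, RVec m)) ∞
      (fun q' => (⟨q', s q'⟩ : TotalSpace (RVec m) E)) U) :
    ∀ᶠ q' in 𝓝 q, extendGerm (n := n) (m := m) s q q' = s q' := by
  have h : ∃ σ : Cₛ^∞⟮𝓡 n; RVec m, E⟯, ∀ᶠ q' in 𝓝 q, σ q' = s q' := by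
    obtain ⟨f, -, hf⟩ := ((SmoothBumpFunction.nhds_basis_tsupport (I := 𝓡 n) q).mem_iff).1 (interior_mem_nhds.2 hU)
    refine ⟨⟨fun q' => f q' • s q', ?_⟩, ?_⟩
    · exact ContMDiffOn.smul_section_of_tsupport f.contMDiff.contMDiffOn isOpen_interior hf
        (hs.mono interior_subset)
    · filter_upwards [f.eventuallyEq_one] with q' hq'
      show f q' • s q' = s q'
      rw [hq', Pi.one_apply, one_smul]
  rw [extendGerm, dif_pos h]
  exact h.choose_spec

theorem tangent_ext [T2Space Q] {q : Q} {v w : TangentSpace (𝓡 n) q}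
    (h : ∀ f : C^∞⟮𝓡 n, Q; ℝ⟯, mvfderiv (𝓡 n) f q v = mvfderiv (𝓡 n) f q w) : v = w := by
  obtain ⟨χ, -, -⟩ := ((SmoothBumpFunction.nhds_basis_tsupport (I := 𝓡 n) q).mem_iff).1
    (univ_mem : univ ∈ 𝓝 q)
  have key : ∀ i : Fin n, ∃ f : C^∞⟮𝓡 n, Q; ℝ⟯,
      ∀ u : TangentSpace (𝓡 n) q, mvfderiv (𝓡 n) f q u = (EuclideanSpace.proj i : RVec n →L[ℝ] ℝ) u := by
    intro i
    have hs : ContMDiff (𝓡 n) 𝓘(ℝ, ℝ) ∞ (fun q' => χ q' • (extChartAt (𝓡 n) q q' i)) := by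
      refine χ.contMDiff_smul ?_
      have h1 : ContMDiffOn (𝓡 n) 𝓘(ℝ, RVec n) ∞ (extChartAt (𝓡 n) q) (chartAt (RVec n) q).source :=
        contMDiffOn_extChartAt
      exact ((EuclideanSpace.proj (𝕜 := ℝ) i).contMDiff (n := ∞)).comp_contMDiffOn h1
    refine ⟨⟨_, hs⟩, fun u => ?_⟩
    refine (mvfderiv_eq_fderiv_chart_self (hs.mdifferentiableAt (by simp)) u).trans ?_
    have he : (fun q' => χ q' • (extChartAt (𝓡 n) q q' i)) ∘ (extChartAt (𝓡 n) q).symm =ᶠ[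
        𝓝 (extChartAt (𝓡 n) q q)] fun y => (EuclideanSpace.proj (𝕜 := ℝ) i : RVec n →L[ℝ] ℝ) y := by
      have hc : ContinuousAt (extChartAt (𝓡 n) q).symm (extChartAt (𝓡 n) q q) :=
        continuousAt_extChartAt_symm q
      have h1 : ∀ᶠ y in 𝓝 (extChartAt (𝓡 n) q q), χ ((extChartAt (𝓡 n) q).symm y) = 1 :=
        hc.eventually (by rw [extChartAt_to_inv]; exact χ.eventuallyEq_one)
      filter_upwards [h1, extChartAt_target_mem_nhds q] with y hy hy'
      simp only [Function.comp_apply, hy, one_smul, (extChartAt (𝓡 n) q).right_inv hy']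
      rfl
    rw [he.fderiv_eq, ContinuousLinearMap.fderiv]
  have hcoord : ∀ i, (EuclideanSpace.proj i : RVec n →L[ℝ] ℝ) v =
      (EuclideanSpace.proj i : RVec n →L[ℝ] ℝ) w := fun i => by
    obtain ⟨f, hf⟩ := key i
    rw [← hf v, ← hf w, h f]
  exact (PiLp.ext hcoord)

theorem contMDiff_mvfderiv_apply {EM : Type*} [NormedAddCommGroup EM] [NormedSpace ℝ EM]
  {HM : Type*} [TopologicalSpace HM] {I : ModelWithCorners ℝ EM HM}
  {M : Type*} [TopologicalSpace M] [ChartedSpace HM M] [IsManifold I ∞ M]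
  {f : M → ℝ} (hf : ContMDiff I 𝓘(ℝ, ℝ) ∞ f) {V : ∀ z : M, TangentSpace I z}
  (hV : ContMDiff I I.tangent ∞ (fun z => (⟨z, V z⟩ : TangentBundle I M))) :
  ContMDiff I 𝓘(ℝ, ℝ) ∞ (fun z => mvfderiv I f z (V z)) := by
  have h1 := (hf.contMDiff_tangentMap (m := ∞) (by simp)).comp hV
  have h2 := (contMDiff_snd_tangentBundle_modelSpace ℝ 𝓘(ℝ, ℝ) (n := ∞)).comp h1
  exact h2

theorem contMDiff_anchor_section (A : LieAlgebroid n m E) (σ : Cₛ^∞⟮𝓡 n; RVec m, E⟯) :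
    ContMDiff (𝓡 n) (𝓡 n).tangent ∞
      (fun q => (⟨q, A.anchor q (σ q)⟩ : TangentBundle (𝓡 n) Q)) :=
  A.contMDiff_anchor.comp σ.contMDiff

theorem anchor_bracket_apply (A : LieAlgebroid n m E) (σ τ γ : Cₛ^∞⟮𝓡 n; RVec m, E⟯)
    (f : C^∞⟮𝓡 n, Q; ℝ⟯) (q : Q) :
    (mvfderiv (𝓡 n) f q (A.anchor q (A.bracket σ τ q)) -
      (mvfderiv (𝓡 n) (fun q' => mvfderiv (𝓡 n) f q' (A.anchor q' (τ q'))) q (A.anchor q (σ q)) -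
       mvfderiv (𝓡 n) (fun q' => mvfderiv (𝓡 n) f q' (A.anchor q' (σ q'))) q (A.anchor q (τ q)))) •
       γ q = 0 := by
  let fγ : Cₛ^∞⟮𝓡 n; RVec m, E⟯ := ⟨fun q => f q • γ q, f.contMDiff.smul_section γ.contMDiff⟩
  let D : Cₛ^∞⟮𝓡 n; RVec m, E⟯ → C^∞⟮𝓡 n, Q; ℝ⟯ := fun σ =>
    ⟨fun q' => mvfderiv (𝓡 n) f q' (A.anchor q' (σ q')),
      contMDiff_mvfderiv_apply f.contMDiff (A.contMDiff_anchor_section σ)⟩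
  let S : C^∞⟮𝓡 n, Q; ℝ⟯ → Cₛ^∞⟮𝓡 n; RVec m, E⟯ → Cₛ^∞⟮𝓡 n; RVec m, E⟯ := fun g τ =>
    ⟨fun q => g q • τ q, g.contMDiff.smul_section τ.contMDiff⟩
  have L : ∀ (σ τ : Cₛ^∞⟮𝓡 n; RVec m, E⟯) (g : C^∞⟮𝓡 n, Q; ℝ⟯), A.bracket σ (S g τ) q =
     g q • A.bracket σ τ q + mvfderiv (𝓡 n) g q (A.anchor q (σ q)) • τ q :=
    fun σ τ g => A.leibniz σ τ g q
  have L1 : ∀ τ, A.bracket τ (S f γ) = S f (A.bracket τ γ) + S (D τ) γ := fun τ => by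
    ext q
    exact A.leibniz τ γ f q
  have skew : ∀ σ τ, A.bracket σ τ = - A.bracket τ σ := fun σ τ => by
    have := A.bracket_self (σ + τ)
    simp only [map_add, LinearMap.add_apply, A.bracket_self, zero_add, add_zero] at this
    exact eq_neg_of_add_eq_zero_left (by rw [add_comm]; exact this)
  have J : ∀ υ, A.bracket (A.bracket σ τ) υ =
      A.bracket σ (A.bracket τ υ) - A.bracket τ (A.bracket σ υ) := fun υ => by
    have := A.jacobi σ τ υ
    rw [skew υ σ, skew υ (A.bracket σ τ), map_neg] at this
    rw [← sub_eq_zero, ← neg_eq_zero, ← this]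
    abel
  have h1 := congrArg (fun s : Cₛ^∞⟮𝓡 n; RVec m, E⟯ => s q) (J (S f γ))
  have h2 := congrArg (fun s : Cₛ^∞⟮𝓡 n; RVec m, E⟯ => s q) (J γ)
  simp only [L1, map_add, ContMDiffSection.coe_add, ContMDiffSection.coe_sub, Pi.add_apply,
    Pi.sub_apply, L] at h1 h2
  have e1 : ∀ g τ, S g τ q = g q • τ q := fun _ _ => rfl
  have e2 : ∀ σ, D σ q = mvfderiv (𝓡 n) f q (A.anchor q (σ q)) := fun _ => rfl
  rw [e1, e1, h2] at h1
  simp only [e2] at h1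
  change (mvfderiv (𝓡 n) f q (A.anchor q (A.bracket σ τ q)) -
      (mvfderiv (𝓡 n) (D τ) q (A.anchor q (σ q)) - mvfderiv (𝓡 n) (D σ) q (A.anchor q (τ q)))) •
       γ q = 0
  rw [← sub_eq_zero] at h1
  rw [← h1]
  module

theorem exists_section_ne_zero [T2Space Q] [NeZero m] (q : Q) :
    ∃ γ : Cₛ^∞⟮𝓡 n; RVec m, E⟯, γ q ≠ 0 := by
  let e := trivializationAt (RVec m) E q
  let b := (EuclideanSpace.basisFun (Fin m) ℝ).toBasis
  have hq : q ∈ e.baseSet := FiberBundle.mem_baseSet_trivializationAt' q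
  have h := extendGerm_eventuallyEq (n := n) (m := m) (e.open_baseSet.mem_nhds hq)
    (e.contMDiffOn_localFrame_baseSet (I := 𝓡 n) ∞ b 0)
  refine ⟨_, h.self_of_nhds.trans_ne ?_⟩
  rw [e.localFrame_apply_of_mem_baseSet b hq]
  exact (e.basisAt b hq).ne_zero 0

/-- `(anchor [σ, τ]) f = (anchor σ)(anchor τ) f - (anchor τ)(anchor σ) f`. -/
theorem anchor_bracket [T2Space Q] (A : LieAlgebroid n m E) (σ τ : Cₛ^∞⟮𝓡 n; RVec m, E⟯)
    (f : C^∞⟮𝓡 n, Q; ℝ⟯) (q : Q) :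
    mvfderiv (𝓡 n) f q (A.anchor q (A.bracket σ τ q)) =
      mvfderiv (𝓡 n) (fun q' => mvfderiv (𝓡 n) f q' (A.anchor q' (τ q'))) q (A.anchor q (σ q)) -
       mvfderiv (𝓡 n) (fun q' => mvfderiv (𝓡 n) f q' (A.anchor q' (σ q'))) q (A.anchor q (τ q)) := by
  rcases eq_or_ne m 0 with rfl | hm
  · have hE : ∀ (q : Q) (a : E q), a = 0 := fun q a =>
      ((trivializationAt (RVec 0) E q).linearEquivAt ℝ q
        (FiberBundle.mem_baseSet_trivializationAt' q)).injective (Subsingleton.elim _ _)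
    have h0 : ∀ σ : Cₛ^∞⟮𝓡 n; RVec 0, E⟯, ∀ q, A.anchor q (σ q) = 0 := fun σ q => by
      rw [hE q (σ q), map_zero]
    simp only [h0, map_zero, sub_zero]
  · have := NeZero.mk hm
    obtain ⟨γ, hγ⟩ := exists_section_ne_zero (n := n) (m := m) (E := E) q
    exact sub_eq_zero.1 ((smul_eq_zero.1 (A.anchor_bracket_apply σ τ γ f q)).resolve_right hγ)

end Base
section Prolongation
variable {n m : ℕ} {Q : Type*} [TopologicalSpace Q] [ChartedSpace (RVec n) Q]
  [IsManifold (𝓡 n) ∞ Q]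
  {E : Q → Type*} [TopologicalSpace (TotalSpace (RVec m) E)]
  [∀ q, AddCommGroup (E q)] [∀ q, Module ℝ (E q)] [∀ q, TopologicalSpace (E q)]
  [∀ q, IsTopologicalAddGroup (E q)] [∀ q, ContinuousSMul ℝ (E q)]
  [FiberBundle (RVec m) E] [VectorBundle ℝ (RVec m) E] [ContMDiffVectorBundle ∞ (RVec m) E (𝓡 n)]
  {EP : Type*} [NormedAddCommGroup EP] [NormedSpace ℝ EP] [CompleteSpace EP]
  {HP : Type*} [TopologicalSpace HP] {IP : ModelWithCorners ℝ EP HP} [IP.Boundaryless]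
  {P : Type*} [TopologicalSpace P] [ChartedSpace HP P] [IsManifold IP ∞ P]

/-- The fibre at `p` of the prolongation of `A` over `pr : P → Q`: the pairs `(a, v)` with
`a ∈ E_{pr p}`, `v ∈ T_p P` and `anchor a = T pr (v)`. -/
noncomputable def prolongation (A : LieAlgebroid n m E) (pr : C^∞⟮IP, P; 𝓡 n, Q⟯) (p : P) :
    Submodule ℝ (E (pr p) × TangentSpace IP p) :=
  LinearMap.eqLocus (A.anchor (pr p) ∘ₗ LinearMap.fst ℝ _ _)
    ((mfderiv IP (𝓡 n) pr p).toLinearMap ∘ₗ LinearMap.snd ℝ _ _)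

/-- A smooth section of the prolongation: `p ↦ (a p, v p)` in the fibres, smooth as a map to `E × TP`. -/
@[ext]
structure ProlongationSection (A : LieAlgebroid n m E) (pr : C^∞⟮IP, P; 𝓡 n, Q⟯) where
  toFun : ∀ p, A.prolongation pr p
  contMDiff_fst : ContMDiff IP ((𝓡 n).prod 𝓘(ℝ, RVec m)) ∞
    (fun p => (⟨pr p, (toFun p).1.1⟩ : TotalSpace (RVec m) E))
  contMDiff_snd : ContMDiff IP IP.tangent ∞
    (fun p => (⟨p, (toFun p).1.2⟩ : TangentBundle IP P))

/-- The local frame of `E` near `q₀` given by the preferred trivialization at `q₀`. -/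
noncomputable def frame (q₀ : Q) (α : Fin m) : ∀ q, E q :=
  (trivializationAt (RVec m) E q₀).localFrame (EuclideanSpace.basisFun (Fin m) ℝ).toBasis α

/-- The components of an element of `E` in the frame `frame q₀`. -/
noncomputable def frameCoord (q₀ : Q) (α : Fin m) (a : TotalSpace (RVec m) E) : ℝ :=
  (trivializationAt (RVec m) E q₀ a).2 α

theorem sum_frameCoord_smul_frame {q₀ q : Q} (hq : q ∈ (trivializationAt (RVec m) E q₀).baseSet)
    (a : E q) : a = ∑ α, frameCoord q₀ α (⟨q, a⟩ : TotalSpace (RVec m) E) • frame q₀ α q := by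
  have h := ((trivializationAt (RVec m) E q₀).basisAt
    (EuclideanSpace.basisFun (Fin m) ℝ).toBasis hq).sum_repr a
  refine h.symm.trans (Finset.sum_congr rfl fun α _ => ?_)
  rw [frame, Trivialization.localFrame_apply_of_mem_baseSet _ _ hq]
  rfl

/-- The `E`-component at `p` of the bracket of the sections `Z = (a, v)` and `W = (b, w)`: writing
`a = ∑ z_α e_α ∘ pr` and `b = ∑ w_β e_β ∘ pr` in a local frame,
it is `∑ z_α w_β [e_α, e_β] ∘ pr + ∑ (v(w_β) - w(z_β)) e_β ∘ pr`. -/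
noncomputable def prolongationBracketFst (A : LieAlgebroid n m E) (pr : C^∞⟮IP, P; 𝓡 n, Q⟯)
    (Z W : A.ProlongationSection pr) (p : P) : E (pr p) :=
  let z : Fin m → P → ℝ := fun α p' => frameCoord (pr p) α ⟨pr p', (Z.toFun p').1.1⟩
  let w : Fin m → P → ℝ := fun α p' => frameCoord (pr p) α ⟨pr p', (W.toFun p').1.1⟩
  ∑ α, ∑ β, (z α p * w β p) • A.localBracket (frame (pr p) α) (frame (pr p) β) (pr p) +
    ∑ β, (mvfderiv IP (w β) p (Z.toFun p).1.2 - mvfderiv IP (z β) p (W.toFun p).1.2) •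
      frame (pr p) β (pr p)

theorem mdifferentiableAt_frameCoord (A : LieAlgebroid n m E) (pr : C^∞⟮IP, P; 𝓡 n, Q⟯)
    (Z : A.ProlongationSection pr) (p : P) (α : Fin m) :
    MDifferentiableAt IP 𝓘(ℝ, ℝ)
      (fun p' => frameCoord (pr p) α (⟨pr p', (Z.toFun p').1.1⟩ : TotalSpace (RVec m) E)) p := by
  have h := (contMDiffAt_totalSpace.1 (Z.contMDiff_fst p)).2.mdifferentiableAt (by simp)
  exact (EuclideanSpace.proj (𝕜 := ℝ) α).mdifferentiableAt.comp p h

theorem mvfderiv_anchor_prolongation [T2Space Q] (A : LieAlgebroid n m E) (pr : C^∞⟮IP, P; 𝓡 n, Q⟯)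
    (Z : A.ProlongationSection pr) (g : C^∞⟮𝓡 n, Q; ℝ⟯) (p : P) :
    mvfderiv IP (g ∘ pr) p (Z.toFun p).1.2 =
      mvfderiv (𝓡 n) g (pr p) (A.anchor _ (Z.toFun p).1.1) := by
  have h : A.anchor _ (Z.toFun p).1.1 = mfderiv IP (𝓡 n) pr p (Z.toFun p).1.2 := (Z.toFun p).2
  rw [h]
  have h2 := mvfderiv_comp p (g.contMDiff.mdifferentiableAt (by simp))
    (pr.contMDiff.mdifferentiableAt (by simp))
  rw [h2]
  rfl

theorem mvfderiv_sum_mul {ι : Type*} [Fintype ι] {EM : Type*} [NormedAddCommGroup EM] [NormedSpace ℝ EM]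
    {HM : Type*} [TopologicalSpace HM] {I : ModelWithCorners ℝ EM HM}
    {M : Type*} [TopologicalSpace M] [ChartedSpace HM M]
    {w h : ι → M → ℝ} {x : M} (hw : ∀ β, MDifferentiableAt I 𝓘(ℝ, ℝ) (w β) x)
    (hh : ∀ β, MDifferentiableAt I 𝓘(ℝ, ℝ) (h β) x) (v : TangentSpace I x) :
    mvfderiv I (fun y => ∑ β, w β y * h β y) x v =
      ∑ β, (w β x * mvfderiv I (h β) x v + mvfderiv I (w β) x v * h β x) := by
  classical
  have hsum : ∀ s : Finset ι, MDifferentiableAt I 𝓘(ℝ, ℝ) (fun y => ∑ β ∈ s, w β y * h β y) x ∧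
      mvfderiv I (fun y => ∑ β ∈ s, w β y * h β y) x v =
        ∑ β ∈ s, (w β x * mvfderiv I (h β) x v + mvfderiv I (w β) x v * h β x) := by
    intro s
    induction s using Finset.induction_on with
    | empty =>
      simp only [Finset.sum_empty, mvfderiv_const]
      exact ⟨mdifferentiableAt_const, rfl⟩
    | insert β s hβ ih =>
      have hm : MDifferentiableAt I 𝓘(ℝ, ℝ) (fun y => w β y * h β y) x := (hw β).mul (hh β)
      simp only [Finset.sum_insert hβ]
      refine ⟨hm.add ih.1, ?_⟩
      rw [mvfderiv_fun_add hm ih.1, mvfderiv_fun_mul (hw β) (hh β), ← ih.2]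
      show w β x * mvfderiv I (h β) x v + h β x * mvfderiv I (w β) x v + _ = _
      refine congrArg₂ (· + ·) ?_ rfl
      ring
  exact (hsum Finset.univ).2

theorem mvfderiv_mvfderiv_prolongation [T2Space Q] (A : LieAlgebroid n m E) (pr : C^∞⟮IP, P; 𝓡 n, Q⟯)
    (Z W : A.ProlongationSection pr) (g : C^∞⟮𝓡 n, Q; ℝ⟯) (p : P)
    (e : Fin m → Cₛ^∞⟮𝓡 n; RVec m, E⟯) (he : ∀ α, ∀ᶠ q in 𝓝 (pr p), e α q = frame (pr p) α q) :
    mvfderiv IP (fun p' => mvfderiv IP (g ∘ pr) p' (W.toFun p').1.2) p (Z.toFun p).1.2 =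
     ∑ β, (mvfderiv IP (fun p' => frameCoord (pr p) β (⟨pr p', (W.toFun p').1.1⟩ : TotalSpace (RVec m) E))
         p (Z.toFun p).1.2 * mvfderiv (𝓡 n) g (pr p) (A.anchor _ (e β (pr p)))) +
     ∑ α, ∑ β, frameCoord (pr p) α (⟨pr p, (Z.toFun p).1.1⟩ : TotalSpace (RVec m) E) *
       frameCoord (pr p) β (⟨pr p, (W.toFun p).1.1⟩ : TotalSpace (RVec m) E) *
       mvfderiv (𝓡 n) (fun q => mvfderiv (𝓡 n) g q (A.anchor _ (e β q))) (pr p)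
        (A.anchor _ (e α (pr p))) := by
  let w : Fin m → P → ℝ := fun β p' =>
    frameCoord (pr p) β (⟨pr p', (W.toFun p').1.1⟩ : TotalSpace (RVec m) E)
  let h : Fin m → Q → ℝ := fun β q => mvfderiv (𝓡 n) g q (A.anchor _ (e β q))
  have hw : ∀ β, MDifferentiableAt IP 𝓘(ℝ, ℝ) (w β) p := A.mdifferentiableAt_frameCoord pr W p
  have hh : ∀ β, MDifferentiableAt (𝓡 n) 𝓘(ℝ, ℝ) (h β) (pr p) := fun β =>
    (contMDiff_mvfderiv_apply g.contMDiff
      (A.contMDiff_anchor_section (e β))).mdifferentiableAt (by simp)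
  have hp : MDifferentiableAt IP (𝓡 n) pr p := pr.contMDiff.mdifferentiableAt (by simp)
  have hhp : ∀ β, MDifferentiableAt IP 𝓘(ℝ, ℝ) (h β ∘ pr) p := fun β =>
    (hh β).comp p hp
  have hc : ContinuousAt pr p := pr.contMDiff.continuous.continuousAt
  have hev : (fun p' => mvfderiv IP (g ∘ pr) p' (W.toFun p').1.2) =ᶠ[𝓝 p]
      fun p' => ∑ β, w β p' * (h β ∘ pr) p' := by
    have h1 : ∀ᶠ p' in 𝓝 p, pr p' ∈ (trivializationAt (RVec m) E (pr p)).baseSet :=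
      hc.eventually ((trivializationAt (RVec m) E (pr p)).open_baseSet.mem_nhds
        (FiberBundle.mem_baseSet_trivializationAt' _))
    have h2 : ∀ᶠ p' in 𝓝 p, ∀ α, e α (pr p') = frame (pr p) α (pr p') :=
      eventually_all.2 fun α => hc.eventually (he α)
    filter_upwards [h1, h2] with p' h1 h2
    rw [mvfderiv_anchor_prolongation]
    conv_lhs => rw [sum_frameCoord_smul_frame h1 (W.toFun p').1.1]
    simp only [map_sum, map_smul, smul_eq_mul, ← h2]
    rfl
  have hd : mvfderiv IP (fun p' => mvfderiv IP (g ∘ pr) p' (W.toFun p').1.2) p =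
      mvfderiv IP (fun p' => ∑ β, w β p' * (h β ∘ pr) p') p := by
    exact ContinuousLinearMap.ext fun v => DFunLike.congr_fun hev.mfderiv_eq v
  rw [hd, mvfderiv_sum_mul hw hhp, Finset.sum_add_distrib, add_comm]
  congr 1
  rw [Finset.sum_comm]
  refine Finset.sum_congr rfl fun β _ => ?_
  have h3 := A.mvfderiv_anchor_prolongation pr Z
    ⟨h β, contMDiff_mvfderiv_apply g.contMDiff (A.contMDiff_anchor_section (e β))⟩ p
  change mvfderiv IP (h β ∘ pr) p (Z.toFun p).1.2 = mvfderiv (𝓡 n) (h β) (pr p) _ at h3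
  rw [h3]
  have hb : pr p ∈ (trivializationAt (RVec m) E (pr p)).baseSet :=
    FiberBundle.mem_baseSet_trivializationAt' _
  conv_lhs => rw [sum_frameCoord_smul_frame hb (Z.toFun p).1.1]
  simp only [map_sum, map_smul, smul_eq_mul, Finset.mul_sum, ← fun α => (he α).self_of_nhds]
  refine Finset.sum_congr rfl fun α _ => ?_
  show w β p * _ = _ * w β p * _
  ring

theorem prolongationBracket_mem [T2Space Q] (A : LieAlgebroid n m E) (pr : C^∞⟮IP, P; 𝓡 n, Q⟯)
    (Z W : A.ProlongationSection pr) (p : P) :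
    (A.prolongationBracketFst pr Z W p,
      mlieBracket IP (fun p => (Z.toFun p).1.2) (fun p => (W.toFun p).1.2) p) ∈
      A.prolongation pr p := by
  show A.anchor _ _ = mfderiv IP (𝓡 n) pr p _
  refine tangent_ext fun g => ?_
  have h1 : mvfderiv (𝓡 n) g (pr p) (mfderiv IP (𝓡 n) pr p
      (mlieBracket IP (fun p => (Z.toFun p).1.2) (fun p => (W.toFun p).1.2) p)) =
      mvfderiv IP (g ∘ pr) p
       (mlieBracket IP (fun p => (Z.toFun p).1.2) (fun p => (W.toFun p).1.2) p) := by
    have h2 := mvfderiv_comp p (g.contMDiff.mdifferentiableAt (by simp))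
      (pr.contMDiff.mdifferentiableAt (by simp))
    rw [h2]
    rfl
  have hgp : ContMDiff IP 𝓘(ℝ, ℝ) ∞ (g ∘ pr) := g.contMDiff.comp pr.contMDiff
  have he : ∀ α, ∀ᶠ q in 𝓝 (pr p), extendGerm (n := n) (m := m) (frame (pr p) α : ∀ q, E q) (pr p) q = frame (pr p) α q :=
    fun α => extendGerm_eventuallyEq ((trivializationAt (RVec m) E (pr p)).open_baseSet.mem_nhds
      (FiberBundle.mem_baseSet_trivializationAt' _))
      ((trivializationAt (RVec m) E (pr p)).contMDiffOn_localFrame_baseSet (I := 𝓡 n) ∞ _ α)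
  refine Eq.trans ?_ h1.symm
  rw [mvfderiv_mlieBracket hgp.contMDiffAt (Z.contMDiff_snd.mdifferentiableAt (by simp))
    (W.contMDiff_snd.mdifferentiableAt (by simp))
    ((contMDiff_mvfderiv_apply hgp Z.contMDiff_snd).mdifferentiableAt (by simp))
    ((contMDiff_mvfderiv_apply hgp W.contMDiff_snd).mdifferentiableAt (by simp)),
    mvfderiv_mvfderiv_prolongation A pr Z W g p _ he,
    mvfderiv_mvfderiv_prolongation A pr W Z g p _ he]
  let L : E (pr p) →ₗ[ℝ] ℝ :=
    (mvfderiv (𝓡 n) g (pr p)).toLinearMap ∘ₗ A.anchor (pr p)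
  have hf : ∀ β, A.anchor _ (extendGerm (n := n) (m := m) (frame (pr p) β : ∀ q, E q) (pr p) (pr p)) =
      A.anchor _ (frame (m := m) (pr p) β (pr p)) := fun β => by rw [(he β).self_of_nhds]
  have hb : ∀ α β, L (A.localBracket (frame (m := m) (pr p) α) (frame (m := m) (pr p) β) (pr p)) =
      _ := fun α β => A.anchor_bracket _ _ g (pr p)
  change L (A.prolongationBracketFst pr Z W p) = _
  simp only [prolongationBracketFst, map_add, map_sum, map_smul, smul_eq_mul, hb, hf]
  rw [add_sub_add_comm, add_comm]
  congr 1
  · rw [← Finset.sum_sub_distrib]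
    exact Finset.sum_congr rfl fun β _ => sub_mul _ _ _
  · rw [Finset.sum_comm (f := fun α β => frameCoord (pr p) α
      (⟨pr p, (W.toFun p).1.1⟩ : TotalSpace (RVec m) E) * _ * _), ← Finset.sum_sub_distrib]
    refine Finset.sum_congr rfl fun α _ => ?_
    rw [← Finset.sum_sub_distrib]
    refine Finset.sum_congr rfl fun β _ => ?_
    ring

/-- The Lie bracket of sections of the prolongation: its `TP`-component is the bracket of vector
fields. In local bases `X_α, V_l` it gives `[X_α, X_β] = C^γ_{αβ} X_γ`, `[X_α, V_l] = 0`,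
`[V_l, V_k] = 0`. -/
noncomputable def prolongationBracket [T2Space Q] (A : LieAlgebroid n m E) (pr : C^∞⟮IP, P; 𝓡 n, Q⟯)
    (Z W : A.ProlongationSection pr) (p : P) : A.prolongation pr p :=
  ⟨_, A.prolongationBracket_mem pr Z W p⟩

/-- A `1`-section of the dual of the prolongation. -/
abbrev OneSection (A : LieAlgebroid n m E) (pr : C^∞⟮IP, P; 𝓡 n, Q⟯) :=
  ∀ p, A.prolongation pr p →ₗ[ℝ] ℝ

/-- The anchor of the prolongation, `(a, v) ↦ v`, applied to a section: a vector field on `P`. -/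
noncomputable def ProlongationSection.anchor {A : LieAlgebroid n m E} {pr : C^∞⟮IP, P; 𝓡 n, Q⟯}
    (Z : A.ProlongationSection pr) (p : P) : TangentSpace IP p :=
  (Z.toFun p).1.2

/-- The exterior differential of a function `f` on `P`: `(df)(Z) = (anchor Z) f`. -/
noncomputable def extDerivFun (A : LieAlgebroid n m E) (pr : C^∞⟮IP, P; 𝓡 n, Q⟯) (f : P → ℝ) :
    A.OneSection pr := fun p =>
  (mvfderiv IP f p).toLinearMap ∘ₗ LinearMap.snd ℝ _ _ ∘ₗ (A.prolongation pr p).subtype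

/-- The exterior differential of a `1`-section:
`(dμ)(Z, W) = (anchor Z)(μ(W)) - (anchor W)(μ(Z)) - μ([Z, W])`. -/
noncomputable def extDeriv [T2Space Q] {A : LieAlgebroid n m E} {pr : C^∞⟮IP, P; 𝓡 n, Q⟯}
    (μ : A.OneSection pr) (Z W : A.ProlongationSection pr) (p : P) : ℝ :=
  mvfderiv IP (fun p' => μ p' (W.toFun p')) p (Z.anchor p) -
    mvfderiv IP (fun p' => μ p' (Z.toFun p')) p (W.anchor p) -
    μ p (A.prolongationBracket pr Z W p)

/-- The `(2 k + 1)`-form `μ ∧ (dμ)^k` evaluated on sections: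
`(1 / 2 ^ k) ∑_σ sgn(σ) μ(Z_{σ 0}) dμ(Z_{σ 1}, Z_{σ 2}) ⋯ dμ(Z_{σ (2k-1)}, Z_{σ (2k)})`. -/
noncomputable def wedgeExtDerivPow [T2Space Q] {A : LieAlgebroid n m E}
    {pr : C^∞⟮IP, P; 𝓡 n, Q⟯} (μ : A.OneSection pr) (k : ℕ)
    (Z : Fin (2 * k + 1) → A.ProlongationSection pr) (p : P) : ℝ :=
  (1 / 2 ^ k) * ∑ σ : Equiv.Perm (Fin (2 * k + 1)), ((Equiv.Perm.sign σ : ℤ) : ℝ) *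
    (μ p ((Z (σ 0)).toFun p) *
      ∏ i : Fin k, extDeriv μ (Z (σ ⟨2 * i + 1, by omega⟩)) (Z (σ ⟨2 * i + 2, by omega⟩)) p)

/-- `μ` is a contact section of the prolongation: the rank is `2 k + 1`, `μ` is smooth, and
`μ ∧ (dμ)^k` vanishes nowhere. -/
structure IsContactSection [T2Space Q] {A : LieAlgebroid n m E} {pr : C^∞⟮IP, P; 𝓡 n, Q⟯}
    (k : ℕ) (μ : A.OneSection pr) : Prop where
  finrank_eq : ∀ p, Module.finrank ℝ (A.prolongation pr p) = 2 * k + 1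
  contMDiff : ∀ Z : A.ProlongationSection pr,
    ContMDiff IP 𝓘(ℝ, ℝ) ∞ (fun p => μ p (Z.toFun p))
  wedge_ne_zero : ∀ p, ∃ Z : Fin (2 * k + 1) → A.ProlongationSection pr,
    wedgeExtDerivPow μ k Z p ≠ 0

/-- The Reeb section `R` of `μ`: `i_R dμ = 0` and `i_R μ = 1`. -/
def IsReebSection [T2Space Q] {A : LieAlgebroid n m E} {pr : C^∞⟮IP, P; 𝓡 n, Q⟯}
    (μ : A.OneSection pr) (R : A.ProlongationSection pr) : Prop :=
  (∀ (Z : A.ProlongationSection pr) (p : P), extDeriv μ R Z p = 0) ∧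
    ∀ p, μ p (R.toFun p) = 1

/-- `ξ` satisfies `i_ξ μ = -H` and `i_ξ dμ = dH - (anchor R)(H) μ`. -/
def IsHamiltonianSection [T2Space Q] {A : LieAlgebroid n m E} {pr : C^∞⟮IP, P; 𝓡 n, Q⟯}
    (μ : A.OneSection pr) (R : A.ProlongationSection pr) (H : P → ℝ)
    (ξ : A.ProlongationSection pr) : Prop :=
  (∀ p, μ p (ξ.toFun p) = -H p) ∧
    ∀ (Z : A.ProlongationSection pr) (p : P), extDeriv μ ξ Z p =
      A.extDerivFun pr H p (Z.toFun p) - mvfderiv IP H p (R.anchor p) * μ p (Z.toFun p)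

end Prolongation

section Hamiltonian

/-- The manifold `E^* × ℝ`. -/
abbrev DualLine (m : ℕ) {Q : Type*} (E : Q → Type*) [∀ q, AddCommGroup (E q)]
    [∀ q, Module ℝ (E q)] [∀ q, TopologicalSpace (E q)] :=
  TotalSpace (RVec m →L[ℝ] ℝ) (fun q => E q →L[ℝ] Bundle.Trivial Q ℝ q) × ℝ

/-- The model with corners of `E^* × ℝ`. -/
noncomputable abbrev dualLineModel (n m : ℕ) :=
  ((𝓡 n).prod 𝓘(ℝ, RVec m →L[ℝ] ℝ)).prod 𝓘(ℝ, ℝ)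

variable {n m : ℕ} {Q : Type*} [TopologicalSpace Q] [ChartedSpace (RVec n) Q]
  [IsManifold (𝓡 n) ∞ Q]
  {E : Q → Type*} [TopologicalSpace (TotalSpace (RVec m) E)]
  [∀ q, AddCommGroup (E q)] [∀ q, Module ℝ (E q)] [∀ q, TopologicalSpace (E q)]
  [∀ q, IsTopologicalAddGroup (E q)] [∀ q, ContinuousSMul ℝ (E q)]
  [FiberBundle (RVec m) E] [VectorBundle ℝ (RVec m) E] [ContMDiffVectorBundle ∞ (RVec m) E (𝓡 n)]

variable (n m E) in
/-- The projection `E^* × ℝ → Q`, `(b_q, s) ↦ q`. -/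
noncomputable def dualLineProj : C^∞⟮dualLineModel n m, DualLine m E; 𝓡 n, Q⟯ :=
  ⟨fun p => p.1.proj, (contMDiff_proj _).comp contMDiff_fst⟩

/-- The Liouville section `Θ_{(b, s)}(a, v) = b(a)`. -/
noncomputable def liouvilleSection (A : LieAlgebroid n m E) :
    A.OneSection (dualLineProj n m E) := fun p =>
  (p.1.2 : E p.1.proj →L[ℝ] ℝ).toLinearMap ∘ₗ LinearMap.fst ℝ _ _ ∘ₗ
    (A.prolongation (dualLineProj n m E) p).subtype

/-- The section `V^s(a, v) = ds(v)`, where `s` is the coordinate of the factor `ℝ`. -/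
noncomputable def verticalSection (A : LieAlgebroid n m E) :
    A.OneSection (dualLineProj n m E) :=
  A.extDerivFun (dualLineProj n m E) (fun p => p.2)

/-- The canonical section `η = V^s - Θ`. -/
noncomputable def contactSection (A : LieAlgebroid n m E) :
    A.OneSection (dualLineProj n m E) := fun p =>
  A.verticalSection p - A.liouvilleSection p

section LocalCoordinates

/-- The component `ρ^i_α` of the anchor: `ρ(e_α) = ρ^i_α ∂/∂q^i`. -/
noncomputable def anchorCoeff (A : LieAlgebroid n m E) (φ : OpenPartialHomeomorph Q (RVec n))
    (e : Fin m → ∀ q, E q) (i : Fin n) (α : Fin m) (q : Q) : ℝ :=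
  mvfderiv (𝓡 n) (fun q' => φ q' i) q (A.anchor q (e α q))

/-- The structure function `C^γ_{αβ}`: `[e_α, e_β] = C^γ_{αβ} e_γ`. -/
noncomputable def bracketCoeff (A : LieAlgebroid n m E) {e : Fin m → ∀ q, E q} {U : Set Q}
    (he : IsLocalFrameOn (𝓡 n) (RVec m) ∞ e U) (γ α β : Fin m) (q : Q) : ℝ :=
  he.coeff γ q (A.localBracket (e α) (e β) q)

/-- The element `e^α(q)` of the dual frame. -/
noncomputable def dualFrame {e : Fin m → ∀ q, E q} {U : Set Q}
    (he : IsLocalFrameOn (𝓡 n) (RVec m) ∞ e U) (α : Fin m) (q : Q) :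
    E q →L[ℝ] Bundle.Trivial Q ℝ q where
  toLinearMap := he.coeff α q
  cont := by
    have := FiberBundle.t2Space (RVec m) E q
    have : FiniteDimensional ℝ (E q) := VectorBundle.finiteDimensional ℝ (RVec m) E q
    exact (he.coeff α q).continuous_of_finiteDimensional

/-- The coordinates `(q^i, y_α, s)` on `E^* × ℝ` given by a chart of `Q` and a frame of `E`. -/
noncomputable def coords (φ : OpenPartialHomeomorph Q (RVec n)) (e : Fin m → ∀ q, E q)
    (p : DualLine m E) : RVec n × RVec m × ℝ :=
  (φ p.1.proj, WithLp.toLp 2 (fun α => p.1.2 (e α p.1.proj)), p.2)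

/-- The inverse of `coords`: `(x, y, s) ↦ (∑ y_α e^α(φ⁻¹ x), s)`. -/
noncomputable def coordsSymm (φ : OpenPartialHomeomorph Q (RVec n)) {e : Fin m → ∀ q, E q}
    {U : Set Q} (he : IsLocalFrameOn (𝓡 n) (RVec m) ∞ e U) (x : RVec n × RVec m × ℝ) :
    DualLine m E :=
  (⟨φ.symm x.1, ∑ α, x.2.1 α • dualFrame he α (φ.symm x.1)⟩, x.2.2)

/-- The derivative at `p`, in the coordinates `(q^i, y_α, s)`, of `H` along the vector `v`. -/
noncomputable def coordDeriv (φ : OpenPartialHomeomorph Q (RVec n)) {e : Fin m → ∀ q, E q}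
    {U : Set Q} (he : IsLocalFrameOn (𝓡 n) (RVec m) ∞ e U) (H : DualLine m E → ℝ)
    (v : RVec n × RVec m × ℝ) (p : DualLine m E) : ℝ :=
  lineDeriv ℝ (fun x => H (coordsSymm φ he x)) (coords φ e p) v

/-- The partial derivative `∂H/∂q^i`. -/
noncomputable def partialQ (φ : OpenPartialHomeomorph Q (RVec n)) {e : Fin m → ∀ q, E q}
    {U : Set Q} (he : IsLocalFrameOn (𝓡 n) (RVec m) ∞ e U) (H : DualLine m E → ℝ) (i : Fin n) :
    DualLine m E → ℝ :=
  coordDeriv φ he H (EuclideanSpace.single i 1, 0, 0)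

/-- The partial derivative `∂H/∂y_α`. -/
noncomputable def partialY (φ : OpenPartialHomeomorph Q (RVec n)) {e : Fin m → ∀ q, E q}
    {U : Set Q} (he : IsLocalFrameOn (𝓡 n) (RVec m) ∞ e U) (H : DualLine m E → ℝ) (α : Fin m) :
    DualLine m E → ℝ :=
  coordDeriv φ he H (0, EuclideanSpace.single α 1, 0)

/-- The partial derivative `∂H/∂s`. -/
noncomputable def partialS (φ : OpenPartialHomeomorph Q (RVec n)) {e : Fin m → ∀ q, E q}
    {U : Set Q} (he : IsLocalFrameOn (𝓡 n) (RVec m) ∞ e U) (H : DualLine m E → ℝ) :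
    DualLine m E → ℝ :=
  coordDeriv φ he H (0, 0, 1)

/-- The contact Hamilton equations for a curve `c` at time `t` (derivatives within `J`), in the
coordinates given by a chart `φ` of `Q` and a local frame `e` of `E`. -/
def ContactHamiltonEquationsAt (A : LieAlgebroid n m E) (φ : OpenPartialHomeomorph Q (RVec n))
    {e : Fin m → ∀ q, E q} {U : Set Q} (he : IsLocalFrameOn (𝓡 n) (RVec m) ∞ e U)
    (H : DualLine m E → ℝ) (c : ℝ → DualLine m E) (J : Set ℝ) (t : ℝ) : Prop :=
  (∀ i, HasDerivWithinAt (fun t' => (coords φ e (c t')).1 i)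
    (∑ α, A.anchorCoeff φ e i α (c t).1.proj * partialY φ he H α (c t)) J t) ∧
  (∀ α, HasDerivWithinAt (fun t' => (coords φ e (c t')).2.1 α)
    (-(∑ i, A.anchorCoeff φ e i α (c t).1.proj * partialQ φ he H i (c t) +
      ∑ β, ∑ γ, A.bracketCoeff he γ α β (c t).1.proj * (coords φ e (c t)).2.1 γ *
        partialY φ he H β (c t) +
      (coords φ e (c t)).2.1 α * partialS φ he H (c t))) J t) ∧
  HasDerivWithinAt (fun t' => (coords φ e (c t')).2.2)
    (∑ α, (coords φ e (c t)).2.1 α * partialY φ he H α (c t) - H (c t)) J t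

end LocalCoordinates

end Hamiltonian

end LieAlgebroid

/-! The theorem is linear algebra in a fibre, once `dη` is known in coordinates. Take a chart `φ` of
`Q` and a local frame `e` of `E` on its domain. An element `(a, v)` of the prolongation has the
components `z_α` of `a` and the velocities `u_α = dy_α(v)`, `r = ds(v)`. The base velocity is forced
by `ρ(a) = Tπ(v)`, so these `2m + 1` numbers are free linear coordinates on the fibre
(`prolongationCoords`).

In these coordinates `η = r - ∑ y_α z_α`, and `dη` of `(z, u, r)` and `(z', u', r')` is `∑ (u'_α z_α
- u_α z'_α) + ∑ z_α z'_β C^γ_{αβ} y_γ` (`extDeriv_contactSection`). All derivatives of components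
cancel: `ds` is closed because the second component of the bracket is the bracket of vector fields,
and the derivatives in `dΘ` are matched by those in the `E`-component of the bracket. The latter is
defined through a preferred frame at each point, so its formula must first be proved in an arbitrary
frame (`prolongationBracketFst_eq`); this uses the locality of the algebroid bracket and the Leibniz
rule in both arguments.

Pairing with the fibre directions under `dη` recovers `z`, pairing with the frame directions then
recovers `u`, and `η` recovers `r` (`ext_of_contactForm`). This gives both uniqueness statements.
For existence, `(0, 0, 1)` and `hamiltonianCoords` solve the Reeb and Hamiltonian equations in each
chart and frame. As the equations are intrinsic, solutions from different charts coincide at each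
point and form a global section. Here `dη`, which is defined on sections, is seen to depend on
values only, by the coordinate formula and the existence of sections through any point
(`exists_section_eq`). Hamilton's equations are the components of the velocity `ρ^{*π}(ξ_H)`.

For the contact condition, `η ∧ (dη)^m` is evaluated on the Reeb direction and a Darboux basis of
`ker η`. No term of the sum over permutations is negative, and the identity contributes a positive
one (`sum_sign_mul_prod_pos`). -/

namespace LieAlgebroid

/-! ### Smoothness in terms of components in an arbitrary local frame. -/

section FrameCoefficients
variable {n m : ℕ} {Q : Type*} [TopologicalSpace Q] [ChartedSpace (RVec n) Q]
  [IsManifold (𝓡 n) ∞ Q]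
  {E : Q → Type*} [TopologicalSpace (TotalSpace (RVec m) E)]
  [∀ q, AddCommGroup (E q)] [∀ q, Module ℝ (E q)] [∀ q, TopologicalSpace (E q)]
  [∀ q, IsTopologicalAddGroup (E q)] [∀ q, ContinuousSMul ℝ (E q)]
  [FiberBundle (RVec m) E] [VectorBundle ℝ (RVec m) E] [ContMDiffVectorBundle ∞ (RVec m) E (𝓡 n)]
  {e : Fin m → ∀ q, E q} {U : Set Q}

/-- The matrix of the frame `e` in the preferred trivialization at `q₀`. -/
noncomputable def frameMatrix (e : Fin m → ∀ q, E q) (q₀ q : Q) : RVec m →L[ℝ] RVec m :=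
  ∑ α, ContinuousLinearMap.smulRightL ℝ _ _ (EuclideanSpace.proj α)
    (trivializationAt (RVec m) E q₀ (⟨q, e α q⟩ : TotalSpace (RVec m) E)).2

theorem coeff_frame (he : IsLocalFrameOn (𝓡 n) (RVec m) ∞ e U) {q : Q} (hq : q ∈ U)
    (α β : Fin m) : he.coeff α q (e β q) = if β = α then 1 else 0 := by
  rw [he.coeff_apply_of_mem hq (e β), ← he.toBasisAt_coe hq β, Module.Basis.repr_self,
    Finsupp.single_apply]

theorem sum_coeff_smul (he : IsLocalFrameOn (𝓡 n) (RVec m) ∞ e U) {q : Q} (hq : q ∈ U)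
    (a : E q) : ∑ α, he.coeff α q a • e α q = a := by
  classical
  -- The expansion in a frame is available for sections, smooth or not, so the vector `a` is
  -- extended by zero off `q`.
  have h := he.coeff_sum_eq (fun q' => if h : q' = q then h ▸ a else 0) hq
  simpa using h.symm

theorem ext_coeff (he : IsLocalFrameOn (𝓡 n) (RVec m) ∞ e U) {q : Q} (hq : q ∈ U)
    {a b : E q} (h : ∀ α, he.coeff α q a = he.coeff α q b) : a = b := by
  rw [← sum_coeff_smul he hq a, ← sum_coeff_smul he hq b]
  simp only [h]

theorem coeff_sum_smul (he : IsLocalFrameOn (𝓡 n) (RVec m) ∞ e U) {q : Q} (hq : q ∈ U)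
    (α : Fin m) (z : Fin m → ℝ) : he.coeff α q (∑ β, z β • e β q) = z α := by
  simp [coeff_frame he hq]

theorem frameMatrix_apply_coeff (he : IsLocalFrameOn (𝓡 n) (RVec m) ∞ e U) {q₀ q : Q} (hq : q ∈ U)
    (hq₀ : q ∈ (trivializationAt (RVec m) E q₀).baseSet) (a : E q) :
    frameMatrix e q₀ q (WithLp.toLp 2 fun α => he.coeff α q a) =
      (trivializationAt (RVec m) E q₀ (⟨q, a⟩ : TotalSpace (RVec m) E)).2 := by
  have hl : ∀ b : E q, (trivializationAt (RVec m) E q₀ (⟨q, b⟩ : TotalSpace (RVec m) E)).2 =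
      (trivializationAt (RVec m) E q₀).linearEquivAt ℝ q hq₀ b := fun _ => rfl
  rw [hl a, ← sum_coeff_smul he hq a, map_sum]
  simp only [frameMatrix, sum_apply, hl, map_smul]
  refine Finset.sum_congr rfl fun α _ => ?_
  rw [sum_coeff_smul he hq a]
  rfl

/-- Every vector of the model fibre is the trivialization of some `a`, hence the image of the frame
components of `a`. So the matrix is surjective, and in finite dimension bijective. -/
theorem isInvertible_frameMatrix (he : IsLocalFrameOn (𝓡 n) (RVec m) ∞ e U) {q₀ q : Q} (hq : q ∈ U)
    (hq₀ : q ∈ (trivializationAt (RVec m) E q₀).baseSet) : (frameMatrix e q₀ q).IsInvertible := by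
  have hsurj : Function.Surjective (frameMatrix e q₀ q) := fun y => by
    refine ⟨_, (frameMatrix_apply_coeff he hq hq₀
      (((trivializationAt (RVec m) E q₀).linearEquivAt ℝ q hq₀).symm y)).trans ?_⟩
    exact ((trivializationAt (RVec m) E q₀).linearEquivAt ℝ q hq₀).apply_symm_apply y
  have hinj := LinearMap.injective_iff_surjective (f := (frameMatrix e q₀ q).toLinearMap).2 hsurj
  exact ⟨(LinearEquiv.ofBijective (frameMatrix e q₀ q).toLinearMap
    ⟨hinj, hsurj⟩).toContinuousLinearEquiv, by ext; rfl⟩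

theorem inverse_frameMatrix_apply (he : IsLocalFrameOn (𝓡 n) (RVec m) ∞ e U) {q₀ q : Q} (hq : q ∈ U)
    (hq₀ : q ∈ (trivializationAt (RVec m) E q₀).baseSet) (a : E q) (α : Fin m) :
    (frameMatrix e q₀ q).inverse
      (trivializationAt (RVec m) E q₀ (⟨q, a⟩ : TotalSpace (RVec m) E)).2 α = he.coeff α q a := by
  rw [((isInvertible_frameMatrix he hq hq₀).inverse_apply_eq).2
    (frameMatrix_apply_coeff he hq hq₀ a).symm]

theorem contMDiffAt_frameMatrix (hU : IsOpen U) (he : IsLocalFrameOn (𝓡 n) (RVec m) ∞ e U) {q : Q}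
    (hq : q ∈ U) :
    ContMDiffAt (𝓡 n) 𝓘(ℝ, RVec m →L[ℝ] RVec m) ∞ (frameMatrix e q) q := by
  have h : ∀ α, ContMDiffAt (𝓡 n) 𝓘(ℝ, RVec m) ∞
      (fun q' => (trivializationAt (RVec m) E q (⟨q', e α q'⟩ : TotalSpace (RVec m) E)).2) q :=
    fun α => (contMDiffAt_section q).1 (he.contMDiffAt hU hq α)
  unfold frameMatrix
  refine contMDiffAt_finsetSum fun α _ => ?_
  exact (ContinuousLinearMap.smulRightL ℝ (RVec m) (RVec m)
    (EuclideanSpace.proj α)).contMDiff.contMDiffAt.comp q (h α)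

theorem contMDiffAt_inverse_frameMatrix (hU : IsOpen U)
    (he : IsLocalFrameOn (𝓡 n) (RVec m) ∞ e U) {q : Q} (hq : q ∈ U) :
    ContMDiffAt (𝓡 n) 𝓘(ℝ, RVec m →L[ℝ] RVec m) ∞ (fun q' => (frameMatrix e q q').inverse) q := by
  have h := (isInvertible_frameMatrix he hq
    (FiberBundle.mem_baseSet_trivializationAt' q)).contDiffAt_map_inverse (n := ∞)
  exact h.contMDiffAt.comp q (contMDiffAt_frameMatrix hU he hq)

/-- Near `a`, the components in `e` are the inverse frame matrix applied to the components in the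
trivialization, and inversion of operators is smooth at an invertible one. -/
theorem contMDiffAt_coeff (hU : IsOpen U) (he : IsLocalFrameOn (𝓡 n) (RVec m) ∞ e U) (α : Fin m)
    {a : TotalSpace (RVec m) E} (ha : a.proj ∈ U) :
    ContMDiffAt ((𝓡 n).prod 𝓘(ℝ, RVec m)) 𝓘(ℝ, ℝ) ∞
      (fun b : TotalSpace (RVec m) E => he.coeff α b.proj b.2) a := by
  have h1 : ContMDiffAt ((𝓡 n).prod 𝓘(ℝ, RVec m)) 𝓘(ℝ, RVec m →L[ℝ] RVec m) ∞
      (fun b : TotalSpace (RVec m) E => (frameMatrix e a.proj b.proj).inverse) a :=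
    (contMDiffAt_inverse_frameMatrix hU he ha).comp a (contMDiff_proj E).contMDiffAt
  have h2 : ContMDiffAt ((𝓡 n).prod 𝓘(ℝ, RVec m)) 𝓘(ℝ, RVec m) ∞
      (fun b : TotalSpace (RVec m) E => (trivializationAt (RVec m) E a.proj b).2) a :=
    (contMDiffAt_totalSpace.1 (contMDiffAt_id (x := a))).2
  have h3 := (EuclideanSpace.proj (𝕜 := ℝ) α).contMDiff.contMDiffAt.comp a
    (h1.clm_apply h2)
  refine h3.congr_of_eventuallyEq ?_
  have hc : ContinuousAt (TotalSpace.proj : TotalSpace (RVec m) E → Q) a :=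
    (FiberBundle.continuous_proj (RVec m) E).continuousAt
  filter_upwards [hc.eventually (hU.mem_nhds ha), hc.eventually
    ((trivializationAt (RVec m) E a.proj).open_baseSet.mem_nhds
      (FiberBundle.mem_baseSet_trivializationAt' _))] with b hb hb'
  exact (inverse_frameMatrix_apply he hb hb' b.2 α).symm

/-- The converse: the frame matrix, which is smooth, carries the components in `e` back to those in
the trivialization. -/
theorem contMDiffAt_of_coeff {EP : Type*} [NormedAddCommGroup EP] [NormedSpace ℝ EP]
    {HP : Type*} [TopologicalSpace HP] {IP : ModelWithCorners ℝ EP HP}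
    {P : Type*} [TopologicalSpace P] [ChartedSpace HP P]
    (hU : IsOpen U) (he : IsLocalFrameOn (𝓡 n) (RVec m) ∞ e U)
    {f : P → Q} {a : ∀ p, E (f p)} {p : P} (hp : f p ∈ U) (hf : ContMDiffAt IP (𝓡 n) ∞ f p)
    (h : ∀ α, ContMDiffAt IP 𝓘(ℝ, ℝ) ∞ (fun p' => he.coeff α (f p') (a p')) p) :
    ContMDiffAt IP ((𝓡 n).prod 𝓘(ℝ, RVec m)) ∞
      (fun p' => (⟨f p', a p'⟩ : TotalSpace (RVec m) E)) p := by
  refine contMDiffAt_totalSpace.2 ⟨hf, ?_⟩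
  have h1 : ContMDiffAt IP 𝓘(ℝ, RVec m →L[ℝ] RVec m) ∞ (fun p' => frameMatrix e (f p) (f p')) p :=
    (contMDiffAt_frameMatrix hU he hp).comp p hf
  have h2 : ContMDiffAt IP 𝓘(ℝ, RVec m) ∞
      (fun p' => WithLp.toLp 2 fun α => he.coeff α (f p') (a p')) p :=
    ((PiLp.continuousLinearEquiv 2 ℝ (fun _ : Fin m => ℝ)).symm :
        (Fin m → ℝ) →L[ℝ] RVec m).contMDiff.contMDiffAt.comp p
      (contMDiffAt_pi_space.2 h)
  refine (h1.clm_apply h2).congr_of_eventuallyEq ?_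
  filter_upwards [hf.continuousAt.eventually (hU.mem_nhds hp), hf.continuousAt.eventually
    ((trivializationAt (RVec m) E (f p)).open_baseSet.mem_nhds
      (FiberBundle.mem_baseSet_trivializationAt' _))] with p' hp' hp''
  exact (frameMatrix_apply_coeff he hp' hp'' (a p')).symm

end FrameCoefficients

/-! ### The coordinates on `E^* × ℝ` and the components of its tangent vectors. -/

section Coordinates
variable {n m : ℕ} {Q : Type*} [TopologicalSpace Q] [ChartedSpace (RVec n) Q]
  [IsManifold (𝓡 n) ∞ Q]
  {E : Q → Type*} [TopologicalSpace (TotalSpace (RVec m) E)]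
  [∀ q, AddCommGroup (E q)] [∀ q, Module ℝ (E q)] [∀ q, TopologicalSpace (E q)]
  [∀ q, IsTopologicalAddGroup (E q)] [∀ q, ContinuousSMul ℝ (E q)]
  [FiberBundle (RVec m) E] [VectorBundle ℝ (RVec m) E] [ContMDiffVectorBundle ∞ (RVec m) E (𝓡 n)]
  {φ : OpenPartialHomeomorph Q (RVec n)} {e : Fin m → ∀ q, E q}

/-- The projection to `E^*` is a smooth family of functionals along the base map; here it is paired
with the pullback of `s`. -/
theorem contMDiffAt_pairing {s : ∀ q, E q} {p : DualLine m E}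
    (hs : ContMDiffAt (𝓡 n) ((𝓡 n).prod 𝓘(ℝ, RVec m)) ∞
      (fun q => (⟨q, s q⟩ : TotalSpace (RVec m) E)) p.1.proj) :
    ContMDiffAt (dualLineModel n m) 𝓘(ℝ, ℝ) ∞
      (fun p' : DualLine m E => (p'.1.2 (s p'.1.proj) : ℝ)) p := by
  have h1 : ContMDiffAt (dualLineModel n m) ((𝓡 n).prod 𝓘(ℝ, RVec m)) ∞
      (fun p' : DualLine m E => (⟨p'.1.proj, s p'.1.proj⟩ : TotalSpace (RVec m) E)) p :=
    hs.comp p (dualLineProj n m E).contMDiff.contMDiffAt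
  have h2 : ContMDiffAt (dualLineModel n m) ((𝓡 n).prod 𝓘(ℝ, RVec m →L[ℝ] ℝ)) ∞
      (fun p' : DualLine m E => TotalSpace.mk' (RVec m →L[ℝ] ℝ)
        (E := fun q => E q →L[ℝ] Bundle.Trivial Q ℝ q) p'.1.proj p'.1.2) p :=
    contMDiffAt_fst
  exact (contMDiffAt_totalSpace.1 (h2.clm_bundle_apply h1)).2

theorem contMDiffAt_fibreCoord (he : IsLocalFrameOn (𝓡 n) (RVec m) ∞ e φ.source) (α : Fin m)
    {p : DualLine m E} (hp : p.1.proj ∈ φ.source) :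
    ContMDiffAt (dualLineModel n m) 𝓘(ℝ, ℝ) ∞
      (fun p' : DualLine m E => (p'.1.2 (e α p'.1.proj) : ℝ)) p :=
  contMDiffAt_pairing (he.contMDiffAt φ.open_source hp α)

theorem contMDiffAt_coords (hφ : φ ∈ IsManifold.maximalAtlas (𝓡 n) ∞ Q)
    (he : IsLocalFrameOn (𝓡 n) (RVec m) ∞ e φ.source) {p : DualLine m E}
    (hp : p.1.proj ∈ φ.source) :
    ContMDiffAt (dualLineModel n m) 𝓘(ℝ, RVec n × RVec m × ℝ) ∞ (coords φ e) p := by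
  have h0 : ContMDiffAt (dualLineModel n m) (𝓡 n) ∞ (fun p' : DualLine m E => p'.1.proj) p :=
    (dualLineProj n m E).contMDiff.contMDiffAt
  refine ContMDiffAt.prodMk_space ((contMDiffAt_of_mem_maximalAtlas hφ hp).comp p h0)
    (ContMDiffAt.prodMk_space ?_ contMDiffAt_snd)
  exact ((PiLp.continuousLinearEquiv 2 ℝ (fun _ : Fin m => ℝ)).symm :
        (Fin m → ℝ) →L[ℝ] RVec m).contMDiff.contMDiffAt.comp p
      (contMDiffAt_pi_space.2 fun α => contMDiffAt_fibreCoord he α hp)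

/-- A map into the dual bundle is smooth when its representation in the trivializations is. In that
representation `e^α` is the `α`-th row of the inverse frame matrix, which is smooth. -/
theorem contMDiffAt_coordsSymm (hφ : φ ∈ IsManifold.maximalAtlas (𝓡 n) ∞ Q)
    (he : IsLocalFrameOn (𝓡 n) (RVec m) ∞ e φ.source) {x : RVec n × RVec m × ℝ}
    (hx : x.1 ∈ φ.target) :
    ContMDiffAt 𝓘(ℝ, RVec n × RVec m × ℝ) (dualLineModel n m) ∞ (coordsSymm φ he) x := by
  have h0 : ContMDiffAt 𝓘(ℝ, RVec n × RVec m × ℝ) (𝓡 n) ∞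
      (fun x : RVec n × RVec m × ℝ => φ.symm x.1) x :=
    (contMDiffAt_symm_of_mem_maximalAtlas hφ hx).comp x
      (ContinuousLinearMap.fst ℝ (RVec n) (RVec m × ℝ)).contMDiff.contMDiffAt
  have hs := φ.map_target hx
  refine ContMDiffAt.prodMk ((contMDiffAt_hom_bundle _).2 ⟨h0, ?_⟩)
    (((ContinuousLinearMap.snd ℝ (RVec m) ℝ).comp
      (ContinuousLinearMap.snd ℝ (RVec n) (RVec m × ℝ))).contMDiff.contMDiffAt)
  have h1 : ContMDiffAt 𝓘(ℝ, RVec n × RVec m × ℝ) 𝓘(ℝ, RVec m →L[ℝ] ℝ) ∞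
      (fun x' : RVec n × RVec m × ℝ => ∑ α, x'.2.1 α • (EuclideanSpace.proj α : RVec m →L[ℝ] ℝ).comp
        (frameMatrix e (φ.symm x.1) (φ.symm x'.1)).inverse) x := by
    refine contMDiffAt_finsetSum fun α _ => ?_
    have h2 := ((EuclideanSpace.proj α : RVec m →L[ℝ] ℝ).comp
        ((ContinuousLinearMap.fst ℝ (RVec m) ℝ).comp
        (ContinuousLinearMap.snd ℝ (RVec n) (RVec m × ℝ)))).contMDiff.contMDiffAt (n := ∞) (x := x)
    have h3 : ContMDiffAt 𝓘(ℝ, RVec n × RVec m × ℝ) 𝓘(ℝ, RVec m →L[ℝ] ℝ) ∞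
        (fun x' : RVec n × RVec m × ℝ => (EuclideanSpace.proj α : RVec m →L[ℝ] ℝ).comp
          (frameMatrix e (φ.symm x.1) (φ.symm x'.1)).inverse) x :=
      contMDiffAt_const.clm_comp
        ((contMDiffAt_inverse_frameMatrix φ.open_source he hs).comp x h0)
    exact h2.smul h3
  refine h1.congr_of_eventuallyEq ?_
  filter_upwards [h0.continuousAt.eventually (φ.open_source.mem_nhds hs), h0.continuousAt.eventually
    ((trivializationAt (RVec m) E (φ.symm x.1)).open_baseSet.mem_nhds
      (FiberBundle.mem_baseSet_trivializationAt' _))] with x' hx' hx''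
  refine ContinuousLinearMap.ext fun v => ?_
  have h2 : ∀ α, (frameMatrix e (φ.symm x.1) (φ.symm x'.1)).inverse v α =
      he.coeff α (φ.symm x'.1)
        (((trivializationAt (RVec m) E (φ.symm x.1)).linearEquivAt ℝ _ hx'').symm v) := fun α => by
    rw [← inverse_frameMatrix_apply he hx' hx'']
    refine congrArg (fun w => (frameMatrix e (φ.symm x.1) (φ.symm x'.1)).inverse w α) ?_
    exact (((trivializationAt (RVec m) E (φ.symm x.1)).linearEquivAt ℝ _ hx'').apply_symm_apply v).symm
  rw [ContinuousLinearMap.inCoordinates_eq hx'' (by exact mem_univ _)]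
  simp only [sum_apply, smul_apply, ContinuousLinearMap.comp_apply]
  -- The target fibre is that of the trivial line bundle, whose trivialization is the identity on
  -- fibres.
  have h3 : ∀ r : ℝ, Trivialization.continuousLinearEquivAt ℝ
      (trivializationAt ℝ (Bundle.Trivial Q ℝ) (φ.symm x.1)) (φ.symm x'.1) (mem_univ _) r = r := by
    intro r
    change Trivialization.continuousLinearEquivAt ℝ (Bundle.Trivial.trivialization Q ℝ)
      (φ.symm x'.1) (mem_univ _) r = r
    rw [Bundle.Trivial.continuousLinearEquivAt_trivialization]
    rfl
  exact (h3 _).trans (Finset.sum_congr rfl fun α _ => congrArg (x'.2.1 α * ·) (h2 α).symm)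

theorem coordsSymm_coords (he : IsLocalFrameOn (𝓡 n) (RVec m) ∞ e φ.source) {p : DualLine m E}
    (hp : p.1.proj ∈ φ.source) : coordsSymm φ he (coords φ e p) = p := by
  obtain ⟨⟨q, b⟩, s⟩ := p
  have hq : φ.symm (φ q) = q := φ.left_inv hp
  have hb : ∑ α, (b (e α q) : ℝ) • dualFrame he α q = b := by
    refine ContinuousLinearMap.ext fun a => ?_
    rw [sum_apply]
    conv_rhs => rw [← sum_coeff_smul he hp a, map_sum]
    refine Finset.sum_congr rfl fun α _ => ?_
    rw [map_smul]
    exact mul_comm _ _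
  -- The point `φ.symm (φ q)` equals `q` only propositionally while the fibre depends on it, so the
  -- base point is made a variable before the substitution.
  have key : ∀ q', q' = q → (⟨q', ∑ α, (b (e α q) : ℝ) • dualFrame he α q'⟩ :
      TotalSpace (RVec m →L[ℝ] ℝ) (fun q => E q →L[ℝ] Bundle.Trivial Q ℝ q)) = ⟨q, b⟩ := by
    rintro _ rfl
    rw [hb]
  exact Prod.ext (key _ hq) rfl

theorem coords_coordsSymm (he : IsLocalFrameOn (𝓡 n) (RVec m) ∞ e φ.source)
    {x : RVec n × RVec m × ℝ} (hx : x.1 ∈ φ.target) : coords φ e (coordsSymm φ he x) = x := by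
  refine Prod.ext (φ.right_inv hx) (Prod.ext (PiLp.ext fun α => ?_) rfl)
  change (∑ β, x.2.1 β • dualFrame he β (φ.symm x.1)) (e α (φ.symm x.1)) = x.2.1 α
  rw [sum_apply]
  change ∑ β, x.2.1 β * he.coeff β (φ.symm x.1) (e α (φ.symm x.1)) = x.2.1 α
  simp [coeff_frame he (φ.map_target hx)]

/-- The components of tangent vectors in the coordinates `(q^i, y_α, s)`. -/
noncomputable def coordVel (φ : OpenPartialHomeomorph Q (RVec n)) (e : Fin m → ∀ q, E q)
    (p : DualLine m E) : TangentSpace (dualLineModel n m) p →L[ℝ] RVec n × RVec m × ℝ :=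
  mfderiv (dualLineModel n m) 𝓘(ℝ, RVec n × RVec m × ℝ) (coords φ e) p

theorem isOpen_preimage_source (φ : OpenPartialHomeomorph Q (RVec n)) :
    IsOpen {p : DualLine m E | p.1.proj ∈ φ.source} :=
  φ.open_source.preimage (dualLineProj n m E).contMDiff.continuous

theorem coords_fst_mem {p : DualLine m E} (hp : p.1.proj ∈ φ.source) :
    (coords φ e p).1 ∈ φ.target := φ.map_source hp

theorem isOpen_target_prod (φ : OpenPartialHomeomorph Q (RVec n)) :
    IsOpen {x : RVec n × RVec m × ℝ | x.1 ∈ φ.target} :=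
  φ.open_target.preimage continuous_fst

/-- The chain rule for `coordsSymm ∘ coords`, which is the identity near `p`. It makes `coordVel`
injective. -/
theorem mfderiv_coordsSymm_coordVel (hφ : φ ∈ IsManifold.maximalAtlas (𝓡 n) ∞ Q)
    (he : IsLocalFrameOn (𝓡 n) (RVec m) ∞ e φ.source) {p : DualLine m E}
    (hp : p.1.proj ∈ φ.source) (v : TangentSpace (dualLineModel n m) p) :
    mfderiv 𝓘(ℝ, RVec n × RVec m × ℝ) (dualLineModel n m) (coordsSymm φ he) (coords φ e p)
      (coordVel φ e p v) = v := by
  have h1 := ((contMDiffAt_coords hφ he hp).mdifferentiableAt (by simp)).hasMFDerivAt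
  have h2 := ((contMDiffAt_coordsSymm hφ he (coords_fst_mem (e := e) hp)).mdifferentiableAt
    (by simp)).hasMFDerivAt
  have h3 : coordsSymm φ he ∘ coords φ e =ᶠ[𝓝 p] id := by
    filter_upwards [(isOpen_preimage_source φ).mem_nhds hp] with p' hp'
    exact coordsSymm_coords he hp'
  exact DFunLike.congr_fun (hasMFDerivAt_unique (h2.comp p h1)
    ((hasMFDerivAt_id p).congr_of_eventuallyEq h3)) v

theorem coordVel_injective (hφ : φ ∈ IsManifold.maximalAtlas (𝓡 n) ∞ Q)
    (he : IsLocalFrameOn (𝓡 n) (RVec m) ∞ e φ.source) {p : DualLine m E}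
    (hp : p.1.proj ∈ φ.source) : Function.Injective (coordVel φ e p) := fun v w h => by
  rw [← mfderiv_coordsSymm_coordVel hφ he hp v, h]
  exact mfderiv_coordsSymm_coordVel hφ he hp w

theorem coordVel_surjective (hφ : φ ∈ IsManifold.maximalAtlas (𝓡 n) ∞ Q)
    (he : IsLocalFrameOn (𝓡 n) (RVec m) ∞ e φ.source) {p : DualLine m E}
    (hp : p.1.proj ∈ φ.source) : Function.Surjective (coordVel φ e p) := fun x => by
  have hx := coords_fst_mem (e := e) hp
  have hps := coordsSymm_coords he hp
  have h1 := ((contMDiffAt_coords hφ he (p := coordsSymm φ he (coords φ e p))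
    (by rwa [hps])).mdifferentiableAt (by simp)).hasMFDerivAt
  have h2 := ((contMDiffAt_coordsSymm hφ he hx).mdifferentiableAt (by simp)).hasMFDerivAt
  have h3 : coords φ e ∘ coordsSymm φ he =ᶠ[𝓝 (coords φ e p)] id := by
    filter_upwards [(isOpen_target_prod φ).mem_nhds hx] with x' hx'
    exact coords_coordsSymm he hx'
  have h4 := DFunLike.congr_fun (hasMFDerivAt_unique (h1.comp (coords φ e p) h2)
    ((hasMFDerivAt_id (coords φ e p)).congr_of_eventuallyEq h3)) x
  -- The candidate preimage is tangent at `coordsSymm (coords p)`; this moves it to the equal point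
  -- `p`.
  have h5 : ∀ p', p' = p → ∀ w : TangentSpace (dualLineModel n m) p',
      ∃ v, coordVel φ e p v = coordVel φ e p' w := by
    rintro _ rfl w
    exact ⟨w, rfl⟩
  obtain ⟨v, hv⟩ := h5 _ hps (mfderiv 𝓘(ℝ, RVec n × RVec m × ℝ) (dualLineModel n m)
    (coordsSymm φ he) (coords φ e p) x)
  exact ⟨v, hv.trans h4⟩

/-- The vector field is recovered from its components by the tangent map of `coordsSymm`, which is
smooth over the chart's target. -/
theorem contMDiffAt_of_coordVel (hφ : φ ∈ IsManifold.maximalAtlas (𝓡 n) ∞ Q)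
    (he : IsLocalFrameOn (𝓡 n) (RVec m) ∞ e φ.source) {p : DualLine m E}
    (hp : p.1.proj ∈ φ.source) {V : ∀ p : DualLine m E, TangentSpace (dualLineModel n m) p}
    (hV : ContMDiffAt (dualLineModel n m) 𝓘(ℝ, RVec n × RVec m × ℝ) ∞
      (fun p' => coordVel φ e p' (V p')) p) :
    ContMDiffAt (dualLineModel n m) (dualLineModel n m).tangent ∞
      (fun p' => (⟨p', V p'⟩ : TangentBundle (dualLineModel n m) (DualLine m E))) p := by
  have h1 : ContMDiffOn 𝓘(ℝ, RVec n × RVec m × ℝ) (dualLineModel n m) ∞ (coordsSymm φ he)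
      {x | x.1 ∈ φ.target} := fun x hx => (contMDiffAt_coordsSymm hφ he hx).contMDiffWithinAt
  have h2 := h1.contMDiffOn_tangentMapWithin (m := ∞) (by simp)
    (isOpen_target_prod φ).uniqueMDiffOn
  have h3 : ContMDiffAt (dualLineModel n m) 𝓘(ℝ, RVec n × RVec m × ℝ).tangent ∞
      (fun p' => (⟨coords φ e p', coordVel φ e p' (V p')⟩ :
        TangentBundle 𝓘(ℝ, RVec n × RVec m × ℝ) (RVec n × RVec m × ℝ))) p :=
    contMDiffAt_totalSpace.2 ⟨contMDiffAt_coords hφ he hp, by simpa using hV⟩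
  have h4 := (h2.contMDiffAt (x := ⟨coords φ e p, coordVel φ e p (V p)⟩)
    (((isOpen_target_prod φ).preimage (FiberBundle.continuous_proj _ _)).mem_nhds
      (coords_fst_mem (e := e) hp))).comp p h3
  refine h4.congr_of_eventuallyEq ?_
  filter_upwards [(isOpen_preimage_source φ).mem_nhds hp] with p' hp'
  have h5 := mfderiv_coordsSymm_coordVel hφ he hp' (V p')
  have h6 : ∀ (p'' : DualLine m E) (w : RVec n × RVec m × ℝ →L[ℝ] TangentSpace (dualLineModel n m) p'')
      (x : RVec n × RVec m × ℝ), p'' = p' → (w x : ((RVec n × (RVec m →L[ℝ] ℝ)) × ℝ)) = V p' →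
      (⟨p', V p'⟩ : TangentBundle (dualLineModel n m) (DualLine m E)) = ⟨p'', w x⟩ := by
    rintro _ w x rfl h
    exact congrArg _ h.symm
  refine h6 _ _ _ (coordsSymm_coords he hp') ?_
  rw [← h5, mfderivWithin_of_isOpen (isOpen_target_prod φ) (coords_fst_mem (e := e) hp')]
  rfl

theorem mvfderiv_eq_fderiv_coords (hφ : φ ∈ IsManifold.maximalAtlas (𝓡 n) ∞ Q)
    (he : IsLocalFrameOn (𝓡 n) (RVec m) ∞ e φ.source) {p : DualLine m E}
    (hp : p.1.proj ∈ φ.source) {H : DualLine m E → ℝ}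
    (hH : ContMDiffAt (dualLineModel n m) 𝓘(ℝ, ℝ) ∞ H p)
    (v : TangentSpace (dualLineModel n m) p) :
    mvfderiv (dualLineModel n m) H p v =
      fderiv ℝ (fun x => H (coordsSymm φ he x)) (coords φ e p) (coordVel φ e p v) := by
  have hps := coordsSymm_coords he hp
  have h0 : ContMDiffAt 𝓘(ℝ, RVec n × RVec m × ℝ) 𝓘(ℝ, ℝ) ∞
      (fun x => H (coordsSymm φ he x)) (coords φ e p) :=
    ContMDiffAt.comp (coords φ e p) (by rwa [hps])
      (contMDiffAt_coordsSymm hφ he (coords_fst_mem (e := e) hp))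
  have h1 := ((contMDiffAt_coords hφ he hp).mdifferentiableAt (by simp)).hasMFDerivAt
  have h2 := (h0.mdifferentiableAt (by simp)).hasMFDerivAt
  have h3 : H =ᶠ[𝓝 p] (fun x => H (coordsSymm φ he x)) ∘ coords φ e := by
    filter_upwards [(isOpen_preimage_source φ).mem_nhds hp] with p' hp'
    exact congrArg H (coordsSymm_coords he hp').symm
  have h4 := ((h2.comp p h1).congr_of_eventuallyEq h3).mfderiv
  rw [← mfderiv_eq_fderiv]
  exact DFunLike.congr_fun h4 v

/-- Over the chart `H ∘ coordsSymm` is smooth, so the line derivative in `coordDeriv` is the Fréchet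
derivative applied to a fixed vector, composed with the coordinates. -/
theorem contMDiffAt_coordDeriv (hφ : φ ∈ IsManifold.maximalAtlas (𝓡 n) ∞ Q)
    (he : IsLocalFrameOn (𝓡 n) (RVec m) ∞ e φ.source) {p : DualLine m E}
    (hp : p.1.proj ∈ φ.source) {H : DualLine m E → ℝ}
    (hH : ContMDiff (dualLineModel n m) 𝓘(ℝ, ℝ) ∞ H) (v : RVec n × RVec m × ℝ) :
    ContMDiffAt (dualLineModel n m) 𝓘(ℝ, ℝ) ∞ (coordDeriv φ he H v) p := by
  have h0 : ∀ x : RVec n × RVec m × ℝ, x.1 ∈ φ.target →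
      ContDiffAt ℝ ∞ (fun x => H (coordsSymm φ he x)) x := fun x hx =>
    (hH.contMDiffAt.comp x (contMDiffAt_coordsSymm hφ he hx)).contDiffAt
  have h1 : ContDiffAt ℝ ∞ (fderiv ℝ fun x => H (coordsSymm φ he x)) (coords φ e p) :=
    (h0 _ (coords_fst_mem (e := e) hp)).fderiv_right (by simp)
  have h2 := (h1.clm_apply (contDiffAt_const (c := v))).contMDiffAt.comp p
    (contMDiffAt_coords hφ he hp)
  refine h2.congr_of_eventuallyEq ?_
  filter_upwards [(isOpen_preimage_source φ).mem_nhds hp] with p' hp'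
  exact ((h0 _ (coords_fst_mem (e := e) hp')).differentiableAt (by simp)).lineDeriv_eq_fderiv

theorem mvfderiv_eq_coordDeriv (hφ : φ ∈ IsManifold.maximalAtlas (𝓡 n) ∞ Q)
    (he : IsLocalFrameOn (𝓡 n) (RVec m) ∞ e φ.source) {p : DualLine m E}
    (hp : p.1.proj ∈ φ.source) {H : DualLine m E → ℝ}
    (hH : ContMDiff (dualLineModel n m) 𝓘(ℝ, ℝ) ∞ H)
    (v : TangentSpace (dualLineModel n m) p) :
    mvfderiv (dualLineModel n m) H p v =
      ∑ i, (coordVel φ e p v).1 i * partialQ φ he H i p +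
      ∑ α, (coordVel φ e p v).2.1 α * partialY φ he H α p +
      (coordVel φ e p v).2.2 * partialS φ he H p := by
  rw [mvfderiv_eq_fderiv_coords hφ he hp hH.contMDiffAt]
  have h0 : DifferentiableAt ℝ (fun x => H (coordsSymm φ he x)) (coords φ e p) :=
    (hH.contMDiffAt.comp _ (contMDiffAt_coordsSymm hφ he
      (coords_fst_mem (e := e) hp))).contDiffAt.differentiableAt (by simp)
  simp only [partialQ, partialY, partialS, coordDeriv, h0.lineDeriv_eq_fderiv]
  generalize fderiv ℝ (fun x => H (coordsSymm φ he x)) (coords φ e p) = D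
  obtain ⟨x, y, s⟩ := coordVel φ e p v
  have hx : x = ∑ i, x i • EuclideanSpace.single i (1 : ℝ) := by
    ext j; simp [Pi.single_apply]
  have hy : y = ∑ i, y i • EuclideanSpace.single i (1 : ℝ) := by
    ext j; simp [Pi.single_apply]
  have h1 : D (x, y, s) = D (x, 0, 0) + D (0, y, 0) + D (0, 0, s) := by
    rw [← map_add, ← map_add]; simp
  have h2 : D (x, 0, 0) = ∑ i, x i * D (EuclideanSpace.single i 1, 0, 0) := by
    change (D.comp (ContinuousLinearMap.inl ℝ (RVec n) (RVec m × ℝ))) x = _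
    conv_lhs => rw [hx, map_sum]
    exact Finset.sum_congr rfl fun i _ => map_smul _ _ _
  have h3 : D (0, y, 0) = ∑ i, y i * D (0, EuclideanSpace.single i 1, 0) := by
    change (D.comp ((ContinuousLinearMap.inr ℝ (RVec n) (RVec m × ℝ)).comp
      (ContinuousLinearMap.inl ℝ (RVec m) ℝ))) y = _
    conv_lhs => rw [hy, map_sum]
    exact Finset.sum_congr rfl fun i _ => map_smul _ _ _
  have h4 : D (0, 0, s) = s * D (0, 0, 1) := by
    rw [← smul_eq_mul, ← map_smul]; simp
  rw [h1, h2, h3, h4]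

end Coordinates

/-! ### Linear coordinates on the fibres of the prolongation, and its smooth sections. -/

section ProlongationCoordinates
variable {n m : ℕ} {Q : Type*} [TopologicalSpace Q] [ChartedSpace (RVec n) Q]
  [IsManifold (𝓡 n) ∞ Q]
  {E : Q → Type*} [TopologicalSpace (TotalSpace (RVec m) E)]
  [∀ q, AddCommGroup (E q)] [∀ q, Module ℝ (E q)] [∀ q, TopologicalSpace (E q)]
  [∀ q, IsTopologicalAddGroup (E q)] [∀ q, ContinuousSMul ℝ (E q)]
  [FiberBundle (RVec m) E] [VectorBundle ℝ (RVec m) E] [ContMDiffVectorBundle ∞ (RVec m) E (𝓡 n)]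
  {A : LieAlgebroid n m E} {φ : OpenPartialHomeomorph Q (RVec n)} {e : Fin m → ∀ q, E q}

theorem clm_coordVel (hφ : φ ∈ IsManifold.maximalAtlas (𝓡 n) ∞ Q)
    (he : IsLocalFrameOn (𝓡 n) (RVec m) ∞ e φ.source) {p : DualLine m E}
    (hp : p.1.proj ∈ φ.source) (l : RVec n × RVec m × ℝ →L[ℝ] ℝ)
    (v : TangentSpace (dualLineModel n m) p) :
    mvfderiv (dualLineModel n m) (l ∘ coords φ e) p v = l (coordVel φ e p v) := by
  have h := mvfderiv_comp p l.mdifferentiableAt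
    ((contMDiffAt_coords hφ he hp).mdifferentiableAt (by simp))
  rw [h]
  change (mfderiv 𝓘(ℝ, RVec n × RVec m × ℝ) 𝓘(ℝ, ℝ) l (coords φ e p)) _ = _
  rw [mfderiv_eq_fderiv, l.fderiv]
  rfl

theorem mvfderiv_fibreCoord (hφ : φ ∈ IsManifold.maximalAtlas (𝓡 n) ∞ Q)
    (he : IsLocalFrameOn (𝓡 n) (RVec m) ∞ e φ.source) {p : DualLine m E}
    (hp : p.1.proj ∈ φ.source) (α : Fin m) (v : TangentSpace (dualLineModel n m) p) :
    mvfderiv (dualLineModel n m) (fun p' : DualLine m E => (p'.1.2 (e α p'.1.proj) : ℝ)) p v =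
      (coordVel φ e p v).2.1 α :=
  clm_coordVel hφ he hp ((EuclideanSpace.proj α : RVec m →L[ℝ] ℝ).comp
    ((ContinuousLinearMap.fst ℝ (RVec m) ℝ).comp
      (ContinuousLinearMap.snd ℝ (RVec n) (RVec m × ℝ)))) v

theorem mvfderiv_lineCoord (hφ : φ ∈ IsManifold.maximalAtlas (𝓡 n) ∞ Q)
    (he : IsLocalFrameOn (𝓡 n) (RVec m) ∞ e φ.source) {p : DualLine m E}
    (hp : p.1.proj ∈ φ.source) (v : TangentSpace (dualLineModel n m) p) :
    mvfderiv (dualLineModel n m) (fun p' : DualLine m E => p'.2) p v = (coordVel φ e p v).2.2 :=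
  clm_coordVel hφ he hp ((ContinuousLinearMap.snd ℝ (RVec m) ℝ).comp
      (ContinuousLinearMap.snd ℝ (RVec n) (RVec m × ℝ))) v

theorem mdifferentiableAt_chartCoord (hφ : φ ∈ IsManifold.maximalAtlas (𝓡 n) ∞ Q) {q : Q}
    (hq : q ∈ φ.source) (i : Fin n) :
    MDifferentiableAt (𝓡 n) 𝓘(ℝ, ℝ) (fun q' => φ q' i) q :=
  (EuclideanSpace.proj (𝕜 := ℝ) i).mdifferentiableAt.comp q
    ((contMDiffAt_of_mem_maximalAtlas hφ hq).mdifferentiableAt (by simp))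

theorem coordVel_fst (hφ : φ ∈ IsManifold.maximalAtlas (𝓡 n) ∞ Q)
    (he : IsLocalFrameOn (𝓡 n) (RVec m) ∞ e φ.source) {p : DualLine m E}
    (hp : p.1.proj ∈ φ.source) (v : TangentSpace (dualLineModel n m) p) (i : Fin n) :
    (coordVel φ e p v).1 i = mvfderiv (𝓡 n) (fun q => φ q i) p.1.proj
      (mfderiv (dualLineModel n m) (𝓡 n) (dualLineProj n m E) p v) := by
  have h1 := clm_coordVel hφ he hp ((EuclideanSpace.proj i : RVec n →L[ℝ] ℝ).comp
    (ContinuousLinearMap.fst ℝ (RVec n) (RVec m × ℝ))) v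
  have h2 := mvfderiv_comp p (mdifferentiableAt_chartCoord hφ hp i)
    ((dualLineProj n m E).contMDiff.mdifferentiableAt (by simp))
  refine h1.symm.trans ?_
  exact DFunLike.congr_fun h2 v

/-- The differential of `φ` has a left inverse, the differential of `φ.symm`, so the chart
components separate tangent vectors. -/
theorem tangent_ext_chart (hφ : φ ∈ IsManifold.maximalAtlas (𝓡 n) ∞ Q) {q : Q}
    (hq : q ∈ φ.source) {v w : TangentSpace (𝓡 n) q}
    (h : ∀ i, mvfderiv (𝓡 n) (fun q' => φ q' i) q v = mvfderiv (𝓡 n) (fun q' => φ q' i) q w) :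
    v = w := by
  have h1 := ((contMDiffAt_of_mem_maximalAtlas hφ hq).mdifferentiableAt (by simp)).hasMFDerivAt
  have h2 := ((contMDiffAt_symm_of_mem_maximalAtlas hφ (φ.map_source hq)).mdifferentiableAt
    (by simp)).hasMFDerivAt
  have h3 : φ.symm ∘ φ =ᶠ[𝓝 q] id := by
    filter_upwards [φ.open_source.mem_nhds hq] with q' hq'
    exact φ.left_inv hq'
  have h4 := hasMFDerivAt_unique (h2.comp q h1) ((hasMFDerivAt_id q).congr_of_eventuallyEq h3)
  have h5 : ∀ (i : Fin n) (u : TangentSpace (𝓡 n) q), mvfderiv (𝓡 n) (fun q' => φ q' i) q u =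
      (EuclideanSpace.proj i : RVec n →L[ℝ] ℝ) (mfderiv (𝓡 n) (𝓡 n) φ q u) := fun i u => by
    have h6 := mvfderiv_comp q (EuclideanSpace.proj (𝕜 := ℝ) i).mdifferentiableAt
      ((contMDiffAt_of_mem_maximalAtlas hφ hq).mdifferentiableAt (by simp))
    refine (DFunLike.congr_fun h6 u).trans ?_
    change (mfderiv (𝓡 n) 𝓘(ℝ, ℝ) (EuclideanSpace.proj (𝕜 := ℝ) i) (φ q)) _ = _
    rw [mfderiv_eq_fderiv, ContinuousLinearMap.fderiv]
    rfl
  have h7 : mfderiv (𝓡 n) (𝓡 n) φ q v = mfderiv (𝓡 n) (𝓡 n) φ q w :=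
    PiLp.ext fun i => ((h5 i v).symm.trans (h i)).trans (h5 i w)
  have h8 := DFunLike.congr_fun h4 v
  have h9 := DFunLike.congr_fun h4 w
  refine h8.symm.trans (Eq.trans ?_ h9)
  exact congrArg (mfderiv (𝓡 n) (𝓡 n) φ.symm (φ q)) h7

/-- The components `(z_α, u_α, r)` of an element `(a, v)` of the prolongation: `a = ∑ z_α e_α`,
`u_α = dy_α(v)`, `r = ds(v)`. -/
noncomputable def prolongationCoords (A : LieAlgebroid n m E) (φ : OpenPartialHomeomorph Q (RVec n))
    (he : IsLocalFrameOn (𝓡 n) (RVec m) ∞ e φ.source) (p : DualLine m E) :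
    A.prolongation (dualLineProj n m E) p →ₗ[ℝ] (Fin m → ℝ) × RVec m × ℝ :=
  ((LinearMap.pi fun α => he.coeff α p.1.proj) ∘ₗ LinearMap.fst ℝ (E p.1.proj) _ ∘ₗ
      (A.prolongation (dualLineProj n m E) p).subtype).prod
    (LinearMap.snd ℝ (RVec n) (RVec m × ℝ) ∘ₗ (coordVel φ e p).toLinearMap ∘ₗ
      LinearMap.snd ℝ (E p.1.proj) _ ∘ₗ (A.prolongation (dualLineProj n m E) p).subtype)

theorem anchor_eq_sum (he : IsLocalFrameOn (𝓡 n) (RVec m) ∞ e φ.source) {q : Q}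
    (hq : q ∈ φ.source) (a : E q) (i : Fin n) :
    mvfderiv (𝓡 n) (fun q' => φ q' i) q (A.anchor q a) =
      ∑ α, A.anchorCoeff φ e i α q * he.coeff α q a := by
  conv_lhs => rw [← sum_coeff_smul he hq a]
  simp only [map_sum, map_smul, smul_eq_mul]
  exact Finset.sum_congr rfl fun α _ => mul_comm _ _

/-- This is the constraint `ρ(a) = Tπ(v)` in coordinates. It is why base velocities are not among
the `prolongationCoords`, and it becomes the first Hamilton equation. -/
theorem coordVel_fst_eq_sum (hφ : φ ∈ IsManifold.maximalAtlas (𝓡 n) ∞ Q)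
    (he : IsLocalFrameOn (𝓡 n) (RVec m) ∞ e φ.source) {p : DualLine m E}
    (hp : p.1.proj ∈ φ.source) (x : A.prolongation (dualLineProj n m E) p) (i : Fin n) :
    (coordVel φ e p x.1.2).1 i =
      ∑ α, A.anchorCoeff φ e i α p.1.proj * (A.prolongationCoords φ he p x).1 α := by
  have hx : A.anchor p.1.proj x.1.1 =
    mfderiv (dualLineModel n m) (𝓡 n) (dualLineProj n m E) p x.1.2 := x.2
  rw [coordVel_fst hφ he hp, ← hx]
  exact anchor_eq_sum he hp _ i

theorem prolongationCoords_injective (hφ : φ ∈ IsManifold.maximalAtlas (𝓡 n) ∞ Q)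
    (he : IsLocalFrameOn (𝓡 n) (RVec m) ∞ e φ.source) {p : DualLine m E}
    (hp : p.1.proj ∈ φ.source) : Function.Injective (A.prolongationCoords φ he p) := by
  intro x y h
  refine Subtype.ext (Prod.ext ?_ ?_)
  · exact ext_coeff he hp fun α => congrFun (congrArg Prod.fst h) α
  · refine coordVel_injective hφ he hp (Prod.ext (PiLp.ext fun i => ?_)
      (congrArg Prod.snd h :))
    rw [coordVel_fst_eq_sum hφ he hp, coordVel_fst_eq_sum hφ he hp, h]

theorem prolongationCoords_surjective (hφ : φ ∈ IsManifold.maximalAtlas (𝓡 n) ∞ Q)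
    (he : IsLocalFrameOn (𝓡 n) (RVec m) ∞ e φ.source) {p : DualLine m E}
    (hp : p.1.proj ∈ φ.source) : Function.Surjective (A.prolongationCoords φ he p) := by
  rintro ⟨z, y⟩
  let a : E p.1.proj := ∑ α, z α • e α p.1.proj
  -- The base components of `v` are chosen to be those of `ρ(a)`, which makes `(a, v)` satisfy the
  -- constraint; the other components are prescribed.
  obtain ⟨v, hv⟩ := coordVel_surjective hφ he hp (WithLp.toLp 2 fun i =>
    mvfderiv (𝓡 n) (fun q' => φ q' i) p.1.proj (A.anchor p.1.proj a), y)
  have hav : A.anchor p.1.proj a =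
      mfderiv (dualLineModel n m) (𝓡 n) (dualLineProj n m E) p v := by
    refine tangent_ext_chart hφ hp fun i => ?_
    refine Eq.trans ?_ (coordVel_fst hφ he hp v i)
    rw [hv]
  refine ⟨⟨(a, v), hav⟩, Prod.ext (funext fun α => coeff_sum_smul he hp α z) ?_⟩
  exact (congrArg Prod.snd hv :)

theorem finrank_prolongation (hφ : φ ∈ IsManifold.maximalAtlas (𝓡 n) ∞ Q)
    (he : IsLocalFrameOn (𝓡 n) (RVec m) ∞ e φ.source) {p : DualLine m E}
    (hp : p.1.proj ∈ φ.source) :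
    Module.finrank ℝ (A.prolongation (dualLineProj n m E) p) = 2 * m + 1 := by
  rw [(LinearEquiv.ofBijective _ ⟨prolongationCoords_injective hφ he hp,
    prolongationCoords_surjective hφ he hp⟩).finrank_eq]
  simp
  ring

/-- The coefficient is the fibre part of the tangent map of `q^i` applied to the smooth vector field
`ρ(e_α)`. As `q^i` is smooth only on the chart domain, the tangent map within that domain is used.
-/
theorem contMDiffAt_anchorCoeff (A : LieAlgebroid n m E)
    (hφ : φ ∈ IsManifold.maximalAtlas (𝓡 n) ∞ Q)
    (he : IsLocalFrameOn (𝓡 n) (RVec m) ∞ e φ.source) {q : Q} (hq : q ∈ φ.source)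
    (i : Fin n) (α : Fin m) : ContMDiffAt (𝓡 n) 𝓘(ℝ, ℝ) ∞ (A.anchorCoeff φ e i α) q := by
  have h1 : ContMDiffOn (𝓡 n) 𝓘(ℝ, ℝ) ∞ (fun q' => φ q' i) φ.source := fun q' hq' =>
    ((EuclideanSpace.proj (𝕜 := ℝ) i).contMDiff.contMDiffAt.comp q'
      (contMDiffAt_of_mem_maximalAtlas hφ hq')).contMDiffWithinAt
  have h2 := h1.contMDiffOn_tangentMapWithin (m := ∞) (by simp) φ.open_source.uniqueMDiffOn
  have h3 : ContMDiffAt (𝓡 n) (𝓡 n).tangent ∞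
      (fun q => (⟨q, A.anchor q (e α q)⟩ : TangentBundle (𝓡 n) Q)) q :=
    A.contMDiff_anchor.contMDiffAt.comp q (he.contMDiffAt φ.open_source hq α)
  have h4 := (h2.contMDiffAt (x := ⟨q, A.anchor q (e α q)⟩)
    ((φ.open_source.preimage (FiberBundle.continuous_proj _ _)).mem_nhds hq)).comp q h3
  have h5 := (contMDiff_snd_tangentBundle_modelSpace ℝ 𝓘(ℝ, ℝ) (n := ∞)).contMDiffAt.comp q h4
  refine h5.congr_of_eventuallyEq ?_
  filter_upwards [φ.open_source.mem_nhds hq] with q' hq'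
  have h6 := mfderivWithin_of_isOpen (I := 𝓡 n) (I' := 𝓘(ℝ, ℝ)) (f := fun q' => φ q' i)
    φ.open_source hq'
  exact (DFunLike.congr_fun h6 (A.anchor q' (e α q'))).symm

section Smooth
variable {Z : ∀ p, A.prolongation (dualLineProj n m E) p} {p : DualLine m E}

theorem contMDiffAt_fst_of_prolongationCoords
    (he : IsLocalFrameOn (𝓡 n) (RVec m) ∞ e φ.source) (hp : p.1.proj ∈ φ.source)
    (h1 : ∀ α, ContMDiffAt (dualLineModel n m) 𝓘(ℝ, ℝ) ∞
      (fun p' => (A.prolongationCoords φ he p' (Z p')).1 α) p) :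
    ContMDiffAt (dualLineModel n m) ((𝓡 n).prod 𝓘(ℝ, RVec m)) ∞
      (fun p => (⟨dualLineProj n m E p, (Z p).1.1⟩ : TotalSpace (RVec m) E)) p :=
  contMDiffAt_of_coeff φ.open_source he hp (dualLineProj n m E).contMDiff.contMDiffAt h1

theorem contMDiffAt_snd_of_prolongationCoords (hφ : φ ∈ IsManifold.maximalAtlas (𝓡 n) ∞ Q)
    (he : IsLocalFrameOn (𝓡 n) (RVec m) ∞ e φ.source) (hp : p.1.proj ∈ φ.source)
    (h1 : ∀ α, ContMDiffAt (dualLineModel n m) 𝓘(ℝ, ℝ) ∞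
      (fun p' => (A.prolongationCoords φ he p' (Z p')).1 α) p)
    (h2 : ∀ α, ContMDiffAt (dualLineModel n m) 𝓘(ℝ, ℝ) ∞
      (fun p' => (A.prolongationCoords φ he p' (Z p')).2.1 α) p)
    (h3 : ContMDiffAt (dualLineModel n m) 𝓘(ℝ, ℝ) ∞
      (fun p' => (A.prolongationCoords φ he p' (Z p')).2.2) p) :
    ContMDiffAt (dualLineModel n m) (dualLineModel n m).tangent ∞
      (fun p => (⟨p, (Z p).1.2⟩ : TangentBundle (dualLineModel n m) (DualLine m E))) p := by
  refine contMDiffAt_of_coordVel hφ he hp (ContMDiffAt.prodMk_space ?_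
    (ContMDiffAt.prodMk_space ?_ h3))
  · have h4 : ∀ i, ContMDiffAt (dualLineModel n m) 𝓘(ℝ, ℝ) ∞ (fun p' : DualLine m E =>
        ∑ α, A.anchorCoeff φ e i α p'.1.proj * (A.prolongationCoords φ he p' (Z p')).1 α) p :=
      fun i => contMDiffAt_finsetSum fun α _ => by
        have h6 : ContMDiffAt (dualLineModel n m) 𝓘(ℝ, ℝ) ∞
            (fun p' : DualLine m E => A.anchorCoeff φ e i α p'.1.proj) p :=
          (contMDiffAt_anchorCoeff A hφ he hp i α).comp p
            (dualLineProj n m E).contMDiff.contMDiffAt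
        exact h6.mul (h1 α)
    have h5 := ((PiLp.continuousLinearEquiv 2 ℝ (fun _ : Fin n => ℝ)).symm :
        (Fin n → ℝ) →L[ℝ] RVec n).contMDiff.contMDiffAt.comp p (contMDiffAt_pi_space.2 h4)
    refine h5.congr_of_eventuallyEq ?_
    filter_upwards [(isOpen_preimage_source φ).mem_nhds hp] with p' hp'
    exact PiLp.ext fun i => coordVel_fst_eq_sum hφ he hp' (Z p') i
  · exact ((PiLp.continuousLinearEquiv 2 ℝ (fun _ : Fin m => ℝ)).symm :
        (Fin m → ℝ) →L[ℝ] RVec m).contMDiff.contMDiffAt.comp p (contMDiffAt_pi_space.2 h2)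

end Smooth

theorem contMDiffAt_prolongationCoords_fst
    (he : IsLocalFrameOn (𝓡 n) (RVec m) ∞ e φ.source) {p : DualLine m E} (hp : p.1.proj ∈ φ.source)
    (Z : A.ProlongationSection (dualLineProj n m E)) (α : Fin m) :
    ContMDiffAt (dualLineModel n m) 𝓘(ℝ, ℝ) ∞
      (fun p' => (A.prolongationCoords φ he p' (Z.toFun p')).1 α) p :=
  (contMDiffAt_coeff φ.open_source he α
    (a := ⟨dualLineProj n m E p, (Z.toFun p).1.1⟩) hp).comp p (Z.contMDiff_fst p)

/-- The components of `Z` in the coordinates given by `φ` and `e` are smooth at `p`. -/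
def SmoothCoordsAt (φ : OpenPartialHomeomorph Q (RVec n))
    (he : IsLocalFrameOn (𝓡 n) (RVec m) ∞ e φ.source)
    (Z : ∀ p, A.prolongation (dualLineProj n m E) p) (p : DualLine m E) : Prop :=
  (∀ α, ContMDiffAt (dualLineModel n m) 𝓘(ℝ, ℝ) ∞
      (fun p' => (A.prolongationCoords φ he p' (Z p')).1 α) p) ∧
    (∀ α, ContMDiffAt (dualLineModel n m) 𝓘(ℝ, ℝ) ∞
      (fun p' => (A.prolongationCoords φ he p' (Z p')).2.1 α) p) ∧
    ContMDiffAt (dualLineModel n m) 𝓘(ℝ, ℝ) ∞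
      (fun p' => (A.prolongationCoords φ he p' (Z p')).2.2) p

/-- Smoothness is local, so it may be tested around each point in a chart and frame chosen for that
point. -/
theorem exists_prolongationSection {Z : ∀ p, A.prolongation (dualLineProj n m E) p}
    (h : ∀ p, ∃ φ ∈ IsManifold.maximalAtlas (𝓡 n) ∞ Q, ∃ (e : Fin m → ∀ q, E q)
      (he : IsLocalFrameOn (𝓡 n) (RVec m) ∞ e φ.source), p.1.proj ∈ φ.source ∧
        SmoothCoordsAt φ he Z p) :
    ∃ W : A.ProlongationSection (dualLineProj n m E), W.toFun = Z := by
  refine ⟨⟨Z, fun p => ?_, fun p => ?_⟩, rfl⟩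
  · obtain ⟨φ, -, e, he, hp, h1, -⟩ := h p
    exact contMDiffAt_fst_of_prolongationCoords he hp h1
  · obtain ⟨φ, hφ, e, he, hp, h1, h2, h3⟩ := h p
    exact contMDiffAt_snd_of_prolongationCoords hφ he hp h1 h2 h3

/-- Serves for sections with constant components, for cut-offs of these, and for sections vanishing
near `p`. -/
theorem smoothCoordsAt_of_eventuallyEq_smul
    {he : IsLocalFrameOn (𝓡 n) (RVec m) ∞ e φ.source}
    {Z : ∀ p, A.prolongation (dualLineProj n m E) p} {p : DualLine m E} {f : DualLine m E → ℝ}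
    (hf : ContMDiffAt (dualLineModel n m) 𝓘(ℝ, ℝ) ∞ f p) {y : (Fin m → ℝ) × RVec m × ℝ}
    (h : ∀ᶠ p' in 𝓝 p, A.prolongationCoords φ he p' (Z p') = f p' • y) :
    SmoothCoordsAt φ he Z p := by
  obtain ⟨z, u, r⟩ := y
  refine ⟨fun α => ?_, fun α => ?_, ?_⟩
  · exact (hf.mul (contMDiffAt_const (c := z α))).congr_of_eventuallyEq
      (h.mono fun p' h => congrArg (fun y => y.1 α) h)
  · exact (hf.mul (contMDiffAt_const (c := u α))).congr_of_eventuallyEq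
      (h.mono fun p' h => congrArg (fun y => y.2.1 α) h)
  · exact (hf.mul (contMDiffAt_const (c := r))).congr_of_eventuallyEq
      (h.mono fun p' h => congrArg (fun y => y.2.2) h)

/-- The preferred chart is shrunk to the base set of the preferred trivialization, so that one open
set carries both the coordinates and the frame. -/
theorem exists_chart_frame (q : Q) : ∃ φ ∈ IsManifold.maximalAtlas (𝓡 n) ∞ Q,
    ∃ e : Fin m → ∀ q, E q, IsLocalFrameOn (𝓡 n) (RVec m) ∞ e φ.source ∧ q ∈ φ.source := by
  let t := trivializationAt (RVec m) E q
  have hq : q ∈ t.baseSet := FiberBundle.mem_baseSet_trivializationAt' q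
  refine ⟨(chartAt (RVec n) q).restr t.baseSet,
    restr_mem_maximalAtlas _ (IsManifold.chart_mem_maximalAtlas q) t.open_baseSet, frame q,
    (t.isLocalFrameOn_localFrame_baseSet (𝓡 n) ∞ _).mono fun q' h => ?_, ?_⟩
  · rw [OpenPartialHomeomorph.restr_source' _ _ t.open_baseSet] at h
    exact h.2
  · rw [OpenPartialHomeomorph.restr_source' _ _ t.open_baseSet]
    exact ⟨mem_chart_source _ q, hq⟩

set_option maxHeartbeats 800000 in
/-- A smooth section of the prolongation with prescribed value at a point. -/
theorem exists_section_eq [T2Space Q] (p : DualLine m E)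
    (x : A.prolongation (dualLineProj n m E) p) :
    ∃ Z : A.ProlongationSection (dualLineProj n m E), Z.toFun p = x := by
  obtain ⟨φ, hφ, e, he, hp⟩ := exists_chart_frame (n := n) (m := m) (E := E) p.1.proj
  obtain ⟨χ, -, hχ⟩ := ((SmoothBumpFunction.nhds_basis_tsupport (I := 𝓡 n) p.1.proj).mem_iff).1
    (φ.open_source.mem_nhds hp)
  -- Over the chart the section has the constant components of `x`, multiplied by a cut-off that
  -- depends on the base point only; elsewhere it is zero.
  have hex : ∀ p' : DualLine m E, ∃ y : A.prolongation (dualLineProj n m E) p',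
      (p'.1.proj ∈ φ.source → A.prolongationCoords φ he p' y =
        χ p'.1.proj • A.prolongationCoords φ he p x) ∧ (p'.1.proj ∉ φ.source → y = 0) := by
    intro p'
    by_cases hp' : p'.1.proj ∈ φ.source
    · obtain ⟨y, hy⟩ := prolongationCoords_surjective (A := A) hφ he hp'
        (χ p'.1.proj • A.prolongationCoords φ he p x)
      exact ⟨y, fun _ => hy, fun h => absurd hp' h⟩
    · exact ⟨0, fun h => absurd h hp', fun _ => rfl⟩
  choose Z hZ hZ0 using hex
  have hχs : ∀ p', ContMDiffAt (dualLineModel n m) 𝓘(ℝ, ℝ) ∞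
      (fun p' : DualLine m E => χ p'.1.proj) p' := fun p' =>
    (χ.contMDiff.comp (dualLineProj n m E).contMDiff).contMDiffAt
  obtain ⟨W, rfl⟩ := exists_prolongationSection (Z := Z) fun p' => by
    by_cases hp' : p'.1.proj ∈ φ.source
    · refine ⟨φ, hφ, e, he, hp', smoothCoordsAt_of_eventuallyEq_smul (hχs p') ?_
        (y := A.prolongationCoords φ he p x)⟩
      filter_upwards [(isOpen_preimage_source φ).mem_nhds hp'] with p'' hp''
      exact hZ p'' hp''
    -- Outside the chart domain the base point is off the closed support of `χ`, so the section
    -- vanishes on a neighbourhood and any other chart and frame shows it smooth.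
    · obtain ⟨φ', hφ', e', he', hp''⟩ := exists_chart_frame (n := n) (m := m) (E := E) p'.1.proj
      refine ⟨φ', hφ', e', he', hp'', smoothCoordsAt_of_eventuallyEq_smul (hχs p') ?_ (y := 0)⟩
      have hc : IsOpen {p'' : DualLine m E | p''.1.proj ∈ (tsupport χ)ᶜ} :=
        (isClosed_tsupport χ).isOpen_compl.preimage (dualLineProj n m E).contMDiff.continuous
      filter_upwards [hc.mem_nhds fun h => hp' (hχ h)] with p'' h
      have h0 : χ p''.1.proj = 0 := image_eq_zero_of_notMem_tsupport h
      rw [smul_zero]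
      by_cases hs : p''.1.proj ∈ φ.source
      · have h1 := hZ p'' hs
        rw [h0, zero_smul] at h1
        have h2 : Z p'' = 0 :=
          prolongationCoords_injective hφ he hs (h1.trans (map_zero _).symm)
        rw [h2, map_zero]
      · rw [hZ0 p'' hs, map_zero]
  have h1 : χ p.1.proj = 1 := χ.eq_one
  have h2 := hZ p hp
  rw [h1, one_smul] at h2
  exact ⟨W, prolongationCoords_injective hφ he hp h2⟩

end ProlongationCoordinates

/-! ### Locality of the algebroid bracket and its expansion in a spanning family. -/

section LocalBracket
variable {n m : ℕ} {Q : Type*} [TopologicalSpace Q] [T2Space Q] [ChartedSpace (RVec n) Q]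
  [IsManifold (𝓡 n) ∞ Q]
  {E : Q → Type*} [TopologicalSpace (TotalSpace (RVec m) E)]
  [∀ q, AddCommGroup (E q)] [∀ q, Module ℝ (E q)] [∀ q, TopologicalSpace (E q)]
  [∀ q, IsTopologicalAddGroup (E q)] [∀ q, ContinuousSMul ℝ (E q)]
  [FiberBundle (RVec m) E] [VectorBundle ℝ (RVec m) E] [ContMDiffVectorBundle ∞ (RVec m) E (𝓡 n)]
  (A : LieAlgebroid n m E)

/-- The product of a smooth function and a smooth section. -/
noncomputable def smulSection (f : C^∞⟮𝓡 n, Q; ℝ⟯) (σ : Cₛ^∞⟮𝓡 n; RVec m, E⟯) : Cₛ^∞⟮𝓡 n; RVec m, E⟯ :=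
  ⟨fun q => f q • σ q, f.contMDiff.smul_section σ.contMDiff⟩

theorem bracket_skew (σ τ : Cₛ^∞⟮𝓡 n; RVec m, E⟯) : A.bracket σ τ = -A.bracket τ σ := by
  have := A.bracket_self (σ + τ)
  simp only [map_add, LinearMap.add_apply, A.bracket_self, zero_add, add_zero] at this
  exact eq_neg_of_add_eq_zero_left (by rw [add_comm]; exact this)

/-- Take a bump function `χ` supported where `τ` vanishes, with `χ q = 1`. Then `χ τ = 0` globally,
and the Leibniz rule for `[σ, χ τ]` at `q` leaves only `[σ, τ] q`. -/
theorem bracket_eq_zero_of_eventuallyEq (σ τ : Cₛ^∞⟮𝓡 n; RVec m, E⟯) {q : Q}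
    (h : ∀ᶠ q' in 𝓝 q, τ q' = 0) : A.bracket σ τ q = 0 := by
  obtain ⟨χ, -, hχ⟩ := ((SmoothBumpFunction.nhds_basis_tsupport (I := 𝓡 n) q).mem_iff).1 h
  have h1 : smulSection ⟨χ, χ.contMDiff⟩ τ = 0 := by
    ext q'
    by_cases hq : q' ∈ tsupport χ
    · exact (congrArg (χ q' • ·) (hχ hq)).trans (smul_zero _)
    · exact (congrArg (· • τ q') (image_eq_zero_of_notMem_tsupport hq)).trans (zero_smul _ _)
  have h2 := A.leibniz σ τ ⟨χ, χ.contMDiff⟩ q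
  change A.bracket σ (smulSection ⟨χ, χ.contMDiff⟩ τ) q = χ q • _ + _ at h2
  rw [h1, map_zero, h.self_of_nhds, smul_zero, add_zero, χ.eq_one, one_smul] at h2
  exact h2.symm

theorem bracket_congr {σ σ' τ τ' : Cₛ^∞⟮𝓡 n; RVec m, E⟯} {q : Q}
    (hσ : ∀ᶠ q' in 𝓝 q, σ q' = σ' q') (hτ : ∀ᶠ q' in 𝓝 q, τ q' = τ' q') :
    A.bracket σ τ q = A.bracket σ' τ' q := by
  have h1 := A.bracket_eq_zero_of_eventuallyEq σ (τ - τ')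
    (hτ.mono fun q' h => sub_eq_zero.2 h)
  have h2 := A.bracket_eq_zero_of_eventuallyEq τ' (σ - σ')
    (hσ.mono fun q' h => sub_eq_zero.2 h)
  rw [map_sub] at h1 h2
  have h3 : A.bracket σ τ q = A.bracket σ τ' q := sub_eq_zero.1 h1
  have h4 : A.bracket τ' σ q = A.bracket τ' σ' q := sub_eq_zero.1 h2
  rw [h3, A.bracket_skew σ, A.bracket_skew σ']
  exact congrArg Neg.neg h4

/-- The extensions inside `localBracket` are chosen arbitrarily, but the bracket sees only germs, so
any other extensions may replace them. -/
theorem localBracket_eq {s t : ∀ q, E q} {q : Q} {σ τ : Cₛ^∞⟮𝓡 n; RVec m, E⟯}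
    (hσ : ∀ᶠ q' in 𝓝 q, σ q' = s q') (hτ : ∀ᶠ q' in 𝓝 q, τ q' = t q') :
    A.localBracket s t q = A.bracket σ τ q := by
  have key : ∀ (s : ∀ q, E q) (σ : Cₛ^∞⟮𝓡 n; RVec m, E⟯), (∀ᶠ q' in 𝓝 q, σ q' = s q') →
      ∀ᶠ q' in 𝓝 q, extendGerm (n := n) (m := m) s q q' = σ q' := by
    intro s σ hσ
    have h : ∃ σ : Cₛ^∞⟮𝓡 n; RVec m, E⟯, ∀ᶠ q' in 𝓝 q, σ q' = s q' := ⟨σ, hσ⟩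
    rw [extendGerm, dif_pos h]
    filter_upwards [h.choose_spec, hσ] with q' h1 h2
    rw [h1, h2]
  exact A.bracket_congr (key s σ hσ) (key t τ hτ)

theorem exists_function_eventuallyEq {g : Q → ℝ} {q : Q} {U : Set Q} (hU : U ∈ 𝓝 q)
    (hg : ContMDiffOn (𝓡 n) 𝓘(ℝ, ℝ) ∞ g U) :
    ∃ f : C^∞⟮𝓡 n, Q; ℝ⟯, ∀ᶠ q' in 𝓝 q, f q' = g q' := by
  obtain ⟨χ, -, hχ⟩ := ((SmoothBumpFunction.nhds_basis_tsupport (I := 𝓡 n) q).mem_iff).1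
    (interior_mem_nhds.2 hU)
  refine ⟨⟨fun q' => χ q' * g q', contMDiff_of_tsupport fun q' hq' => ?_⟩, ?_⟩
  · have h1 : q' ∈ interior U := hχ (closure_mono (Function.support_mul_subset_left _ _) hq')
    exact χ.contMDiff.contMDiffAt.mul (hg.contMDiffAt (mem_interior_iff_mem_nhds.1 h1))
  · filter_upwards [χ.eventuallyEq_one] with q' hq'
    exact (congrArg (· * g q') hq').trans (one_mul _)

theorem bracket_sum_smul (σ : Cₛ^∞⟮𝓡 n; RVec m, E⟯) {τ : Cₛ^∞⟮𝓡 n; RVec m, E⟯} {q : Q}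
    {ι : Type*} [Fintype ι] (g : ι → C^∞⟮𝓡 n, Q; ℝ⟯) (F : ι → Cₛ^∞⟮𝓡 n; RVec m, E⟯)
    (hτ : ∀ᶠ q' in 𝓝 q, τ q' = ∑ i, g i q' • F i q') :
    A.bracket σ τ q = ∑ i, g i q • A.bracket σ (F i) q +
      ∑ i, mvfderiv (𝓡 n) (g i) q (A.anchor q (σ q)) • F i q := by
  have hev : ∀ (T : ι → Cₛ^∞⟮𝓡 n; RVec m, E⟯) (q' : Q), (∑ i, T i) q' = ∑ i, T i q' := fun T q' => by
    rw [← Finset.sum_apply]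
    exact congrFun (map_sum (ContMDiffSection.coeAddHom (𝓡 n) (RVec m) ∞ E) T Finset.univ) q'
  have h1 : A.bracket σ τ q = A.bracket σ (∑ i, smulSection (g i) (F i)) q :=
    A.bracket_congr (Eventually.of_forall fun _ => rfl)
      (hτ.mono fun q' h => h.trans (hev (fun i => smulSection (g i) (F i)) q').symm)
  rw [h1, map_sum, hev, ← Finset.sum_add_distrib]
  exact Finset.sum_congr rfl fun i _ => A.leibniz σ (F i) (g i) q

/-- The bracket of two sections in terms of the brackets of a family that spans them near `q`. -/
theorem bracket_sum_smul_sum_smul {σ τ : Cₛ^∞⟮𝓡 n; RVec m, E⟯} {q : Q}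
    {ι : Type*} [Fintype ι] (f g : ι → C^∞⟮𝓡 n, Q; ℝ⟯) (F : ι → Cₛ^∞⟮𝓡 n; RVec m, E⟯)
    (hσ : ∀ᶠ q' in 𝓝 q, σ q' = ∑ i, f i q' • F i q')
    (hτ : ∀ᶠ q' in 𝓝 q, τ q' = ∑ i, g i q' • F i q') :
    A.bracket σ τ q = ∑ i, ∑ j, (f i q * g j q) • A.bracket (F i) (F j) q +
      ∑ j, mvfderiv (𝓡 n) (g j) q (A.anchor q (σ q)) • F j q -
      ∑ i, mvfderiv (𝓡 n) (f i) q (A.anchor q (τ q)) • F i q := by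
  have h1 : ∀ j, A.bracket σ (F j) q = ∑ i, f i q • A.bracket (F i) (F j) q -
      ∑ i, mvfderiv (𝓡 n) (f i) q (A.anchor q (F j q)) • F i q := fun j => by
    rw [A.bracket_skew σ]
    refine (congrArg Neg.neg (A.bracket_sum_smul (F j) f F hσ)).trans ?_
    rw [neg_add, ← Finset.sum_neg_distrib, sub_eq_add_neg]
    refine congrArg (· + _) (Finset.sum_congr rfl fun i _ => ?_)
    rw [A.bracket_skew (F i), ← smul_neg]
    rfl
  rw [A.bracket_sum_smul σ g F hτ]
  simp only [h1, smul_sub, Finset.sum_sub_distrib, Finset.smul_sum, smul_smul]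
  rw [hτ.self_of_nhds, Finset.sum_comm]
  simp only [map_sum, map_smul, Finset.sum_smul, mul_comm (g _ q), smul_eq_mul]
  rw [Finset.sum_comm (f := fun i j => (mvfderiv (𝓡 n) (f j) q (A.anchor q (F i q)) * g i q) • F j q)]
  abel

end LocalBracket

/-- The algebra that makes the bracket formula independent of the frame. Here `z` and `w` are the
components of two sections in a frame `e` with `e_β = ∑ g_{βν} F_ν`, `D α β ν` is `ρ(e_α) g_{βν}`,
`B μ ν` is `[F_μ, F_ν]`, and `Zw`, `Wz` are the derivatives of the components of one section along
the other. The left side is the formula in the frame `F`, the right side the formula in `e` with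
`[e_α, e_β]` expanded by the Leibniz rule. -/
theorem bracket_change_of_frame {ι V : Type*} [Fintype ι] [AddCommGroup V] [Module ℝ V]
    (z w Zw Wz : ι → ℝ) (g : ι → ι → ℝ) (D : ι → ι → ι → ℝ) (B : ι → ι → V) (F : ι → V) :
    ∑ μ, ∑ ν, ((∑ α, z α * g α μ) * ∑ β, w β * g β ν) • B μ ν +
      ∑ ν, (∑ β, (w β * ∑ α, z α * D α β ν + Zw β * g β ν) -
        ∑ α, (z α * ∑ β, w β * D β α ν + Wz α * g α ν)) • F ν =
    ∑ α, ∑ β, (z α * w β) • (∑ μ, ∑ ν, (g α μ * g β ν) • B μ ν + ∑ ν, D α β ν • F ν -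
        ∑ ν, D β α ν • F ν) + ∑ β, (Zw β - Wz β) • ∑ ν, g β ν • F ν := by
  have h1 : ∑ μ, ∑ ν, ((∑ α, z α * g α μ) * ∑ β, w β * g β ν) • B μ ν =
      ∑ α, ∑ β, (z α * w β) • ∑ μ, ∑ ν, (g α μ * g β ν) • B μ ν := by
    simp only [Finset.sum_mul_sum, Finset.sum_smul, Finset.smul_sum, smul_smul]
    simp only [← Fintype.sum_prod_type' (f := fun μ ν => ∑ α, ∑ β, (z α * g α μ * (w β * g β ν)) • B μ ν)]
    rw [Finset.sum_comm]
    refine Finset.sum_congr rfl fun α _ => ?_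
    rw [Finset.sum_comm]
    refine Finset.sum_congr rfl fun β _ => ?_
    rw [Fintype.sum_prod_type]
    refine Finset.sum_congr rfl fun μ _ => Finset.sum_congr rfl fun ν _ => ?_
    congr 1
    ring
  have h2 : ∀ D : ι → ι → ι → ℝ, ∑ ν, (∑ α, ∑ β, (z α * w β) * D α β ν) • F ν =
      ∑ α, ∑ β, (z α * w β) • ∑ ν, D α β ν • F ν := fun D => by
    simp only [Finset.sum_smul, Finset.smul_sum, smul_smul]
    rw [Finset.sum_comm]
    exact Finset.sum_congr rfl fun α _ => Finset.sum_comm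
  have h3 : ∀ y : ι → ℝ, ∑ ν, (∑ β, y β * g β ν) • F ν = ∑ β, y β • ∑ ν, g β ν • F ν := fun y => by
    simp only [Finset.sum_smul, Finset.smul_sum, smul_smul]
    exact Finset.sum_comm
  have h4 : ∀ ν, ∑ β, (w β * ∑ α, z α * D α β ν + Zw β * g β ν) =
      ∑ α, ∑ β, (z α * w β) * D α β ν + ∑ β, Zw β * g β ν := fun ν => by
    rw [Finset.sum_add_distrib, Finset.sum_comm]
    simp only [Finset.mul_sum]
    congr 1
    exact Finset.sum_congr rfl fun _ _ => Finset.sum_congr rfl fun _ _ => by ring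
  have h5 : ∀ ν, ∑ α, (z α * ∑ β, w β * D β α ν + Wz α * g α ν) =
      ∑ α, ∑ β, (z α * w β) * D β α ν + ∑ β, Wz β * g β ν := fun ν => by
    rw [Finset.sum_add_distrib]
    simp only [Finset.mul_sum, mul_assoc]
  simp only [h4, h5, sub_smul, add_smul, Finset.sum_add_distrib, Finset.sum_sub_distrib, smul_add,
    smul_sub, h1, h2 D, h2 fun α β ν => D β α ν, h3]
  abel

/-! ### The bracket of the prolongation in an arbitrary local frame. -/

section ChangeOfFrame
variable {n m : ℕ} {Q : Type*} [TopologicalSpace Q] [T2Space Q] [ChartedSpace (RVec n) Q]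
  [IsManifold (𝓡 n) ∞ Q]
  {E : Q → Type*} [TopologicalSpace (TotalSpace (RVec m) E)]
  [∀ q, AddCommGroup (E q)] [∀ q, Module ℝ (E q)] [∀ q, TopologicalSpace (E q)]
  [∀ q, IsTopologicalAddGroup (E q)] [∀ q, ContinuousSMul ℝ (E q)]
  [FiberBundle (RVec m) E] [VectorBundle ℝ (RVec m) E] [ContMDiffVectorBundle ∞ (RVec m) E (𝓡 n)]
  {EP : Type*} [NormedAddCommGroup EP] [NormedSpace ℝ EP] [CompleteSpace EP]
  {HP : Type*} [TopologicalSpace HP] {IP : ModelWithCorners ℝ EP HP} [IP.Boundaryless]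
  {P : Type*} [TopologicalSpace P] [ChartedSpace HP P] [IsManifold IP ∞ P]

theorem contMDiffOn_frameCoord {s : ∀ q, E q} {U : Set Q} (q₀ : Q) (μ : Fin m)
    (hs : ContMDiffOn (𝓡 n) ((𝓡 n).prod 𝓘(ℝ, RVec m)) ∞
      (fun q' => (⟨q', s q'⟩ : TotalSpace (RVec m) E)) U) :
    ContMDiffOn (𝓡 n) 𝓘(ℝ, ℝ) ∞ (fun q => frameCoord q₀ μ (⟨q, s q⟩ : TotalSpace (RVec m) E))
      (U ∩ (trivializationAt (RVec m) E q₀).baseSet) := fun q hq =>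
  (EuclideanSpace.proj (𝕜 := ℝ) μ).contMDiff.contMDiffAt.comp_contMDiffWithinAt q
    (((trivializationAt (RVec m) E q₀).contMDiffWithinAt_section _ hq.2).1
      ((hs q hq.1).mono inter_subset_left))

theorem frameCoord_sum_smul {q₀ q : Q} (hq : q ∈ (trivializationAt (RVec m) E q₀).baseSet)
    (μ : Fin m) (z : Fin m → ℝ) (a : Fin m → E q) :
    frameCoord q₀ μ (⟨q, ∑ α, z α • a α⟩ : TotalSpace (RVec m) E) =
      ∑ α, z α * frameCoord q₀ μ (⟨q, a α⟩ : TotalSpace (RVec m) E) := by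
  have h : ∀ b : E q, frameCoord q₀ μ (⟨q, b⟩ : TotalSpace (RVec m) E) =
      (EuclideanSpace.proj μ : RVec m →L[ℝ] ℝ)
        ((trivializationAt (RVec m) E q₀).linearEquivAt ℝ q hq b) := fun _ => rfl
  simp only [h, map_sum, map_smul, smul_eq_mul]

theorem mdifferentiableAt_coeff_section {A : LieAlgebroid n m E} {pr : C^∞⟮IP, P; 𝓡 n, Q⟯}
    (Z : A.ProlongationSection pr) {p : P} {e : Fin m → ∀ q, E q} {U : Set Q} (hU : IsOpen U)
    (he : IsLocalFrameOn (𝓡 n) (RVec m) ∞ e U) (hp : pr p ∈ U) (α : Fin m) :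
    MDifferentiableAt IP 𝓘(ℝ, ℝ) (fun p' => he.coeff α (pr p') (Z.toFun p').1.1) p :=
  ((contMDiffAt_coeff hU he α (a := ⟨pr p, (Z.toFun p).1.1⟩) hp).comp p
    (Z.contMDiff_fst p)).mdifferentiableAt (by simp)

/-- The product rule for components that are combinations of those in `e` with coefficients `g ∘
pr`. Differentiating `g ∘ pr` along `v` gives `ρ(a) g`, by the constraint defining the prolongation.
-/
theorem mvfderiv_frameCoord_section {A : LieAlgebroid n m E} {pr : C^∞⟮IP, P; 𝓡 n, Q⟯}
    (Z W : A.ProlongationSection pr) {p : P} {e : Fin m → ∀ q, E q} {U : Set Q} (hU : IsOpen U)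
    (he : IsLocalFrameOn (𝓡 n) (RVec m) ∞ e U) (hp : pr p ∈ U) (μ : Fin m)
    (g : Fin m → C^∞⟮𝓡 n, Q; ℝ⟯) (hg : ∀ α, ∀ᶠ q in 𝓝 (pr p),
      g α q = frameCoord (pr p) μ (⟨q, e α q⟩ : TotalSpace (RVec m) E)) :
    mvfderiv IP (fun p' => frameCoord (pr p) μ (⟨pr p', (W.toFun p').1.1⟩ : TotalSpace (RVec m) E))
      p (Z.toFun p).1.2 =
    ∑ β, (he.coeff β (pr p) (W.toFun p).1.1 * (∑ α, he.coeff α (pr p) (Z.toFun p).1.1 *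
        mvfderiv (𝓡 n) (g β) (pr p) (A.anchor _ (e α (pr p)))) +
      mvfderiv IP (fun p' => he.coeff β (pr p') (W.toFun p').1.1) p (Z.toFun p).1.2 *
        g β (pr p)) := by
  have hc : ContinuousAt pr p := pr.contMDiff.continuous.continuousAt
  have hev : (fun p' => frameCoord (pr p) μ
      (⟨pr p', (W.toFun p').1.1⟩ : TotalSpace (RVec m) E)) =ᶠ[𝓝 p]
      fun p' => ∑ β, he.coeff β (pr p') (W.toFun p').1.1 * (g β ∘ pr) p' := by
    filter_upwards [hc.eventually (hU.mem_nhds hp), hc.eventually (eventually_all.2 hg),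
      hc.eventually ((trivializationAt (RVec m) E (pr p)).open_baseSet.mem_nhds
        (FiberBundle.mem_baseSet_trivializationAt' _))] with p' h1 h2 h3
    conv_lhs => rw [← sum_coeff_smul he h1 (W.toFun p').1.1]
    rw [frameCoord_sum_smul h3]
    exact Finset.sum_congr rfl fun β _ => congrArg _ (h2 β).symm
  have hd : mvfderiv IP (fun p' => frameCoord (pr p) μ
        (⟨pr p', (W.toFun p').1.1⟩ : TotalSpace (RVec m) E)) p =
      mvfderiv IP (fun p' => ∑ β, he.coeff β (pr p') (W.toFun p').1.1 * (g β ∘ pr) p') p :=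
    ContinuousLinearMap.ext fun v => DFunLike.congr_fun hev.mfderiv_eq v
  rw [hd, mvfderiv_sum_mul (fun β => mdifferentiableAt_coeff_section W hU he hp β) fun β =>
    ((g β).contMDiff.comp pr.contMDiff).mdifferentiableAt (by simp)]
  refine Finset.sum_congr rfl fun β _ => ?_
  rw [A.mvfderiv_anchor_prolongation pr Z (g β) p]
  conv_lhs => rw [← sum_coeff_smul he hp (Z.toFun p).1.1]
  simp only [map_sum, map_smul, smul_eq_mul]
  rfl

/-- The formula defining `prolongationBracketFst` holds in every local frame. -/
theorem prolongationBracketFst_eq (A : LieAlgebroid n m E) (pr : C^∞⟮IP, P; 𝓡 n, Q⟯)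
    (Z W : A.ProlongationSection pr) {p : P} {e : Fin m → ∀ q, E q} {U : Set Q} (hU : IsOpen U)
    (he : IsLocalFrameOn (𝓡 n) (RVec m) ∞ e U) (hp : pr p ∈ U) :
    A.prolongationBracketFst pr Z W p =
      ∑ α, ∑ β, (he.coeff α (pr p) (Z.toFun p).1.1 * he.coeff β (pr p) (W.toFun p).1.1) •
        A.localBracket (e α) (e β) (pr p) +
      ∑ β, (mvfderiv IP (fun p' => he.coeff β (pr p') (W.toFun p').1.1) p (Z.toFun p).1.2 -
        mvfderiv IP (fun p' => he.coeff β (pr p') (Z.toFun p').1.1) p (W.toFun p).1.2) •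
          e β (pr p) := by
  set q := pr p with hq
  have hb : q ∈ (trivializationAt (RVec m) E q).baseSet :=
    FiberBundle.mem_baseSet_trivializationAt' _
  have hbn := (trivializationAt (RVec m) E q).open_baseSet.mem_nhds hb
  let F : Fin m → Cₛ^∞⟮𝓡 n; RVec m, E⟯ := fun μ => extendGerm (frame q μ) q
  have hF : ∀ μ, ∀ᶠ q' in 𝓝 q, F μ q' = frame q μ q' := fun μ =>
    extendGerm_eventuallyEq hbn
      ((trivializationAt (RVec m) E q).contMDiffOn_localFrame_baseSet (I := 𝓡 n) ∞ _ μ)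
  let G : Fin m → Cₛ^∞⟮𝓡 n; RVec m, E⟯ := fun α => extendGerm (e α) q
  have hG : ∀ α, ∀ᶠ q' in 𝓝 q, G α q' = e α q' := fun α =>
    extendGerm_eventuallyEq (hU.mem_nhds hp) (he.contMDiffOn α)
  have hgex : ∀ α μ, ∃ f : C^∞⟮𝓡 n, Q; ℝ⟯, ∀ᶠ q' in 𝓝 q,
      f q' = frameCoord q μ (⟨q', e α q'⟩ : TotalSpace (RVec m) E) := fun α μ =>
    exists_function_eventuallyEq (inter_mem (hU.mem_nhds hp) hbn)
      (contMDiffOn_frameCoord q μ (he.contMDiffOn α))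
  choose g hg using hgex
  have hGF : ∀ α, ∀ᶠ q' in 𝓝 q, G α q' = ∑ μ, g α μ q' • F μ q' := fun α => by
    filter_upwards [hG α, eventually_all.2 hF, eventually_all.2 (hg α), hbn] with q' h1 h2 h3 h4
    rw [h1, sum_frameCoord_smul_frame h4 (e α q')]
    exact Finset.sum_congr rfl fun μ _ => by rw [h2, h3]
  -- The Leibniz rule in both arguments, applied to global extensions `G` of `e` and `F` of the
  -- preferred frame; near `q` the former are combinations of the latter with coefficients `g`.
  have hlb : ∀ α β, A.localBracket (e α) (e β) q =
      ∑ μ, ∑ ν, (g α μ q * g β ν q) • A.localBracket (frame q μ) (frame q ν) q +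
      ∑ ν, mvfderiv (𝓡 n) (g β ν) q (A.anchor q (e α q)) • frame q ν q -
      ∑ ν, mvfderiv (𝓡 n) (g α ν) q (A.anchor q (e β q)) • frame q ν q := fun α β => by
    rw [A.localBracket_eq (hG α) (hG β), A.bracket_sum_smul_sum_smul (g α) (g β) F (hGF α) (hGF β)]
    simp only [fun μ ν => A.localBracket_eq (hF μ) (hF ν), fun μ => (hF μ).self_of_nhds,
      fun α => (hG α).self_of_nhds]
  have hz : ∀ (Z : A.ProlongationSection pr) μ, frameCoord q μ
      (⟨pr p, (Z.toFun p).1.1⟩ : TotalSpace (RVec m) E) =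
      ∑ α, he.coeff α q (Z.toFun p).1.1 * g α μ q := fun Z μ => by
    conv_lhs => rw [← sum_coeff_smul he hp (Z.toFun p).1.1]
    rw [frameCoord_sum_smul hb]
    exact Finset.sum_congr rfl fun α _ => congrArg _ (hg α μ).self_of_nhds.symm
  have he' : ∀ β, e β q = ∑ ν, g β ν q • frame q ν q := fun β => by
    rw [← (hG β).self_of_nhds, (hGF β).self_of_nhds]
    exact Finset.sum_congr rfl fun ν _ => by rw [(hF ν).self_of_nhds]
  have hdz : ∀ (Z W : A.ProlongationSection pr) μ, _ := fun Z W μ =>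
    mvfderiv_frameCoord_section Z W hU he hp μ (fun α => g α μ) fun α => hg α μ
  refine Eq.trans ?_ ((bracket_change_of_frame (fun α => he.coeff α q (Z.toFun p).1.1)
    (fun α => he.coeff α q (W.toFun p).1.1)
    (fun β => mvfderiv IP (fun p' => he.coeff β (pr p') (W.toFun p').1.1) p (Z.toFun p).1.2)
    (fun β => mvfderiv IP (fun p' => he.coeff β (pr p') (Z.toFun p').1.1) p (W.toFun p).1.2)
    (fun α μ => g α μ q)
    (fun α β ν => mvfderiv (𝓡 n) (g β ν) q (A.anchor q (e α q)))
    (fun μ ν => A.localBracket (frame q μ) (frame q ν) q) (fun ν => frame q ν q)).trans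
    (congrArg₂ (· + ·) (Finset.sum_congr rfl fun α _ => Finset.sum_congr rfl fun β _ =>
      congrArg _ (hlb α β).symm) (Finset.sum_congr rfl fun β _ => congrArg _ (he' β).symm)))
  exact congrArg₂ (· + ·) (Finset.sum_congr rfl fun μ _ => Finset.sum_congr rfl fun ν _ =>
      congrArg (· • _) (congrArg₂ (· * ·) (hz Z μ) (hz W ν)))
    (Finset.sum_congr rfl fun ν _ => congrArg (· • _) (congrArg₂ (· - ·) (hdz Z W ν) (hdz W Z ν)))

end ChangeOfFrame

/-! ### The forms `η` and `dη` in coordinates. -/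

theorem map_sum_smul_add_sum_smul {ι V : Type*} [Fintype ι] [AddCommGroup V] [Module ℝ V]
    (L : V →ₗ[ℝ] ℝ) (c : ι → ι → ℝ) (B : ι → ι → V) (d : ι → ℝ) (F : ι → V) :
    L (∑ α, ∑ β, c α β • B α β + ∑ β, d β • F β) =
      ∑ α, ∑ β, c α β * L (B α β) + ∑ β, d β * L (F β) := by
  simp only [map_add, map_sum, map_smul, smul_eq_mul]

/-- The cancellation that makes `dη` tensorial. Here `a` and `b` are the derivatives of `ds(W)`
along `Z` and of `ds(Z)` along `W`, `dz` and `dw` those of the frame components, `u` and `u'` the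
fibre velocities of `Z` and `W`, and `S` the term with the structure functions. -/
theorem sub_sub_sub_eq_form_add {ι : Type*} [Fintype ι] (a b S : ℝ) (y z w dz dw u u' : ι → ℝ) :
    a - ∑ α, (y α * dw α + u α * w α) - (b - ∑ α, (y α * dz α + u' α * z α)) -
      (a - b - (S + ∑ α, (dw α - dz α) * y α)) = ∑ α, (u' α * z α - u α * w α) + S := by
  have h : ∑ α, (dw α - dz α) * y α = ∑ α, y α * dw α - ∑ α, y α * dz α := by
    rw [← Finset.sum_sub_distrib]
    exact Finset.sum_congr rfl fun α _ => by ring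
  rw [h, Finset.sum_add_distrib, Finset.sum_add_distrib, Finset.sum_sub_distrib]
  ring

section ContactForm
variable {n m : ℕ} {Q : Type*} [TopologicalSpace Q] [ChartedSpace (RVec n) Q]
  [IsManifold (𝓡 n) ∞ Q]
  {E : Q → Type*} [TopologicalSpace (TotalSpace (RVec m) E)]
  [∀ q, AddCommGroup (E q)] [∀ q, Module ℝ (E q)] [∀ q, TopologicalSpace (E q)]
  [∀ q, IsTopologicalAddGroup (E q)] [∀ q, ContinuousSMul ℝ (E q)]
  [FiberBundle (RVec m) E] [VectorBundle ℝ (RVec m) E] [ContMDiffVectorBundle ∞ (RVec m) E (𝓡 n)]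
  {A : LieAlgebroid n m E} {φ : OpenPartialHomeomorph Q (RVec n)} {e : Fin m → ∀ q, E q}

/-- The value `⟨b, [e_α, e_β]⟩ = C^γ_{αβ} y_γ` at `p = (b, s)`. -/
noncomputable def pairedBracket (A : LieAlgebroid n m E) (e : Fin m → ∀ q, E q) (α β : Fin m)
    (p : DualLine m E) : ℝ :=
  p.1.2 (A.localBracket (e α) (e β) p.1.proj)

/-- The bilinear form `dη` at `p` in the coordinates given by `φ` and `e`. -/
noncomputable def contactForm (A : LieAlgebroid n m E) (e : Fin m → ∀ q, E q)
    (p : DualLine m E) (x w : (Fin m → ℝ) × RVec m × ℝ) : ℝ :=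
  ∑ α, (w.2.1 α * x.1 α - x.2.1 α * w.1 α) +
    ∑ α, ∑ β, x.1 α * w.1 β * A.pairedBracket e α β p

theorem liouvilleSection_apply (he : IsLocalFrameOn (𝓡 n) (RVec m) ∞ e φ.source)
    {p : DualLine m E} (hp : p.1.proj ∈ φ.source) (x : A.prolongation (dualLineProj n m E) p) :
    A.liouvilleSection p x =
      ∑ α, (p.1.2 (e α p.1.proj) : ℝ) * (A.prolongationCoords φ he p x).1 α := by
  change (p.1.2 : E p.1.proj →L[ℝ] ℝ) x.1.1 = _
  conv_lhs => rw [← sum_coeff_smul he hp x.1.1]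
  rw [map_sum]
  exact Finset.sum_congr rfl fun α _ => (map_smul _ _ _).trans (mul_comm _ _)

theorem verticalSection_apply (hφ : φ ∈ IsManifold.maximalAtlas (𝓡 n) ∞ Q)
    (he : IsLocalFrameOn (𝓡 n) (RVec m) ∞ e φ.source)
    {p : DualLine m E} (hp : p.1.proj ∈ φ.source) (x : A.prolongation (dualLineProj n m E) p) :
    A.verticalSection p x = (A.prolongationCoords φ he p x).2.2 :=
  mvfderiv_lineCoord hφ he hp x.1.2

theorem contactSection_apply (hφ : φ ∈ IsManifold.maximalAtlas (𝓡 n) ∞ Q)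
    (he : IsLocalFrameOn (𝓡 n) (RVec m) ∞ e φ.source)
    {p : DualLine m E} (hp : p.1.proj ∈ φ.source) (x : A.prolongation (dualLineProj n m E) p) :
    A.contactSection p x = (A.prolongationCoords φ he p x).2.2 -
      ∑ α, (p.1.2 (e α p.1.proj) : ℝ) * (A.prolongationCoords φ he p x).1 α := by
  rw [← liouvilleSection_apply he hp, ← verticalSection_apply hφ he hp]
  rfl

theorem contMDiff_lineCoord : ContMDiff (dualLineModel n m) 𝓘(ℝ, ℝ) ∞
    (fun p : DualLine m E => p.2) := contMDiff_snd

theorem contMDiff_verticalSection (W : A.ProlongationSection (dualLineProj n m E)) :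
    ContMDiff (dualLineModel n m) 𝓘(ℝ, ℝ) ∞ (fun p => A.verticalSection p (W.toFun p)) :=
  contMDiff_mvfderiv_apply contMDiff_lineCoord W.contMDiff_snd

theorem contMDiff_contactSection (W : A.ProlongationSection (dualLineProj n m E)) :
    ContMDiff (dualLineModel n m) 𝓘(ℝ, ℝ) ∞ (fun p => A.contactSection p (W.toFun p)) := by
  intro p
  obtain ⟨φ, hφ, e, he, hp⟩ := exists_chart_frame (n := n) (m := m) (E := E) p.1.proj
  have h1 : ContMDiffAt (dualLineModel n m) 𝓘(ℝ, ℝ) ∞ (fun p' : DualLine m E =>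
      ∑ α, (p'.1.2 (e α p'.1.proj) : ℝ) * (A.prolongationCoords φ he p' (W.toFun p')).1 α) p :=
    contMDiffAt_finsetSum fun α _ =>
      (contMDiffAt_fibreCoord he α hp).mul (contMDiffAt_prolongationCoords_fst he hp W α)
  refine ((contMDiff_verticalSection W p).sub h1).congr_of_eventuallyEq ?_
  filter_upwards [(isOpen_preimage_source φ).mem_nhds hp] with p' hp'
  rw [contactSection_apply hφ he hp', verticalSection_apply hφ he hp']

/-- The product rule applied to `η(W) = ds(W) - ∑ y_α w_α`; the derivative of `y_α` along `v` is the
fibre velocity of `v`. -/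
theorem mvfderiv_contactSection (hφ : φ ∈ IsManifold.maximalAtlas (𝓡 n) ∞ Q)
    (he : IsLocalFrameOn (𝓡 n) (RVec m) ∞ e φ.source)
    {p : DualLine m E} (hp : p.1.proj ∈ φ.source)
    (W : A.ProlongationSection (dualLineProj n m E)) (v : TangentSpace (dualLineModel n m) p) :
    mvfderiv (dualLineModel n m) (fun p' => A.contactSection p' (W.toFun p')) p v =
      mvfderiv (dualLineModel n m) (fun p' => A.verticalSection p' (W.toFun p')) p v -
      ∑ α, ((p.1.2 (e α p.1.proj) : ℝ) * mvfderiv (dualLineModel n m)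
          (fun p' => (A.prolongationCoords φ he p' (W.toFun p')).1 α) p v +
        (coordVel φ e p v).2.1 α * (A.prolongationCoords φ he p (W.toFun p)).1 α) := by
  have hy : ∀ α, MDifferentiableAt (dualLineModel n m) 𝓘(ℝ, ℝ)
      (fun p' : DualLine m E => (p'.1.2 (e α p'.1.proj) : ℝ)) p := fun α =>
    (contMDiffAt_fibreCoord he α hp).mdifferentiableAt (by simp)
  have hw : ∀ α, MDifferentiableAt (dualLineModel n m) 𝓘(ℝ, ℝ)
      (fun p' => (A.prolongationCoords φ he p' (W.toFun p')).1 α) p := fun α =>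
    (contMDiffAt_prolongationCoords_fst he hp W α).mdifferentiableAt (by simp)
  have hs : MDifferentiableAt (dualLineModel n m) 𝓘(ℝ, ℝ) (fun p' : DualLine m E =>
      ∑ α, (p'.1.2 (e α p'.1.proj) : ℝ) * (A.prolongationCoords φ he p' (W.toFun p')).1 α) p :=
    (contMDiffAt_finsetSum fun α _ => (contMDiffAt_fibreCoord he α hp).mul
      (contMDiffAt_prolongationCoords_fst he hp W α)).mdifferentiableAt (by simp)
  have hev : (fun p' => A.contactSection p' (W.toFun p')) =ᶠ[𝓝 p]
      (fun p' => A.verticalSection p' (W.toFun p')) - fun p' : DualLine m E =>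
      ∑ α, (p'.1.2 (e α p'.1.proj) : ℝ) * (A.prolongationCoords φ he p' (W.toFun p')).1 α := by
    filter_upwards [(isOpen_preimage_source φ).mem_nhds hp] with p' hp'
    rw [contactSection_apply hφ he hp', Pi.sub_apply, verticalSection_apply hφ he hp']
  refine (DFunLike.congr_fun hev.mfderiv_eq v).trans ?_
  refine (DFunLike.congr_fun (mvfderiv_sub
    ((contMDiff_verticalSection W).mdifferentiableAt (by simp)) hs) v).trans ?_
  refine congrArg (fun r : ℝ => mvfderiv (dualLineModel n m)
    (fun p' => A.verticalSection p' (W.toFun p')) p v - r) ?_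
  refine (mvfderiv_sum_mul hy hw v).trans ?_
  simp only [mvfderiv_fibreCoord hφ he hp]

variable [T2Space Q]

/-- `dη` in coordinates. -/
theorem extDeriv_contactSection (hφ : φ ∈ IsManifold.maximalAtlas (𝓡 n) ∞ Q)
    (he : IsLocalFrameOn (𝓡 n) (RVec m) ∞ e φ.source)
    {p : DualLine m E} (hp : p.1.proj ∈ φ.source)
    (Z W : A.ProlongationSection (dualLineProj n m E)) :
    extDeriv A.contactSection Z W p = A.contactForm e p
      (A.prolongationCoords φ he p (Z.toFun p)) (A.prolongationCoords φ he p (W.toFun p)) := by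
  -- The identity `[Z, W] s = Z (W s) - W (Z s)` expresses that `ds` is closed; it cancels the
  -- derivatives of `ds(Z)` and `ds(W)` in `dη`.
  have h1 := mvfderiv_mlieBracket (x := p) contMDiff_lineCoord.contMDiffAt
    (Z.contMDiff_snd.mdifferentiableAt (by simp)) (W.contMDiff_snd.mdifferentiableAt (by simp))
    ((contMDiff_verticalSection Z).mdifferentiableAt (by simp))
    ((contMDiff_verticalSection W).mdifferentiableAt (by simp))
  have h2 : A.contactSection p (A.prolongationBracket (dualLineProj n m E) Z W p) =
      mvfderiv (dualLineModel n m) (fun p' => A.verticalSection p' (W.toFun p')) p (Z.anchor p) -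
      mvfderiv (dualLineModel n m) (fun p' => A.verticalSection p' (Z.toFun p')) p (W.anchor p) -
      (p.1.2 : E p.1.proj →L[ℝ] ℝ) (A.prolongationBracketFst (dualLineProj n m E) Z W p) :=
    congrArg (· - _) h1
  have h3 : (p.1.2 : E p.1.proj →L[ℝ] ℝ)
        (A.prolongationBracketFst (dualLineProj n m E) Z W p) =
      ∑ α, ∑ β, (A.prolongationCoords φ he p (Z.toFun p)).1 α *
        (A.prolongationCoords φ he p (W.toFun p)).1 β * A.pairedBracket e α β p +
      ∑ β, (mvfderiv (dualLineModel n m)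
          (fun p' => (A.prolongationCoords φ he p' (W.toFun p')).1 β) p (Z.anchor p) -
        mvfderiv (dualLineModel n m)
          (fun p' => (A.prolongationCoords φ he p' (Z.toFun p')).1 β) p (W.anchor p)) *
        (p.1.2 (e β p.1.proj) : ℝ) := by
    -- The frame `e` is in general not the preferred one at `p.1.proj`, hence the need for the
    -- bracket formula in every frame.
    have h4 := congrArg (p.1.2 : E p.1.proj →L[ℝ] ℝ)
      (A.prolongationBracketFst_eq (dualLineProj n m E) Z W φ.open_source he hp)
    have h5 := map_sum_smul_add_sum_smul (p.1.2 : E p.1.proj →L[ℝ] ℝ).toLinearMap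
      (fun α β => he.coeff α p.1.proj (Z.toFun p).1.1 * he.coeff β p.1.proj (W.toFun p).1.1)
      (fun α β => A.localBracket (e α) (e β) p.1.proj)
      (fun β => mvfderiv (dualLineModel n m)
          (fun p' : DualLine m E => he.coeff β p'.1.proj (W.toFun p').1.1) p (Z.anchor p) -
        mvfderiv (dualLineModel n m)
          (fun p' : DualLine m E => he.coeff β p'.1.proj (Z.toFun p').1.1) p (W.anchor p))
      (fun β => e β p.1.proj)
    exact h4.trans h5
  refine (congrArg₂ (· - ·) (congrArg₂ (· - ·) (mvfderiv_contactSection hφ he hp W (Z.anchor p))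
    (mvfderiv_contactSection hφ he hp Z (W.anchor p)))
    (h2.trans (congrArg (fun r : ℝ => _ - _ - r) h3))).trans ?_
  exact sub_sub_sub_eq_form_add _ _ _ _ _ _ _ _ _ _

end ContactForm

/-! ### Nondegeneracy, the Reeb and Hamiltonian sections, and Hamilton's equations. -/

section Hamiltonian
variable {n m : ℕ} {Q : Type*} [TopologicalSpace Q] [ChartedSpace (RVec n) Q]
  [IsManifold (𝓡 n) ∞ Q]
  {E : Q → Type*} [TopologicalSpace (TotalSpace (RVec m) E)]
  [∀ q, AddCommGroup (E q)] [∀ q, Module ℝ (E q)] [∀ q, TopologicalSpace (E q)]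
  [∀ q, IsTopologicalAddGroup (E q)] [∀ q, ContinuousSMul ℝ (E q)]
  [FiberBundle (RVec m) E] [VectorBundle ℝ (RVec m) E] [ContMDiffVectorBundle ∞ (RVec m) E (𝓡 n)]
  {A : LieAlgebroid n m E} {φ : OpenPartialHomeomorph Q (RVec n)} {e : Fin m → ∀ q, E q}

theorem pairedBracket_skew [T2Space Q] (α β : Fin m) (p : DualLine m E) :
    A.pairedBracket e α β p = -A.pairedBracket e β α p := by
  have h : A.localBracket (e α) (e β) p.1.proj = -A.localBracket (e β) (e α) p.1.proj := by
    unfold localBracket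
    rw [A.bracket_skew]
    rfl
  exact (congrArg (p.1.2 : E p.1.proj →L[ℝ] ℝ) h).trans (map_neg _ _)

theorem pairedBracket_eq_sum (he : IsLocalFrameOn (𝓡 n) (RVec m) ∞ e φ.source) {p : DualLine m E}
    (hp : p.1.proj ∈ φ.source) (α β : Fin m) :
    A.pairedBracket e α β p =
      ∑ γ, A.bracketCoeff he γ α β p.1.proj * (coords φ e p).2.1 γ := by
  unfold pairedBracket
  conv_lhs => rw [← sum_coeff_smul he hp (A.localBracket (e α) (e β) p.1.proj)]
  rw [map_sum]
  exact Finset.sum_congr rfl fun γ _ => map_smul _ _ _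

theorem contactForm_fibre (p : DualLine m E) (x : (Fin m → ℝ) × RVec m × ℝ) (α : Fin m) :
    A.contactForm e p x (0, EuclideanSpace.single α 1, 0) = x.1 α := by
  simp [contactForm]

theorem contactForm_frame (p : DualLine m E) (x : (Fin m → ℝ) × RVec m × ℝ) (β : Fin m) :
    A.contactForm e p x (Pi.single β 1, 0, 0) =
      -x.2.1 β + ∑ α, x.1 α * A.pairedBracket e α β p := by
  simp [contactForm, Pi.single_apply]

/-- Nondegeneracy. Testing `dη` on fibre directions reads off `z`; testing on frame directions gives
`-u` plus a term in `z` already known; the value `r - ∑ y_α z_α` of `η` then fixes `r`. -/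
theorem ext_of_contactForm {p : DualLine m E} {x x' : (Fin m → ℝ) × RVec m × ℝ}
    (h : ∀ w, A.contactForm e p x w = A.contactForm e p x' w) {y : Fin m → ℝ}
    (h' : x.2.2 - ∑ α, y α * x.1 α = x'.2.2 - ∑ α, y α * x'.1 α) : x = x' := by
  have h1 : x.1 = x'.1 := funext fun α => by
    rw [← contactForm_fibre (A := A) (e := e) p x α, h, contactForm_fibre]
  have h2 : x.2.1 = x'.2.1 := PiLp.ext fun β => by
    have := h (Pi.single β 1, 0, 0)
    rw [contactForm_frame, contactForm_frame, h1] at this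
    linarith
  have h3 : x.2.2 = x'.2.2 := by
    rw [h1] at h'
    linarith
  exact Prod.ext h1 (Prod.ext h2 h3)

theorem prolongation_ext (hφ : φ ∈ IsManifold.maximalAtlas (𝓡 n) ∞ Q)
    (he : IsLocalFrameOn (𝓡 n) (RVec m) ∞ e φ.source) {p : DualLine m E}
    (hp : p.1.proj ∈ φ.source) {x x' : A.prolongation (dualLineProj n m E) p}
    (h : ∀ w : A.prolongation (dualLineProj n m E) p,
      A.contactForm e p (A.prolongationCoords φ he p x) (A.prolongationCoords φ he p w) =
      A.contactForm e p (A.prolongationCoords φ he p x') (A.prolongationCoords φ he p w))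
    (h' : A.contactSection p x = A.contactSection p x') : x = x' := by
  refine prolongationCoords_injective hφ he hp (ext_of_contactForm (A := A) (e := e) (p := p)
    (y := fun α => (p.1.2 (e α p.1.proj) : ℝ)) (fun w => ?_) ?_)
  · obtain ⟨w, rfl⟩ := prolongationCoords_surjective (A := A) hφ he hp w
    exact h w
  · rw [contactSection_apply hφ he hp, contactSection_apply hφ he hp] at h'
    exact h'

/-- The components of the Hamiltonian section. -/
noncomputable def hamiltonianCoords (A : LieAlgebroid n m E)
    (φ : OpenPartialHomeomorph Q (RVec n)) (he : IsLocalFrameOn (𝓡 n) (RVec m) ∞ e φ.source)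
    (H : DualLine m E → ℝ) (p : DualLine m E) : (Fin m → ℝ) × RVec m × ℝ :=
  (fun α => partialY φ he H α p,
    WithLp.toLp 2 fun α => -(∑ i, A.anchorCoeff φ e i α p.1.proj * partialQ φ he H i p +
      ∑ β, A.pairedBracket e α β p * partialY φ he H β p +
      (p.1.2 (e α p.1.proj) : ℝ) * partialS φ he H p),
    ∑ α, (p.1.2 (e α p.1.proj) : ℝ) * partialY φ he H α p - H p)

/-- The equation `i_ξ dη = dH - (∂H/∂s) η` in components, with `(z, u, r)` a test vector and `c α β`
standing for `C^γ_{αβ} y_γ`. Skew-symmetry of `c` cancels the bracket term of `dη` against the one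
in the fibre velocity of `ξ`, and `r` cancels between `dH` and `η`. -/
theorem contactForm_hamiltonian_identity {ι κ : Type*} [Fintype ι] [Fintype κ]
    (z u y Hy : ι → ℝ) (r Hs : ℝ) (Hq : κ → ℝ) (ρ : κ → ι → ℝ) {c : ι → ι → ℝ}
    (hc : ∀ α β, c α β = -c β α) :
    ∑ α, (u α * Hy α - -(∑ i, ρ i α * Hq i + ∑ β, c α β * Hy β + y α * Hs) * z α) +
        ∑ α, ∑ β, Hy α * z β * c α β =
      ∑ i, (∑ α, ρ i α * z α) * Hq i + ∑ α, u α * Hy α + r * Hs -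
        Hs * (r - ∑ α, y α * z α) := by
  have h2 : ∑ α, ∑ β, Hy α * z β * c α β = -∑ α, (∑ β, c α β * Hy β) * z α := by
    rw [Finset.sum_comm, ← Finset.sum_neg_distrib]
    refine Finset.sum_congr rfl fun α _ => ?_
    rw [Finset.sum_mul, ← Finset.sum_neg_distrib]
    refine Finset.sum_congr rfl fun β _ => ?_
    rw [hc β α]
    ring
  have h3 : ∑ i, (∑ α, ρ i α * z α) * Hq i = ∑ α, (∑ i, ρ i α * Hq i) * z α := by
    simp only [Finset.sum_mul]
    rw [Finset.sum_comm]
    exact Finset.sum_congr rfl fun α _ => Finset.sum_congr rfl fun i _ => by ring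
  have h4 : Hs * ∑ α, y α * z α = ∑ α, y α * Hs * z α := by
    rw [Finset.mul_sum]
    exact Finset.sum_congr rfl fun α _ => by ring
  simp only [neg_mul, sub_neg_eq_add, add_mul, Finset.sum_add_distrib]
  rw [h2, h3, mul_sub, h4]
  ring

theorem contactForm_hamiltonianCoords [T2Space Q] (hφ : φ ∈ IsManifold.maximalAtlas (𝓡 n) ∞ Q)
    (he : IsLocalFrameOn (𝓡 n) (RVec m) ∞ e φ.source) {p : DualLine m E}
    (hp : p.1.proj ∈ φ.source) {H : DualLine m E → ℝ}
    (hH : ContMDiff (dualLineModel n m) 𝓘(ℝ, ℝ) ∞ H)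
    (w : A.prolongation (dualLineProj n m E) p) :
    A.contactForm e p (A.hamiltonianCoords φ he H p) (A.prolongationCoords φ he p w) =
      mvfderiv (dualLineModel n m) H p w.1.2 - partialS φ he H p * A.contactSection p w := by
  refine (contactForm_hamiltonian_identity (A.prolongationCoords φ he p w).1
    (A.prolongationCoords φ he p w).2.1 (fun α => (p.1.2 (e α p.1.proj) : ℝ))
    (fun α => partialY φ he H α p) (A.prolongationCoords φ he p w).2.2 (partialS φ he H p)
    (fun i => partialQ φ he H i p) (fun i α => A.anchorCoeff φ e i α p.1.proj)
    (c := fun α β => A.pairedBracket e α β p) fun α β => pairedBracket_skew α β p).trans ?_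
  refine congrArg₂ (· - ·) (Eq.trans ?_ (mvfderiv_eq_coordDeriv hφ he hp hH w.1.2).symm)
    (congrArg (partialS φ he H p * ·) (contactSection_apply hφ he hp w).symm)
  exact congrArg (fun x : ℝ => x + _ + _) (Finset.sum_congr rfl fun i _ =>
    congrArg (· * partialQ φ he H i p) (coordVel_fst_eq_sum hφ he hp w i).symm)

theorem smoothAt_pairedBracket [T2Space Q] (he : IsLocalFrameOn (𝓡 n) (RVec m) ∞ e φ.source)
    {p : DualLine m E} (hp : p.1.proj ∈ φ.source) (α β : Fin m) :
    ContMDiffAt (dualLineModel n m) 𝓘(ℝ, ℝ) ∞ (A.pairedBracket e α β) p := by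
  -- `localBracket` chooses new extensions at every point. The ones chosen at `p.1.proj` agree with
  -- `e` around each nearby point as well, so locality lets a single bracket of global sections be
  -- used there.
  have h : ∀ α, ∀ᶠ q in 𝓝 p.1.proj, ∀ᶠ q' in 𝓝 q,
      extendGerm (n := n) (m := m) (e α) p.1.proj q' = e α q' := fun α =>
    (extendGerm_eventuallyEq (φ.open_source.mem_nhds hp) (he.contMDiffOn α)).eventually_nhds
  have h1 := contMDiffAt_pairing (n := n) (m := m) (p := p) (A.bracket (extendGerm (e α) p.1.proj)
    (extendGerm (e β) p.1.proj)).contMDiff.contMDiffAt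
  refine h1.congr_of_eventuallyEq ?_
  have hc : ContinuousAt (fun p' : DualLine m E => p'.1.proj) p :=
    (dualLineProj n m E).contMDiff.continuous.continuousAt
  filter_upwards [hc.eventually (h α), hc.eventually (h β)] with p' hα hβ
  exact congrArg (p'.1.2 : E p'.1.proj →L[ℝ] ℝ) (A.localBracket_eq hα hβ)

variable [T2Space Q]

/-- Both sides are the value at `p` of `dη` on smooth sections through `x` and `w`, so the
coordinate form is independent of the chart and frame. -/
theorem contactForm_eq_extDeriv (hφ : φ ∈ IsManifold.maximalAtlas (𝓡 n) ∞ Q)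
    (he : IsLocalFrameOn (𝓡 n) (RVec m) ∞ e φ.source) {φ' : OpenPartialHomeomorph Q (RVec n)}
    {e' : Fin m → ∀ q, E q} (hφ' : φ' ∈ IsManifold.maximalAtlas (𝓡 n) ∞ Q)
    (he' : IsLocalFrameOn (𝓡 n) (RVec m) ∞ e' φ'.source) {p : DualLine m E}
    (hp : p.1.proj ∈ φ.source) (hp' : p.1.proj ∈ φ'.source)
    (x w : A.prolongation (dualLineProj n m E) p) :
    A.contactForm e p (A.prolongationCoords φ he p x) (A.prolongationCoords φ he p w) =
      A.contactForm e' p (A.prolongationCoords φ' he' p x) (A.prolongationCoords φ' he' p w) := by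
  obtain ⟨Z, rfl⟩ := exists_section_eq p x
  obtain ⟨W, rfl⟩ := exists_section_eq p w
  rw [← extDeriv_contactSection hφ he hp, ← extDeriv_contactSection hφ' he' hp']

/-- Nondegeneracy for sections; every test vector is the value of a smooth section. Both uniqueness
statements follow from it. -/
theorem section_ext {Z Z' : A.ProlongationSection (dualLineProj n m E)}
    (h : ∀ W p, extDeriv A.contactSection Z W p = extDeriv A.contactSection Z' W p)
    (h' : ∀ p, A.contactSection p (Z.toFun p) = A.contactSection p (Z'.toFun p)) : Z = Z' := by
  refine ProlongationSection.ext (funext fun p => ?_)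
  obtain ⟨φ, hφ, e, he, hp⟩ := exists_chart_frame (n := n) (m := m) (E := E) p.1.proj
  refine prolongation_ext hφ he hp (fun w => ?_) (h' p)
  obtain ⟨W, rfl⟩ := exists_section_eq p w
  rw [← extDeriv_contactSection hφ he hp, ← extDeriv_contactSection hφ he hp, h]

/-- The gluing principle: if two charts offer candidates with the same `dη`-contraction and the same
value of `η`, then they describe the same element of the fibre. -/
theorem prolongationCoords_eq_of_contactForm (hφ : φ ∈ IsManifold.maximalAtlas (𝓡 n) ∞ Q)
    (he : IsLocalFrameOn (𝓡 n) (RVec m) ∞ e φ.source) {φ' : OpenPartialHomeomorph Q (RVec n)}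
    {e' : Fin m → ∀ q, E q} (hφ' : φ' ∈ IsManifold.maximalAtlas (𝓡 n) ∞ Q)
    (he' : IsLocalFrameOn (𝓡 n) (RVec m) ∞ e' φ'.source) {p : DualLine m E}
    (hp : p.1.proj ∈ φ.source) (hp' : p.1.proj ∈ φ'.source)
    {x : A.prolongation (dualLineProj n m E) p} {y y' : (Fin m → ℝ) × RVec m × ℝ}
    (hx : A.prolongationCoords φ he p x = y)
    (h : ∀ w : A.prolongation (dualLineProj n m E) p,
      A.contactForm e p y (A.prolongationCoords φ he p w) =
        A.contactForm e' p y' (A.prolongationCoords φ' he' p w))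
    (h' : y.2.2 - ∑ α, (p.1.2 (e α p.1.proj) : ℝ) * y.1 α =
      y'.2.2 - ∑ α, (p.1.2 (e' α p.1.proj) : ℝ) * y'.1 α) :
    A.prolongationCoords φ' he' p x = y' := by
  subst hx
  refine ext_of_contactForm (A := A) (e := e') (p := p)
    (y := fun α => (p.1.2 (e' α p.1.proj) : ℝ)) (fun w => ?_) ?_
  · obtain ⟨w, rfl⟩ := prolongationCoords_surjective (A := A) hφ' he' hp' w
    exact (contactForm_eq_extDeriv hφ' he' hφ he hp' hp x w).trans (h w)
  · exact (contactSection_apply hφ' he' hp' x).symm.trans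
      ((contactSection_apply hφ he hp x).trans h')

/-- In every chart and frame `(0, 0, 1)`, the direction of `∂/∂s`, has zero contraction with `dη`
and value `1` under `η`. So the local candidates agree. -/
theorem exists_reebSection (A : LieAlgebroid n m E) :
    ∃ R : A.ProlongationSection (dualLineProj n m E),
      ∀ (p : DualLine m E), ∀ φ ∈ IsManifold.maximalAtlas (𝓡 n) ∞ Q, ∀ (e : Fin m → ∀ q, E q)
        (he : IsLocalFrameOn (𝓡 n) (RVec m) ∞ e φ.source), p.1.proj ∈ φ.source →
        A.prolongationCoords φ he p (R.toFun p) = (0, 0, 1) := by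
  have hform : ∀ (e : Fin m → ∀ q, E q) (p : DualLine m E) (w : (Fin m → ℝ) × RVec m × ℝ),
      A.contactForm e p (0, 0, 1) w = 0 := fun e p w => by simp [contactForm]
  have hex : ∀ p : DualLine m E, ∃ x : A.prolongation (dualLineProj n m E) p,
      ∀ φ ∈ IsManifold.maximalAtlas (𝓡 n) ∞ Q, ∀ (e : Fin m → ∀ q, E q)
        (he : IsLocalFrameOn (𝓡 n) (RVec m) ∞ e φ.source), p.1.proj ∈ φ.source →
        A.prolongationCoords φ he p x = (0, 0, 1) := by
    intro p
    obtain ⟨φ, hφ, e, he, hp⟩ := exists_chart_frame (n := n) (m := m) (E := E) p.1.proj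
    obtain ⟨x, hx⟩ := prolongationCoords_surjective (A := A) hφ he hp (0, 0, 1)
    refine ⟨x, fun φ' hφ' e' he' hp' => ?_⟩
    exact prolongationCoords_eq_of_contactForm hφ he hφ' he' hp hp' hx
      (fun w => (hform e p _).trans (hform e' p _).symm) (by simp)
  choose Z hZ using hex
  obtain ⟨R, rfl⟩ := exists_prolongationSection (Z := Z) fun p => by
    obtain ⟨φ, hφ, e, he, hp⟩ := exists_chart_frame (n := n) (m := m) (E := E) p.1.proj
    refine ⟨φ, hφ, e, he, hp, smoothCoordsAt_of_eventuallyEq_smul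
      (contMDiffAt_const (c := (1 : ℝ))) (y := (0, 0, 1)) ?_⟩
    filter_upwards [(isOpen_preimage_source φ).mem_nhds hp] with p' hp'
    rw [hZ p' φ hφ e he hp', one_smul]
  exact ⟨R, hZ⟩

theorem isReebSection_of_coords {R : A.ProlongationSection (dualLineProj n m E)}
    (hR : ∀ (p : DualLine m E), ∀ φ ∈ IsManifold.maximalAtlas (𝓡 n) ∞ Q,
      ∀ (e : Fin m → ∀ q, E q) (he : IsLocalFrameOn (𝓡 n) (RVec m) ∞ e φ.source),
        p.1.proj ∈ φ.source → A.prolongationCoords φ he p (R.toFun p) = (0, 0, 1)) :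
    IsReebSection A.contactSection R := by
  refine ⟨fun Z p => ?_, fun p => ?_⟩ <;>
    obtain ⟨φ, hφ, e, he, hp⟩ := exists_chart_frame (n := n) (m := m) (E := E) p.1.proj
  · rw [extDeriv_contactSection hφ he hp, hR p φ hφ e he hp]
    simp [contactForm]
  · rw [contactSection_apply hφ he hp, hR p φ hφ e he hp]
    simp

/-- With coordinates `(0, 0, 1)` the constraint leaves no base velocity, so the Reeb vector field is
`∂/∂s`. In particular `∂H/∂s` is independent of the chart and frame. -/
theorem mvfderiv_reebSection {R : A.ProlongationSection (dualLineProj n m E)}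
    (hR : ∀ (p : DualLine m E), ∀ φ ∈ IsManifold.maximalAtlas (𝓡 n) ∞ Q,
      ∀ (e : Fin m → ∀ q, E q) (he : IsLocalFrameOn (𝓡 n) (RVec m) ∞ e φ.source),
        p.1.proj ∈ φ.source → A.prolongationCoords φ he p (R.toFun p) = (0, 0, 1))
    (hφ : φ ∈ IsManifold.maximalAtlas (𝓡 n) ∞ Q)
    (he : IsLocalFrameOn (𝓡 n) (RVec m) ∞ e φ.source) {p : DualLine m E}
    (hp : p.1.proj ∈ φ.source) {H : DualLine m E → ℝ}
    (hH : ContMDiff (dualLineModel n m) 𝓘(ℝ, ℝ) ∞ H) :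
    mvfderiv (dualLineModel n m) H p (R.anchor p) = partialS φ he H p := by
  have h1 : (coordVel φ e p (R.anchor p)).2 = (A.prolongationCoords φ he p (R.toFun p)).2 := rfl
  have h2 : ∀ i, (coordVel φ e p (R.anchor p)).1 i =
      ∑ α, A.anchorCoeff φ e i α p.1.proj * (A.prolongationCoords φ he p (R.toFun p)).1 α :=
    coordVel_fst_eq_sum hφ he hp (R.toFun p)
  rw [mvfderiv_eq_coordDeriv hφ he hp hH]
  simp only [h1, h2, hR p φ hφ e he hp]
  simp

/-- In each chart and frame `hamiltonianCoords` has `dη`-contraction `dH - (∂H/∂s) η` and value `-H`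
under `η`. These are intrinsic because `∂H/∂s` is the Reeb derivative of `H`, so the local
candidates agree. -/
theorem exists_hamiltonianSection {R : A.ProlongationSection (dualLineProj n m E)}
    (hR : ∀ (p : DualLine m E), ∀ φ ∈ IsManifold.maximalAtlas (𝓡 n) ∞ Q,
      ∀ (e : Fin m → ∀ q, E q) (he : IsLocalFrameOn (𝓡 n) (RVec m) ∞ e φ.source),
        p.1.proj ∈ φ.source → A.prolongationCoords φ he p (R.toFun p) = (0, 0, 1))
    {H : DualLine m E → ℝ} (hH : ContMDiff (dualLineModel n m) 𝓘(ℝ, ℝ) ∞ H) :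
    ∃ ξ : A.ProlongationSection (dualLineProj n m E),
      ∀ (p : DualLine m E), ∀ φ ∈ IsManifold.maximalAtlas (𝓡 n) ∞ Q, ∀ (e : Fin m → ∀ q, E q)
        (he : IsLocalFrameOn (𝓡 n) (RVec m) ∞ e φ.source), p.1.proj ∈ φ.source →
        A.prolongationCoords φ he p (ξ.toFun p) = A.hamiltonianCoords φ he H p := by
  have hex : ∀ p : DualLine m E, ∃ x : A.prolongation (dualLineProj n m E) p,
      ∀ φ ∈ IsManifold.maximalAtlas (𝓡 n) ∞ Q, ∀ (e : Fin m → ∀ q, E q)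
        (he : IsLocalFrameOn (𝓡 n) (RVec m) ∞ e φ.source), p.1.proj ∈ φ.source →
        A.prolongationCoords φ he p x = A.hamiltonianCoords φ he H p := by
    intro p
    obtain ⟨φ, hφ, e, he, hp⟩ := exists_chart_frame (n := n) (m := m) (E := E) p.1.proj
    obtain ⟨x, hx⟩ := prolongationCoords_surjective (A := A) hφ he hp
      (A.hamiltonianCoords φ he H p)
    refine ⟨x, fun φ' hφ' e' he' hp' => ?_⟩
    refine prolongationCoords_eq_of_contactForm hφ he hφ' he' hp hp' hx
      (fun w => (contactForm_hamiltonianCoords hφ he hp hH w).trans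
        (Eq.trans ?_ (contactForm_hamiltonianCoords hφ' he' hp' hH w).symm)) ?_
    · exact congrArg (fun a : ℝ => mvfderiv (dualLineModel n m) H p w.1.2 -
        a * A.contactSection p w) ((mvfderiv_reebSection hR hφ he hp hH).symm.trans
          (mvfderiv_reebSection hR hφ' he' hp' hH))
    · simp only [hamiltonianCoords, sub_sub_cancel_left]
  choose Z hZ using hex
  obtain ⟨ξ, rfl⟩ := exists_prolongationSection (Z := Z) fun p => by
    obtain ⟨φ, hφ, e, he, hp⟩ := exists_chart_frame (n := n) (m := m) (E := E) p.1.proj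
    have hev : ∀ᶠ p' in 𝓝 p, A.prolongationCoords φ he p' (Z p') =
        A.hamiltonianCoords φ he H p' := by
      filter_upwards [(isOpen_preimage_source φ).mem_nhds hp] with p' hp'
      exact hZ p' φ hφ e he hp'
    have hd := contMDiffAt_coordDeriv hφ he hp hH
    refine ⟨φ, hφ, e, he, hp, fun α => ?_, fun α => ?_, ?_⟩
    · exact (hd _).congr_of_eventuallyEq (hev.mono fun p' h => congrArg (fun y => y.1 α) h)
    · have h1 : ContMDiffAt (dualLineModel n m) 𝓘(ℝ, ℝ) ∞ (fun p' : DualLine m E =>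
          ∑ i, A.anchorCoeff φ e i α p'.1.proj * partialQ φ he H i p') p :=
        contMDiffAt_finsetSum fun i _ => by
          have h2 : ContMDiffAt (dualLineModel n m) 𝓘(ℝ, ℝ) ∞
              (fun p' : DualLine m E => A.anchorCoeff φ e i α p'.1.proj) p :=
            (contMDiffAt_anchorCoeff A hφ he hp i α).comp p
              (dualLineProj n m E).contMDiff.contMDiffAt
          exact h2.mul (hd _)
      have h2 : ContMDiffAt (dualLineModel n m) 𝓘(ℝ, ℝ) ∞ (fun p' : DualLine m E =>
          ∑ β, A.pairedBracket e α β p' * partialY φ he H β p') p :=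
        contMDiffAt_finsetSum fun β _ => (smoothAt_pairedBracket he hp α β).mul (hd _)
      have h3 := (contMDiffAt_fibreCoord he α hp).mul (hd (0, 0, 1))
      exact ((h1.add h2).add h3).neg.congr_of_eventuallyEq
        (hev.mono fun p' h => congrArg (fun y => y.2.1 α) h)
    · have h1 : ContMDiffAt (dualLineModel n m) 𝓘(ℝ, ℝ) ∞ (fun p' : DualLine m E =>
          ∑ α, (p'.1.2 (e α p'.1.proj) : ℝ) * partialY φ he H α p') p :=
        contMDiffAt_finsetSum fun α _ => (contMDiffAt_fibreCoord he α hp).mul (hd _)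
      exact (h1.sub hH.contMDiffAt).congr_of_eventuallyEq
        (hev.mono fun p' h => congrArg (fun y => y.2.2) h)
  exact ⟨ξ, hZ⟩

theorem isHamiltonianSection_of_coords {R ξ : A.ProlongationSection (dualLineProj n m E)}
    (hR : ∀ (p : DualLine m E), ∀ φ ∈ IsManifold.maximalAtlas (𝓡 n) ∞ Q,
      ∀ (e : Fin m → ∀ q, E q) (he : IsLocalFrameOn (𝓡 n) (RVec m) ∞ e φ.source),
        p.1.proj ∈ φ.source → A.prolongationCoords φ he p (R.toFun p) = (0, 0, 1))
    {H : DualLine m E → ℝ} (hH : ContMDiff (dualLineModel n m) 𝓘(ℝ, ℝ) ∞ H)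
    (hξ : ∀ (p : DualLine m E), ∀ φ ∈ IsManifold.maximalAtlas (𝓡 n) ∞ Q,
      ∀ (e : Fin m → ∀ q, E q) (he : IsLocalFrameOn (𝓡 n) (RVec m) ∞ e φ.source),
        p.1.proj ∈ φ.source →
        A.prolongationCoords φ he p (ξ.toFun p) = A.hamiltonianCoords φ he H p) :
    IsHamiltonianSection A.contactSection R H ξ := by
  refine ⟨fun p => ?_, fun Z p => ?_⟩ <;>
    obtain ⟨φ, hφ, e, he, hp⟩ := exists_chart_frame (n := n) (m := m) (E := E) p.1.proj
  · rw [contactSection_apply hφ he hp, hξ p φ hφ e he hp]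
    simp [hamiltonianCoords]
  · refine (extDeriv_contactSection hφ he hp ξ Z).trans
      ((congrArg (fun x => A.contactForm e p x _) (hξ p φ hφ e he hp)).trans
      ((contactForm_hamiltonianCoords hφ he hp hH (Z.toFun p)).trans ?_))
    exact congrArg (fun a : ℝ => mvfderiv (dualLineModel n m) H p (Z.toFun p).1.2 -
      a * A.contactSection p (Z.toFun p)) (mvfderiv_reebSection hR hφ he hp hH).symm

/-- By the chain rule the coordinates of the curve have derivative `coordVel` of the anchored
section. Its fibre and line parts are components of `ξ`; its base part comes from the constraint
`ρ(a) = Tπ(v)`. -/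
theorem contactHamiltonEquationsAt_of_coords {ξ : A.ProlongationSection (dualLineProj n m E)}
    {H : DualLine m E → ℝ} (hφ : φ ∈ IsManifold.maximalAtlas (𝓡 n) ∞ Q)
    (he : IsLocalFrameOn (𝓡 n) (RVec m) ∞ e φ.source)
    {c : ℝ → DualLine m E} {J : Set ℝ} {t : ℝ} (hp : (c t).1.proj ∈ φ.source)
    (hξ : A.prolongationCoords φ he (c t) (ξ.toFun (c t)) = A.hamiltonianCoords φ he H (c t))
    (hc : HasMFDerivWithinAt 𝓘(ℝ, ℝ) (dualLineModel n m) c J t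
      ((1 : ℝ →L[ℝ] ℝ).smulRight (ξ.anchor (c t)))) :
    A.ContactHamiltonEquationsAt φ he H c J t := by
  have h1 := ((contMDiffAt_coords hφ he hp).mdifferentiableAt
    (by simp)).hasMFDerivAt.comp_hasMFDerivWithinAt t hc
  have h2 : HasDerivWithinAt (coords φ e ∘ c) (coordVel φ e (c t) (ξ.anchor (c t))) J t := by
    have h3 : HasFDerivWithinAt (coords φ e ∘ c) ((coordVel φ e (c t)).comp
        ((1 : ℝ →L[ℝ] ℝ).smulRight (ξ.anchor (c t))) : ℝ →L[ℝ] RVec n × RVec m × ℝ) J t :=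
      h1.hasFDerivWithinAt
    refine hasDerivWithinAt_iff_hasFDerivWithinAt.2 (h3.congr_fderiv ?_)
    refine ContinuousLinearMap.ext fun a => ?_
    exact map_smul (coordVel φ e (c t)) a (ξ.anchor (c t))
  have h3 : ∀ l : RVec n × RVec m × ℝ →L[ℝ] ℝ, HasDerivWithinAt (fun t' => l (coords φ e (c t')))
      (l (coordVel φ e (c t) (ξ.anchor (c t)))) J t := fun l =>
    l.hasFDerivAt.comp_hasDerivWithinAt t h2
  have h4 : (coordVel φ e (c t) (ξ.anchor (c t))).2 = (A.hamiltonianCoords φ he H (c t)).2 :=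
    congrArg Prod.snd hξ
  refine ⟨fun i => ?_, fun α => ?_, ?_⟩
  · refine (h3 ((EuclideanSpace.proj i : RVec n →L[ℝ] ℝ).comp
      (ContinuousLinearMap.fst ℝ (RVec n) (RVec m × ℝ)))).congr_deriv ?_
    refine (coordVel_fst_eq_sum hφ he hp (ξ.toFun (c t)) i).trans ?_
    rw [hξ]
    rfl
  · refine (h3 ((EuclideanSpace.proj α : RVec m →L[ℝ] ℝ).comp
      ((ContinuousLinearMap.fst ℝ (RVec m) ℝ).comp
        (ContinuousLinearMap.snd ℝ (RVec n) (RVec m × ℝ))))).congr_deriv ?_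
    refine (congrArg (fun y : RVec m × ℝ => y.1 α) h4).trans ?_
    change -(_ + ∑ β, A.pairedBracket e α β (c t) * partialY φ he H β (c t) + _) = -(_ + _ + _)
    simp only [pairedBracket_eq_sum he hp, Finset.sum_mul]
    rfl
  · refine (h3 ((ContinuousLinearMap.snd ℝ (RVec m) ℝ).comp
        (ContinuousLinearMap.snd ℝ (RVec n) (RVec m × ℝ)))).congr_deriv ?_
    exact congrArg Prod.snd h4

end Hamiltonian

/-! ### Positivity of the top power of a contact form on a Darboux basis. -/

section Wedge

/-- The standard area form on `ℝ²`, on the standard basis. -/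
def boolArea (b c : Bool) : ℝ := if b = c then 0 else if b then -1 else 1

theorem boolArea_perm (ε : Equiv.Perm Bool) :
    boolArea (ε false) (ε true) = ((Equiv.Perm.sign ε : ℤ) : ℝ) := by
  have h : ε = 1 ∨ ε = Equiv.swap false true := by
    revert ε
    decide
  rcases h with rfl | rfl <;> simp [boolArea]

/-- The standard symplectic form on `ℝ^(2 k)`, on a Darboux basis. -/
def darbouxForm {ι : Type*} [DecidableEq ι] (x y : ι × Bool) : ℝ :=
  if x.1 = y.1 then boolArea x.2 y.2 else 0

/-- If the product is nonzero, `ρ` maps each pair onto a pair: it is a permutation of the pairs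
composed with flips inside them. Permuting whole pairs is even, so both the sign and the product
equal the product of the signs of the flips, and the expression is a square. -/
theorem sign_mul_prod_darbouxForm_nonneg {ι : Type*} [DecidableEq ι] [Fintype ι]
    (ρ : Equiv.Perm (ι × Bool)) :
    0 ≤ ((Equiv.Perm.sign ρ : ℤ) : ℝ) * ∏ i, darbouxForm (ρ (i, false)) (ρ (i, true)) := by
  by_cases h0 : ∃ i, darbouxForm (ρ (i, false)) (ρ (i, true)) = 0
  · obtain ⟨i, hi⟩ := h0
    rw [Finset.prod_eq_zero (Finset.mem_univ i) hi, mul_zero]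
  push Not at h0
  have h1 : ∀ i, (ρ (i, true)).1 = (ρ (i, false)).1 := fun i => by
    by_contra h
    exact h0 i (if_neg fun h' => h h'.symm)
  have h2 : ∀ i, (ρ (i, true)).2 = !(ρ (i, false)).2 := fun i => by
    have h : (ρ (i, false)).2 ≠ (ρ (i, true)).2 := fun h => h0 i (by
      rw [darbouxForm, if_pos (h1 i).symm, boolArea, if_pos h])
    revert h
    generalize (ρ (i, false)).2 = b
    generalize (ρ (i, true)).2 = c
    revert b c
    decide
  -- If the images of two pairs had the same index, then `ρ (i, false)` would be `ρ (j, false)` or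
  -- `ρ (j, true)`; either way `i = j`.
  have hinj : Function.Injective fun i => (ρ (i, false)).1 := fun i j hij => by
    by_cases h : (ρ (i, false)).2 = (ρ (j, false)).2
    · exact congrArg Prod.fst (ρ.injective (Prod.ext hij h))
    · refine congrArg Prod.fst (ρ.injective (Prod.ext (hij.trans (h1 j).symm) ?_ :
        ρ (i, false) = ρ (j, true)))
      rw [h2]
      revert h
      generalize (ρ (i, false)).2 = b
      generalize (ρ (j, false)).2 = c
      revert b c
      decide
  let T : Equiv.Perm ι := Equiv.ofBijective _ (Finite.injective_iff_bijective.1 hinj)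
  let ε : ι → Equiv.Perm Bool := fun i => if (ρ (i, false)).2 then Equiv.swap false true else 1
  have hε : ∀ i b, ε i b = (ρ (i, b)).2 := fun i b => by
    cases b
    · by_cases h : (ρ (i, false)).2 = true <;> simp [ε, h]
    · rw [h2]
      by_cases h : (ρ (i, false)).2 = true <;> simp [ε, h]
  have hρ : ρ = (Equiv.prodCongrLeft fun _ : Bool => T) * Equiv.prodCongrRight ε := by
    refine Equiv.ext fun x => Prod.ext ?_ (hε x.1 x.2).symm
    obtain ⟨i, b⟩ := x
    cases b
    · rfl
    · exact h1 i
  have hs : Equiv.Perm.sign ρ = ∏ i, Equiv.Perm.sign (ε i) := by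
    conv_lhs => rw [hρ]
    rw [Equiv.Perm.sign_mul, Equiv.Perm.sign_prodCongrLeft, Equiv.Perm.sign_prodCongrRight]
    simp
  have hp : ∏ i, darbouxForm (ρ (i, false)) (ρ (i, true)) =
      ∏ i, ((Equiv.Perm.sign (ε i) : ℤ) : ℝ) := Finset.prod_congr rfl fun i _ => by
    rw [darbouxForm, if_pos (h1 i).symm, ← hε, ← hε, boolArea_perm]
  rw [hp, hs]
  push_cast
  exact mul_self_nonneg _

/-- As `η` kills the Darboux basis, only permutations fixing `none` matter, and such a permutation
has the sign of its restriction to the pairs. -/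
theorem sign_mul_prod_option_nonneg {ι : Type*} [DecidableEq ι] [Fintype ι]
    {η : Option (ι × Bool) → ℝ} {Ω : Option (ι × Bool) → Option (ι × Bool) → ℝ}
    (hη : η none = 1) (hη' : ∀ x, η (some x) = 0)
    (hΩ : ∀ x y, Ω (some x) (some y) = darbouxForm x y) (τ : Equiv.Perm (Option (ι × Bool))) :
    0 ≤ ((Equiv.Perm.sign τ : ℤ) : ℝ) *
      (η (τ none) * ∏ i, Ω (τ (some (i, false))) (τ (some (i, true)))) := by
  rcases h : τ none with _ | x
  · have hτ : τ = (Equiv.removeNone τ).optionCongr := by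
      rw [map_equiv_removeNone, h, Equiv.swap_self]
      rfl
    rw [hτ, Equiv.optionCongr_sign, hη, one_mul]
    simp only [Equiv.optionCongr_apply, Option.map_some, hΩ]
    exact sign_mul_prod_darbouxForm_nonneg _
  · rw [hη', zero_mul, mul_zero]

/-- No summand is negative and the identity gives `1`, so the exact value of the sum is not needed.
-/
theorem sum_sign_mul_prod_option_pos {ι : Type*} [DecidableEq ι] [Fintype ι]
    {η : Option (ι × Bool) → ℝ} {Ω : Option (ι × Bool) → Option (ι × Bool) → ℝ}
    (hη : η none = 1) (hη' : ∀ x, η (some x) = 0)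
    (hΩ : ∀ x y, Ω (some x) (some y) = darbouxForm x y) :
    0 < ∑ τ : Equiv.Perm (Option (ι × Bool)), ((Equiv.Perm.sign τ : ℤ) : ℝ) *
      (η (τ none) * ∏ i, Ω (τ (some (i, false))) (τ (some (i, true)))) := by
  refine Finset.sum_pos' (fun τ _ => sign_mul_prod_option_nonneg hη hη' hΩ τ)
    ⟨1, Finset.mem_univ _, ?_⟩
  simp [hη, hΩ, darbouxForm, boolArea]

/-- The enumeration of a Darboux basis: `none` comes first, then the pairs. -/
noncomputable def pairIndex (k : ℕ) : Option (Fin k × Bool) ≃ Fin (2 * k + 1) :=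
  Equiv.ofBijective
    (fun o => o.elim 0 fun x => ⟨2 * x.1 + 1 + x.2.toNat, by
      have := x.1.2
      have := Bool.toNat_le x.2
      omega⟩)
    ((Fintype.bijective_iff_injective_and_card _).2 ⟨by
      rintro (_ | ⟨i, b⟩) (_ | ⟨j, c⟩) h
      · rfl
      · have h' : 0 = 2 * (j : ℕ) + 1 + c.toNat := congrArg Fin.val h
        clear h
        omega
      · have h' : 2 * (i : ℕ) + 1 + b.toNat = 0 := congrArg Fin.val h
        clear h
        omega
      · have h' : 2 * (i : ℕ) + 1 + b.toNat = 2 * j + 1 + c.toNat := congrArg Fin.val h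
        have hb := Bool.toNat_le b
        have hc := Bool.toNat_le c
        have hij : i = j := Fin.ext (by omega)
        have hbc : b = c := by cases b <;> cases c <;> simp_all
        rw [hij, hbc], by simp; ring⟩)

/-- Transport along the enumeration `pairIndex`: conjugating a permutation preserves its sign. -/
theorem sum_sign_mul_prod_pos {k : ℕ} {η : Fin (2 * k + 1) → ℝ}
    {Ω : Fin (2 * k + 1) → Fin (2 * k + 1) → ℝ}
    (hη : η (pairIndex k none) = 1) (hη' : ∀ x, η (pairIndex k (some x)) = 0)
    (hΩ : ∀ x y, Ω (pairIndex k (some x)) (pairIndex k (some y)) = darbouxForm x y) :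
    0 < ∑ σ : Equiv.Perm (Fin (2 * k + 1)), ((Equiv.Perm.sign σ : ℤ) : ℝ) *
      (η (σ 0) * ∏ i : Fin k, Ω (σ ⟨2 * i + 1, by omega⟩) (σ ⟨2 * i + 2, by omega⟩)) := by
  refine (sum_sign_mul_prod_option_pos (η := η ∘ pairIndex k)
    (Ω := fun x y => Ω (pairIndex k x) (pairIndex k y)) hη hη' hΩ).trans_eq ?_
  refine Fintype.sum_equiv (pairIndex k).permCongr _ _ fun τ => ?_
  have h0 : (pairIndex k).symm 0 = none := (pairIndex k).symm_apply_eq.2 rfl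
  have h1 : ∀ i : Fin k, (pairIndex k).symm ⟨2 * i + 1, by omega⟩ = some (i, false) := fun i =>
    (pairIndex k).symm_apply_eq.2 rfl
  have h2 : ∀ i : Fin k, (pairIndex k).symm ⟨2 * i + 2, by omega⟩ = some (i, true) := fun i =>
    (pairIndex k).symm_apply_eq.2 rfl
  simp only [Equiv.Perm.sign_permCongr, Equiv.permCongr_apply, h0, h1, h2, Function.comp_apply]

end Wedge

/-! ### A basis adapted to `η`, and the contact condition. -/

section Contact
variable {n m : ℕ} {Q : Type*} [TopologicalSpace Q] [T2Space Q] [ChartedSpace (RVec n) Q]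
  [IsManifold (𝓡 n) ∞ Q]
  {E : Q → Type*} [TopologicalSpace (TotalSpace (RVec m) E)]
  [∀ q, AddCommGroup (E q)] [∀ q, Module ℝ (E q)] [∀ q, TopologicalSpace (E q)]
  [∀ q, IsTopologicalAddGroup (E q)] [∀ q, ContinuousSMul ℝ (E q)]
  [FiberBundle (RVec m) E] [VectorBundle ℝ (RVec m) E] [ContMDiffVectorBundle ∞ (RVec m) E (𝓡 n)]

/-- The components of a basis adapted to `η`: the Reeb direction, and a Darboux basis of `ker η`. -/
noncomputable def darbouxCoords (A : LieAlgebroid n m E) (e : Fin m → ∀ q, E q) (p : DualLine m E) :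
    Option (Fin m × Bool) → (Fin m → ℝ) × RVec m × ℝ
  | none => (0, 0, 1)
  -- The last entry `y_i` places the vector in `ker η`. The half bracket makes two such vectors
  -- `dη`-orthogonal: they pair to `c_{ji}/2 - c_{ij}/2 + c_{ij} = 0`, where `c_{ij} = ⟨b, [e_i,
  -- e_j]⟩` is skew.
  | some (i, false) => (Pi.single i 1, WithLp.toLp 2 fun j => A.pairedBracket e i j p / 2,
      (p.1.2 (e i p.1.proj) : ℝ))
  | some (i, true) => (0, EuclideanSpace.single i 1, 0)

theorem contactForm_darbouxCoords (A : LieAlgebroid n m E) (e : Fin m → ∀ q, E q)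
    (p : DualLine m E) (x y : Fin m × Bool) :
    A.contactForm e p (A.darbouxCoords e p (some x)) (A.darbouxCoords e p (some y)) =
      darbouxForm x y := by
  obtain ⟨i, b⟩ := x
  obtain ⟨j, c⟩ := y
  cases b <;> cases c
  · simp [darbouxCoords, contactForm, darbouxForm, boolArea, Pi.single_apply]
    rw [pairedBracket_skew j i]
    ring
  · refine (contactForm_fibre p _ j).trans ?_
    by_cases h : i = j <;> simp [darbouxCoords, darbouxForm, boolArea, h, eq_comm]
  · by_cases h : i = j <;> simp [darbouxCoords, contactForm, darbouxForm, boolArea, h]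
  · simp [darbouxCoords, contactForm, darbouxForm, boolArea]

/-- The form is evaluated on smooth sections whose values at `p` are the Reeb direction and the
Darboux basis, where the sum over permutations is positive. -/
theorem exists_wedge_ne_zero (A : LieAlgebroid n m E) (p : DualLine m E) :
    ∃ Z : Fin (2 * m + 1) → A.ProlongationSection (dualLineProj n m E),
      wedgeExtDerivPow A.contactSection m Z p ≠ 0 := by
  obtain ⟨φ, hφ, e, he, hp⟩ := exists_chart_frame (n := n) (m := m) (E := E) p.1.proj
  have hZ : ∀ k, ∃ Z : A.ProlongationSection (dualLineProj n m E),
      A.prolongationCoords φ he p (Z.toFun p) = A.darbouxCoords e p ((pairIndex m).symm k) :=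
    fun k => by
      obtain ⟨x, hx⟩ := prolongationCoords_surjective (A := A) hφ he hp
        (A.darbouxCoords e p ((pairIndex m).symm k))
      obtain ⟨Z, rfl⟩ := exists_section_eq p x
      exact ⟨Z, hx⟩
  choose Z hZ using hZ
  have hη : ∀ o, A.contactSection p ((Z (pairIndex m o)).toFun p) =
      (A.darbouxCoords e p o).2.2 -
        ∑ α, (p.1.2 (e α p.1.proj) : ℝ) * (A.darbouxCoords e p o).1 α := fun o => by
    refine (contactSection_apply hφ he hp _).trans ?_
    rw [hZ, Equiv.symm_apply_apply]
  refine ⟨Z, mul_ne_zero (by positivity) (sum_sign_mul_prod_pos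
    (η := fun k => A.contactSection p ((Z k).toFun p))
    (Ω := fun k l => extDeriv A.contactSection (Z k) (Z l) p) ?_ ?_ ?_).ne'⟩
  · refine (hη none).trans ?_
    simp [darbouxCoords]
  · rintro ⟨i, _ | _⟩
    · refine (hη _).trans ?_
      simp [darbouxCoords, Pi.single_apply]
    · refine (hη _).trans ?_
      simp [darbouxCoords]
  · intro x y
    refine (extDeriv_contactSection hφ he hp _ _).trans ?_
    rw [hZ, hZ, Equiv.symm_apply_apply, Equiv.symm_apply_apply]
    exact A.contactForm_darbouxCoords e p x y

theorem isContactSection_contactSection (A : LieAlgebroid n m E) :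
    IsContactSection m A.contactSection where
  finrank_eq p := by
    obtain ⟨φ, hφ, e, he, hp⟩ := exists_chart_frame (n := n) (m := m) (E := E) p.1.proj
    exact finrank_prolongation hφ he hp
  contMDiff := contMDiff_contactSection
  wedge_ne_zero := A.exists_wedge_ne_zero

end Contact
end LieAlgebroid

theorem mainTheorem2 {n m : ℕ} {Q : Type*} [TopologicalSpace Q] [T2Space Q]
    [ChartedSpace (RVec n) Q] [IsManifold (𝓡 n) ∞ Q]
    {E : Q → Type*} [TopologicalSpace (TotalSpace (RVec m) E)]
    [∀ q, AddCommGroup (E q)] [∀ q, Module ℝ (E q)] [∀ q, TopologicalSpace (E q)]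
    [∀ q, IsTopologicalAddGroup (E q)] [∀ q, ContinuousSMul ℝ (E q)]
    [FiberBundle (RVec m) E] [VectorBundle ℝ (RVec m) E]
    [ContMDiffVectorBundle ∞ (RVec m) E (𝓡 n)]
    (A : LieAlgebroid n m E) :
    LieAlgebroid.IsContactSection m A.contactSection ∧
    ∃ R : A.ProlongationSection (LieAlgebroid.dualLineProj n m E),
      LieAlgebroid.IsReebSection A.contactSection R ∧
      (∀ R', LieAlgebroid.IsReebSection A.contactSection R' → R' = R) ∧
      ∀ H : C^∞⟮LieAlgebroid.dualLineModel n m, LieAlgebroid.DualLine m E; ℝ⟯,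
        ∃ ξ : A.ProlongationSection (LieAlgebroid.dualLineProj n m E),
          LieAlgebroid.IsHamiltonianSection A.contactSection R H ξ ∧
          (∀ ξ', LieAlgebroid.IsHamiltonianSection A.contactSection R H ξ' → ξ' = ξ) ∧
          ∀ φ ∈ IsManifold.maximalAtlas (𝓡 n) ∞ Q, ∀ (e : Fin m → ∀ q, E q)
            (he : IsLocalFrameOn (𝓡 n) (RVec m) ∞ e φ.source)
            (J : Set ℝ) (c : ℝ → LieAlgebroid.DualLine m E),
            IsMIntegralCurveOn c ξ.anchor J →
            ∀ t ∈ J, (c t).1.proj ∈ φ.source →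
              A.ContactHamiltonEquationsAt φ he H c J t := by
  refine ⟨A.isContactSection_contactSection, ?_⟩
  obtain ⟨R, hR⟩ := LieAlgebroid.exists_reebSection A
  have hReeb := LieAlgebroid.isReebSection_of_coords hR
  refine ⟨R, hReeb, fun R' hR' => ?_, fun H => ?_⟩
  · exact LieAlgebroid.section_ext (fun W p => (hR'.1 W p).trans (hReeb.1 W p).symm)
      fun p => (hR'.2 p).trans (hReeb.2 p).symm
  obtain ⟨ξ, hξ⟩ := LieAlgebroid.exists_hamiltonianSection hR H.contMDiff
  have hHam := LieAlgebroid.isHamiltonianSection_of_coords hR H.contMDiff hξ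
  refine ⟨ξ, hHam, fun ξ' hξ' => ?_, fun φ hφ e he J c hc t ht hp => ?_⟩
  · exact LieAlgebroid.section_ext (fun W p => (hξ'.2 W p).trans (hHam.2 W p).symm)
      fun p => (hξ'.1 p).trans (hHam.1 p).symm
  · exact LieAlgebroid.contactHamiltonEquationsAt_of_coords hφ he hp
      (hξ (c t) φ hφ e he hp) (hc t ht)
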